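/- A \emph{multilevel assignment} of a directed graph $G=(V,E)$ is a function $\ell$ that assigns a finite set of integers $\ell(v)\subset\mathbb Z$ to each vertex $v$. A drawing of $G$ is \emph{multilevel planar} with respect to $\ell$ if it is planar, each edge $(u,v)\in E$ is drawn as a strictly $y$-monotone curve rising from $u$ to $v$, and the $y$-coordinate of each vertex $v$ belongs to $\ell(v)$. An \emph{oriented cycle} is a directed graph without loops and antiparallel edges whose underlying undirected graph is a simple cycle (on at least three vertices). \textbf{Theorem.} Let $G$ be an oriented cycle together with a multilevel assignment $\ell$. Then it can be decided in linear time whether $G$ admits a drawing that is multilevel planar with respect to $\ell$. Furthermore, if such a drawing exists, one can be computed within the same time. Here $G$ is given by the number $n$ of its vertices $0,\dots,n-1$ and the list of its edges in arbitrary order, and each set $\ell(v)$ is given as a finite list of integer intervals $[a,b]=\{k\in\mathbb Z: a\le k\le b\}$ with that union, in arbitrary order and possibly empty or overlapping. More precisely, there are a single program for a random access machine (uniform cost model, with addition, subtraction, comparison, and indirect addressing of integer memory cells) and a constant $C$ such that, for every such input, the program halts after at most $C\cdot N$ steps, where $N$ is the number of integers of the input, so that $N=\Theta(n+k)$ with $k$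 the total number of intervals. It outputs $0$ if no multilevel-planar drawing of $G$ with respect to $\ell$ exists, and otherwise outputs $1$ followed by such a drawing, given by the rational coordinates of the vertices and, for each edge, of the bends of the polyline that represents it. -/

import Mathlib

namespace MultilevelPlanarity

/-! ### Oriented cycles, drawings, multilevel planarity -/

/-- An oriented cycle: a directed graph without loops and antiparallel edges whose underlying
undirected graph is a simple cycle (on at least three vertices). -/
structure IsOrientedCycle {V : Type*} [Fintype V] (G : Digraph V) : Prop where
  loopless : ∀ v, ¬ G.Adj v v
  oriented : ∀ u v, G.Adj u v → ¬ G.Adj v u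
  three_le : 3 ≤ Fintype.card V
  isCycle : Nonempty (G.toSimpleGraphInclusive ≃g SimpleGraph.cycleGraph (Fintype.card V))

/-- A drawing of a directed graph in the plane: every vertex is a point, every edge is a simple
open curve that leads from its tail to its head. -/
structure Drawing {V : Type*} (G : Digraph V) where
  pos : V → ℝ × ℝ
  curve : ∀ {u v : V}, G.Adj u v → Path (pos u) (pos v)
  simple : ∀ {u v : V} (h : G.Adj u v), Function.Injective (curve h)

namespace Drawing

variable {V : Type*} {G : Digraph V}

/-- The drawing has no crossings: distinct vertices are distinct points, a curve passes through
the points of its two end vertices only, and the curves of two distinct edges meet at most in the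
points of common end vertices. -/
structure IsPlanar (D : Drawing G) : Prop where
  pos_injective : Function.Injective D.pos
  vertex_on_curve : ∀ {u v : V} (h : G.Adj u v) (w : V),
    D.pos w ∈ Set.range (D.curve h) → w = u ∨ w = v
  curves_disjoint : ∀ {u v u' v' : V} (h : G.Adj u v) (h' : G.Adj u' v'), (u, v) ≠ (u', v') →
    ∀ x ∈ Set.range (D.curve h) ∩ Set.range (D.curve h'),
      ∃ w : V, (w = u ∨ w = v) ∧ (w = u' ∨ w = v') ∧ x = D.pos w

/-- Every edge is a strictly `y`-monotone curve that rises from its tail to its head. -/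
def IsUpward (D : Drawing G) : Prop :=
  ∀ {u v : V} (h : G.Adj u v), StrictMono fun t => (D.curve h t).2

/-- Multilevel-planar drawings with respect to a multilevel assignment `ℓ`: upward-planar
drawings in which the `y`-coordinate of every vertex `v` belongs to `ℓ v`. -/
structure IsMultilevelPlanar (D : Drawing G) (ℓ : V → Finset ℤ) : Prop where
  planar : D.IsPlanar
  upward : D.IsUpward
  level : ∀ v, ∃ k ∈ ℓ v, (D.pos v).2 = (k : ℝ)

end Drawing

/-! ### Input data -/

/-- The set of integers given by a finite list of integer intervals `[a, b]`. -/
noncomputable def levelSet (L : List (ℤ × ℤ)) : Finset ℤ :=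
  L.toFinset.biUnion fun I => Finset.Icc I.1 I.2

/-- Input data on the vertices `0, …, n - 1`: a list of directed edges and, for every vertex,
a list of integer intervals. -/
structure Input (n : ℕ) where
  edges : List (Fin n × Fin n)
  intervals : Fin n → List (ℤ × ℤ)

namespace Input

variable {n : ℕ}

/-- The input lists every edge of `G` exactly once, in any order, and for every vertex `v` a
decomposition of `ℓ v` into finitely many intervals (unsorted and possibly overlapping). -/
structure Represents (I : Input n) (G : Digraph (Fin n)) (ℓ : Fin n → Finset ℤ) : Prop where
  nodup : I.edges.Nodup
  mem_edges : ∀ u v, (u, v) ∈ I.edges ↔ G.Adj u v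
  levels : ∀ v, ℓ v = levelSet (I.intervals v)

/-- The input as a sequence of integers: the number of vertices, the number of edges, tail and
head of every edge, and for every vertex the number of its intervals and their end points. -/
def encode (I : Input n) : List ℤ :=
  (n : ℤ) :: (I.edges.length : ℤ) ::
    (I.edges.flatMap (fun e => [((e.1 : ℕ) : ℤ), ((e.2 : ℕ) : ℤ)]) ++
      (List.finRange n).flatMap fun v =>
        ((I.intervals v).length : ℤ) :: (I.intervals v).flatMap fun J => [J.1, J.2])

/-- The size of the input: the number of integers it consists of. With `m` edges and `k`
intervals altogether this is `2 + 2 * m + n + 2 * k`. -/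
def size (I : Input n) : ℕ := I.encode.length

end Input

/-! ### Output data: polyline drawings with rational coordinates -/

/-- The point of the real plane with the given rational coordinates. -/
def toPlane (p : ℚ × ℚ) : ℝ × ℝ := ((p.1 : ℝ), (p.2 : ℝ))

/-- The polyline through a sequence of points: the union of the segments between consecutive
points. -/
def polyline : List (ℝ × ℝ) → Set (ℝ × ℝ)
  | [] => ∅
  | [p] => {p}
  | p :: q :: l => segment ℝ p q ∪ polyline (q :: l)

/-- Data of a polyline drawing: the positions of the vertices, and for every edge the sequence of
its bends, from tail to head. -/
structure PolylineData (n : ℕ) where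
  pos : Fin n → ℚ × ℚ
  bends : Fin n × Fin n → List (ℚ × ℚ)

namespace PolylineData

variable {n : ℕ}

/-- The drawing `D` is the one described by the data `P`. -/
structure Describes (P : PolylineData n) {G : Digraph (Fin n)} (D : Drawing G) : Prop where
  pos_eq : ∀ v, D.pos v = toPlane (P.pos v)
  curve_eq : ∀ {u v : Fin n} (h : G.Adj u v), Set.range (D.curve h) =
    polyline ((P.pos u :: (P.bends (u, v) ++ [P.pos v])).map toPlane)

/-- A point with rational coordinates as four integers: numerators and denominators. -/
def encodePoint (p : ℚ × ℚ) : List ℤ :=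
  [p.1.num, (p.1.den : ℤ), p.2.num, (p.2.den : ℤ)]

/-- The data as a sequence of integers: the positions of the vertices, followed by the number of
bends and the bends of every edge, in the order of the given list of edges. -/
def encode (P : PolylineData n) (edges : List (Fin n × Fin n)) : List ℤ :=
  (List.finRange n).flatMap (fun v => encodePoint (P.pos v)) ++
    edges.flatMap fun e => ((P.bends e).length : ℤ) :: (P.bends e).flatMap encodePoint

end PolylineData

/-! ### Random access machines

Structured programs for a random access machine in the uniform cost model. The machine holds
integers in registers and in arrays with indirect addressing; its only arithmetic operations are
addition and subtraction. Every operation takes one step. -/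

namespace RAM

/-- Contents of the registers, contents of the arrays, and the output written so far. -/
structure State where
  reg : ℕ → ℤ
  arr : ℕ → ℤ → ℤ
  out : List ℤ

/-- Integer terms: a constant, a register, a cell of an array, sums, differences. The names of
registers and arrays are fixed in the program, only the index of a cell is computed. -/
inductive Term where
  | const (z : ℤ)
  | reg (x : ℕ)
  | cell (a : ℕ) (i : Term)
  | add (e f : Term)
  | sub (e f : Term)

namespace Term

def eval (s : State) : Term → ℤ
  | const z => z
  | reg x => s.reg x
  | cell a i => s.arr a (i.eval s)
  | add e f => e.eval s + f.eval s
  | sub e f => e.eval s - f.eval s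

def cost : Term → ℕ
  | const _ => 1
  | reg _ => 1
  | cell _ i => i.cost + 1
  | add e f => e.cost + f.cost + 1
  | sub e f => e.cost + f.cost + 1

end Term

/-- Tests for branching. -/
inductive Test where
  | le (e f : Term)
  | eq (e f : Term)
  | not (b : Test)
  | and (b c : Test)

namespace Test

def Holds (s : State) : Test → Prop
  | le e f => e.eval s ≤ f.eval s
  | eq e f => e.eval s = f.eval s
  | not b => ¬ b.Holds s
  | and b c => b.Holds s ∧ c.Holds s

def cost : Test → ℕ
  | le e f => e.cost + f.cost + 1
  | eq e f => e.cost + f.cost + 1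
  | not b => b.cost + 1
  | and b c => b.cost + c.cost + 1

end Test

/-- Programs: do nothing, assign to a register, write to a cell of an array, append an integer to
the output, and the usual control structures. -/
inductive Program where
  | skip
  | assign (x : ℕ) (e : Term)
  | write (a : ℕ) (i e : Term)
  | output (e : Term)
  | seq (p q : Program)
  | ite (b : Test) (p q : Program)
  | while (b : Test) (p : Program)

/-- `Exec p s t s'`: started in the state `s`, the program `p` halts after exactly `t` steps in
the state `s'`. -/
inductive Exec : Program → State → ℕ → State → Prop where
  | skip (s : State) : Exec .skip s 1 s
  | assign (x : ℕ) (e : Term) (s : State) :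
      Exec (.assign x e) s (e.cost + 1) { s with reg := Function.update s.reg x (e.eval s) }
  | write (a : ℕ) (i e : Term) (s : State) :
      Exec (.write a i e) s (i.cost + e.cost + 1)
        { s with arr := Function.update s.arr a
                          (Function.update (s.arr a) (i.eval s) (e.eval s)) }
  | output (e : Term) (s : State) :
      Exec (.output e) s (e.cost + 1) { s with out := s.out ++ [e.eval s] }
  | seq {p q : Program} {s₁ s₂ s₃ : State} {t₁ t₂ : ℕ} (hp : Exec p s₁ t₁ s₂)
      (hq : Exec q s₂ t₂ s₃) : Exec (.seq p q) s₁ (t₁ + t₂) s₃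
  | ite_true {b : Test} {p q : Program} {s s' : State} {t : ℕ} (hb : b.Holds s)
      (hp : Exec p s t s') : Exec (.ite b p q) s (b.cost + 1 + t) s'
  | ite_false {b : Test} {p q : Program} {s s' : State} {t : ℕ} (hb : ¬ b.Holds s)
      (hq : Exec q s t s') : Exec (.ite b p q) s (b.cost + 1 + t) s'
  | while_true {b : Test} {p : Program} {s₁ s₂ s₃ : State} {t₁ t₂ : ℕ} (hb : b.Holds s₁)
      (hp : Exec p s₁ t₁ s₂) (hw : Exec (.while b p) s₂ t₂ s₃) :
      Exec (.while b p) s₁ (b.cost + 1 + t₁ + t₂) s₃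
  | while_false {b : Test} {p : Program} {s : State} (hb : ¬ b.Holds s) :
      Exec (.while b p) s (b.cost + 1) s

/-- The initial state: the input stands in the cells `0, 1, 2, …` of the array `0`, everything
else is zero, and nothing has been output. -/
def init (w : List ℤ) : State where
  reg := fun _ => 0
  arr := fun a i => if a = 0 ∧ 0 ≤ i then w.getD i.toNat 0 else 0
  out := []

/-- On the input `w` the program `p` halts after exactly `t` steps with the output `o`. -/
def Computes (p : Program) (w : List ℤ) (t : ℕ) (o : List ℤ) : Prop :=
  ∃ s : State, Exec p (init w) t s ∧ s.out = o

end RAM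

end MultilevelPlanarity

/-! The heights of the vertices in a drawing form a leveling: integers from the level sets that
increase along every edge. If levelings exist, there is a lowest one, found greedily by relaxing the
edges in topological order, and by reflection a highest one. Let `m` be the smallest lowest level
and `M` the largest highest level. A vertex is forced to the bottom if its highest level is `m`, and
forced to the top if its lowest level is `M`. A forced vertex has the same height in every leveling.

Obstruction. Suppose that vertices forced to bottom, top, bottom, top follow each other in this
order around the cycle. The four arcs between them stay in the strip between `m` and `M`, and
opposite arcs are disjoint. Two disjoint curves from the lower to the upper border of a strip appear
in the same order on both borders (`JoinedIn.strip_lt`, proved with a continuous argument of the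
difference of the two curves). The two pairs of opposite arcs then demand contradictory orders
(`Drawing.not_alternating`).

Construction. Mark the forced vertices and in addition one chosen vertex on each side: a vertex
whose lowest level is `m`, and a vertex whose highest level is `M`. Ties are broken in such a way
that two marks on the same side are always both forced (`IsExtreme.forced`), so alternating marks
exclude a drawing (`IsExtreme.not_drawable`). If the marks do not alternate, the cycle splits into
two paths: one starts at a bottom mark and contains no top mark, the other starts at a top mark and
contains no bottom mark. The first is placed on the left at its lowest levels, the second on the
right at its highest levels. The first stays strictly below `M`, so one connecting edge passes above
it; the second stays strictly above `m`, so the other connecting edge passes below it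
(`IsExtreme.isLayout`, `IsLayout.exists_drawing`).

Linear time. On a cycle every vertex has two edges, so the sum of their indices suffices to walk
around, and a topological order is read off from a walk that starts at a source. Relaxing an edge
scans the intervals of its head once. A vertex is the head of at most two edges, so all scans
together are linear (`RAM.sum_heads_le`). The program is verified by a calculus of invariants with
step bounds (`RAM.Runs`). -/

namespace MultilevelPlanarity
namespace RAM

/-! ### Reasoning about programs -/

/-- Started in `s`, the program `p` halts within `B` steps in a state that satisfies `Q`. -/
def Runs (p : Program) (s : State) (B : ℕ) (Q : State → Prop) : Prop :=
  ∃ (t : ℕ) (s' : State), Exec p s t s' ∧ t ≤ B ∧ Q s'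

namespace Program

/-- Loop-free programs. -/
def LoopFree : Program → Bool
  | skip => true
  | assign _ _ => true
  | write _ _ _ => true
  | output _ => true
  | seq p q => p.LoopFree && q.LoopFree
  | ite _ p q => p.LoopFree && q.LoopFree
  | .while _ _ => false

/-- A bound for the number of steps of a loop-free program. -/
def bound : Program → ℕ
  | skip => 1
  | assign _ e => e.cost + 1
  | write _ i e => i.cost + e.cost + 1
  | output e => e.cost + 1
  | seq p q => p.bound + q.bound
  | ite b p q => b.cost + 1 + (p.bound + q.bound)
  | .while b _ => b.cost + 1

open Classical in
/-- The final state of a loop-free program. -/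
noncomputable def run : Program → State → State
  | skip, s => s
  | assign x e, s => { s with reg := Function.update s.reg x (e.eval s) }
  | write a i e, s =>
    { s with arr := Function.update s.arr a (Function.update (s.arr a) (i.eval s) (e.eval s)) }
  | output e, s => { s with out := s.out ++ [e.eval s] }
  | seq p q, s => q.run (p.run s)
  | ite b p q, s => if b.Holds s then p.run s else q.run s
  | .while _ _, s => s

/-- The program never assigns to the register `x`. -/
def keepsReg (x : ℕ) : Program → Bool
  | skip => true
  | assign y _ => y != x
  | write _ _ _ => true
  | output _ => true
  | seq p q => p.keepsReg x && q.keepsReg x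
  | ite _ p q => p.keepsReg x && q.keepsReg x
  | .while _ p => p.keepsReg x

/-- The program never writes to the array `a`. -/
def keepsArr (a : ℕ) : Program → Bool
  | skip => true
  | assign _ _ => true
  | write b _ _ => b != a
  | output _ => true
  | seq p q => p.keepsArr a && q.keepsArr a
  | ite _ p q => p.keepsArr a && q.keepsArr a
  | .while _ p => p.keepsArr a

/-- The program produces no output. -/
def silent : Program → Bool
  | skip => true
  | assign _ _ => true
  | write _ _ _ => true
  | output _ => false
  | seq p q => p.silent && q.silent
  | ite _ p q => p.silent && q.silent
  | .while _ p => p.silent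

/-- The state `s'` agrees with `s` on everything that the program does not change. -/
structure Frame (p : Program) (s s' : State) : Prop where
  reg : ∀ x, p.keepsReg x = true → s'.reg x = s.reg x
  arr : ∀ a, p.keepsArr a = true → s'.arr a = s.arr a
  out : p.silent = true → s'.out = s.out

theorem Frame.refl (p : Program) (s : State) : Frame p s s :=
  ⟨fun _ _ => rfl, fun _ _ => rfl, fun _ => rfl⟩

theorem Frame.trans {p : Program} {s₁ s₂ s₃ : State} (h : Frame p s₁ s₂) (h' : Frame p s₂ s₃) :
    Frame p s₁ s₃ :=
  ⟨fun x hx => (h'.reg x hx).trans (h.reg x hx), fun a ha => (h'.arr a ha).trans (h.arr a ha),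
    fun ho => (h'.out ho).trans (h.out ho)⟩

theorem Frame.seq_left {p q : Program} {s s' : State} (h : Frame p s s') :
    Frame (.seq p q) s s' := by
  constructor
  · intro x hx; simp only [keepsReg, Bool.and_eq_true] at hx; exact h.reg x hx.1
  · intro x hx; simp only [keepsArr, Bool.and_eq_true] at hx; exact h.arr x hx.1
  · intro hx; simp only [silent, Bool.and_eq_true] at hx; exact h.out hx.1

theorem Frame.seq_right {p q : Program} {s s' : State} (h : Frame q s s') :
    Frame (.seq p q) s s' := by
  constructor
  · intro x hx; simp only [keepsReg, Bool.and_eq_true] at hx; exact h.reg x hx.2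
  · intro x hx; simp only [keepsArr, Bool.and_eq_true] at hx; exact h.arr x hx.2
  · intro hx; simp only [silent, Bool.and_eq_true] at hx; exact h.out hx.2

theorem exec_run (p : Program) (hp : p.LoopFree = true) (s : State) :
    ∃ t, Exec p s t (p.run s) ∧ t ≤ p.bound := by
  induction p generalizing s with
  | skip => exact ⟨_, .skip s, le_rfl⟩
  | assign x e => exact ⟨_, .assign x e s, le_rfl⟩
  | write a i e => exact ⟨_, .write a i e s, le_rfl⟩
  | output e => exact ⟨_, .output e s, le_rfl⟩
  | seq p q ihp ihq =>
    simp only [LoopFree, Bool.and_eq_true] at hp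
    obtain ⟨t, h, ht⟩ := ihp hp.1 s
    obtain ⟨t', h', ht'⟩ := ihq hp.2 (p.run s)
    exact ⟨_, .seq h h', by simp only [bound]; omega⟩
  | ite b p q ihp ihq =>
    simp only [LoopFree, Bool.and_eq_true] at hp
    by_cases hb : b.Holds s
    · obtain ⟨t, h, ht⟩ := ihp hp.1 s
      exact ⟨_, by simpa only [run, if_pos hb] using Exec.ite_true hb h, by
        simp only [bound]; omega⟩
    · obtain ⟨t, h, ht⟩ := ihq hp.2 s
      exact ⟨_, by simpa only [run, if_neg hb] using Exec.ite_false hb h, by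
        simp only [bound]; omega⟩
  | _ => simp [LoopFree] at hp

end Program

open Program

/-- Which registers and arrays may change is computed from the program text alone. Hence what a run
preserves, loops included, can be settled by evaluating a Boolean, usually with `rfl`. -/
theorem Exec.frame {p : Program} {s s' : State} {t : ℕ} (h : Exec p s t s') : Frame p s s' := by
  induction h with
  | skip s => exact Frame.refl _ s
  | assign x e s =>
    refine ⟨fun y hy => ?_, fun _ _ => rfl, fun _ => rfl⟩
    have : y ≠ x := by rintro rfl; simp [keepsReg] at hy
    simp [this]
  | write a i e s =>
    refine ⟨fun _ _ => rfl, fun b hb => ?_, fun _ => rfl⟩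
    have : b ≠ a := by rintro rfl; simp [keepsArr] at hb
    simp [this]
  | output e s => exact ⟨fun _ _ => rfl, fun _ _ => rfl, fun h => by simp [silent] at h⟩
  | seq _ _ ihp ihq => exact ihp.seq_left.trans ihq.seq_right
  | ite_true _ _ ih =>
    exact ⟨fun x hx => ih.reg x (by simp_all [keepsReg]),
      fun x hx => ih.arr x (by simp_all [keepsArr]), fun hx => ih.out (by simp_all [silent])⟩
  | ite_false _ _ ih =>
    exact ⟨fun x hx => ih.reg x (by simp_all [keepsReg]),
      fun x hx => ih.arr x (by simp_all [keepsArr]), fun hx => ih.out (by simp_all [silent])⟩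
  | while_true _ _ _ ihp ihw =>
    exact Frame.trans ⟨ihp.reg, ihp.arr, ihp.out⟩ ihw
  | while_false _ => exact Frame.refl _ _

namespace Runs

theorem mono {p : Program} {s : State} {B B' : ℕ} {Q Q' : State → Prop} (h : Runs p s B Q)
    (hB : B ≤ B') (hQ : ∀ s', Frame p s s' → Q s' → Q' s') : Runs p s B' Q' := by
  obtain ⟨t, s', he, ht, hq⟩ := h
  exact ⟨t, s', he, ht.trans hB, hQ s' he.frame hq⟩

theorem of_run {p : Program} (hp : p.LoopFree = true) {s : State} {Q : State → Prop}
    (h : Q (p.run s)) : Runs p s p.bound Q := by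
  obtain ⟨t, he, ht⟩ := p.exec_run hp s
  exact ⟨t, _, he, ht, h⟩

theorem seq {p q : Program} {s : State} {B B' : ℕ} {Q R : State → Prop} (h : Runs p s B Q)
    (h' : ∀ s', Frame p s s' → Q s' → Runs q s' B' R) : Runs (.seq p q) s (B + B') R := by
  obtain ⟨t, s', he, ht, hq⟩ := h
  obtain ⟨t', s'', he', ht', hr⟩ := h' s' he.frame hq
  exact ⟨_, s'', .seq he he', by omega, hr⟩

theorem ite {b : Test} {p q : Program} {s : State} {B : ℕ} {Q : State → Prop}
    (h : b.Holds s → Runs p s B Q) (h' : ¬ b.Holds s → Runs q s B Q) :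
    Runs (.ite b p q) s (b.cost + 1 + B) Q := by
  by_cases hb : b.Holds s
  · obtain ⟨t, s', he, ht, hq⟩ := h hb
    exact ⟨_, s', .ite_true hb he, by omega, hq⟩
  · obtain ⟨t, s', he, ht, hq⟩ := h' hb
    exact ⟨_, s', .ite_false hb he, by omega, hq⟩

/-- A loop that performs `N` rounds, the `k`-th of which takes at most `c k` steps. -/
theorem loop {b : Test} {p : Program} {s : State} (N : ℕ) (c : ℕ → ℕ) (J : ℕ → State → Prop)
    (h0 : J 0 s)
    (hstep : ∀ k < N, ∀ s', Frame p s s' → J k s' → b.Holds s' ∧ Runs p s' (c k) (J (k + 1)))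
    (hend : ∀ s', Frame p s s' → J N s' → ¬ b.Holds s') :
    Runs (.while b p) s (∑ k ∈ Finset.range N, (b.cost + 1 + c k) + (b.cost + 1)) (J N) := by
  -- Induction on the number `j` of rounds that remain, with the current round `k` general, since
  -- `Exec` unfolds a loop from its first round.
  suffices H : ∀ j k, k + j = N → ∀ s', Frame p s s' → J k s' →
      Runs (.while b p) s' (∑ i ∈ Finset.range j, (b.cost + 1 + c (k + i)) + (b.cost + 1)) (J N) by
    simpa using H N 0 (by omega) s (Frame.refl p s) h0
  intro j
  induction j with
  | zero =>
    intro k hk s' hf hJ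
    obtain rfl : k = N := by omega
    exact ⟨_, s', .while_false (hend s' hf hJ), by simp, hJ⟩
  | succ j ih =>
    intro k hk s' hf hJ
    obtain ⟨hb, t, s'', he, ht, hJ'⟩ := hstep k (by omega) s' hf hJ
    obtain ⟨t', s₃, he', ht', hJ''⟩ := ih (k + 1) (by omega) s'' (hf.trans he.frame) hJ'
    refine ⟨_, s₃, .while_true hb he he', ?_, hJ''⟩
    rw [Finset.sum_range_succ']
    simp only [add_zero]
    have : ∑ i ∈ Finset.range j, (b.cost + 1 + c (k + (i + 1))) =
        ∑ i ∈ Finset.range j, (b.cost + 1 + c (k + 1 + i)) :=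
      Finset.sum_congr rfl fun i _ => by rw [show k + (i + 1) = k + 1 + i by omega]
    omega

/-- A loop with a loop-free body that performs `N` rounds. -/
theorem loop_run {b : Test} {p : Program} {s : State} (hp : p.LoopFree = true) (N : ℕ)
    (J : ℕ → State → Prop) (h0 : J 0 s)
    (hstep : ∀ k < N, ∀ s', Frame p s s' → J k s' → b.Holds s' ∧ J (k + 1) (p.run s'))
    (hend : ∀ s', Frame p s s' → J N s' → ¬ b.Holds s') :
    Runs (.while b p) s ((b.cost + 1 + p.bound) * (N + 1)) (J N) := by
  refine (loop N (fun _ => p.bound) J h0 (fun k hk s' hf hJ => ?_) hend).mono ?_ fun _ _ h => h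
  · obtain ⟨hb, hJ'⟩ := hstep k hk s' hf hJ
    exact ⟨hb, of_run hp hJ'⟩
  · simp only [Finset.sum_const, Finset.card_range, smul_eq_mul]
    ring_nf
    omega

end Runs

end RAM
namespace RAM

/-! ### The program

Registers: `0` and `1` hold the numbers of vertices and edges, `2` is the counter of the outer
loops, `9` is set when some vertex has no admissible level. Arrays: `0` input, `1` sum of the
indices of the edges at a vertex, `2` marks vertices with an incoming edge, `3` position of the
intervals of a vertex in the input, `4` cyclic sequence of the vertices, `5` edges in topological
order, `6` lowest levels, `7` negated highest levels, `8` and `9` coordinates of the vertices.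
A Boolean parameter `σ` selects the original problem or its image under reflection in the
horizontal axis. -/

infixr:60 ";;" => Program.seq

/-- Disjunction of tests. -/
def Test.or (b c : Test) : Test := .not (.and (.not b) (.not c))

/-- Strict comparison. -/
def Test.lt (e f : Term) : Test := .not (.le f e)

@[simp] theorem Test.holds_or (s : State) (b c : Test) :
    (Test.or b c).Holds s ↔ b.Holds s ∨ c.Holds s := by
  simp only [Test.or, Test.Holds]; tauto

@[simp] theorem Test.holds_lt (s : State) (e f : Term) :
    (Test.lt e f).Holds s ↔ e.eval s < f.eval s := by
  simp [Test.lt, Test.Holds]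

open Program Term Test

def tailTerm (e : Term) : Term := cell 0 (add (const 2) (add e e))

def headTerm (e : Term) : Term := cell 0 (add (const 3) (add e e))

/-- Tail of an edge after reflection. -/
def tl : Bool → Term → Term
  | true, e => tailTerm e
  | false, e => headTerm e

/-- Head of an edge after reflection. -/
def hd : Bool → Term → Term
  | true, e => headTerm e
  | false, e => tailTerm e

/-- Lower end of an interval after reflection. -/
def lo : Bool → Term → Term
  | true, e => cell 0 e
  | false, e => sub (const 0) (cell 0 (add e (const 1)))

/-- Upper end of an interval after reflection. -/
def hi : Bool → Term → Term
  | true, e => cell 0 (add e (const 1))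
  | false, e => sub (const 0) (cell 0 e)

/-- Array of the lowest levels. -/
def lev : Bool → ℕ
  | true => 6
  | false => 7

/-- Register of the position of the chosen lowest vertex. -/
def base : Bool → ℕ
  | true => 20
  | false => 21

def incr (x : ℕ) : Program := assign x (add (reg x) (const 1))

/-- Repeat `p` with the counter in register `2` running through `0, …, e - 1`. -/
def forLoop (e : Term) (p : Program) : Program :=
  assign 2 (const 0) ;; .while (lt (reg 2) e) (p ;; incr 2)

/-- Every vertex of a cycle has exactly two edges. Their sum determines one from the other by a
subtraction, so no adjacency lists are needed. -/
def incidenceStep : Program :=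
  assign 30 (tailTerm (reg 2)) ;; assign 31 (headTerm (reg 2)) ;;
  write 1 (reg 30) (add (cell 1 (reg 30)) (reg 2)) ;;
  write 1 (reg 31) (add (cell 1 (reg 31)) (reg 2)) ;;
  write 2 (reg 31) (const 1)

def sourceStep : Program :=
  ite (eq (cell 2 (tailTerm (reg 2))) (const 0)) (assign 3 (reg 2) ;; assign 4 (const 1)) skip

def offsetStep : Program :=
  write 3 (reg 2) (reg 8) ;;
  assign 8 (add (reg 8) (add (const 1) (add (cell 0 (reg 8)) (cell 0 (reg 8)))))

/-- Edges traversed upwards fill array `5` from the front, edges traversed downwards fill it from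
the back. Since the walk starts at a source, this is a topological order. Only the first of the
three turns writes to it. -/
def walkStep : Program :=
  write 4 (reg 2) (reg 5) ;;
  ite (eq (tailTerm (reg 6)) (reg 5))
    (ite (lt (reg 2) (reg 0)) (write 5 (reg 7) (reg 6)) skip ;;
      incr 7 ;; assign 5 (headTerm (reg 6)))
    (ite (lt (reg 2) (reg 0))
        (write 5 (sub (sub (reg 0) (const 1)) (sub (reg 2) (reg 7))) (reg 6)) skip ;;
      assign 5 (tailTerm (reg 6))) ;;
  assign 6 (sub (cell 1 (reg 5)) (reg 6))

/-- Register `17` is the lower end of the interval, raised above the bound in register `11` where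
the bound applies. Register `15` is the minimum so far, and register `16` tells whether there is
one. -/
def intervalStep (σ : Bool) : Program :=
  assign 17 (lo σ (reg 13)) ;;
  ite (and (eq (reg 12) (const 0)) (le (reg 17) (reg 11)))
    (assign 17 (add (reg 11) (const 1))) skip ;;
  ite (and (le (reg 17) (hi σ (reg 13))) (not (and (eq (reg 16) (const 1)) (le (reg 15) (reg 17)))))
    (assign 15 (reg 17) ;; assign 16 (const 1)) skip ;;
  assign 13 (add (reg 13) (const 2))

def nextLoop (σ : Bool) : Program := .while (lt (reg 13) (reg 14)) (intervalStep σ)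

def nextInit : Program :=
  assign 13 (add (cell 3 (reg 10)) (const 1)) ;;
  assign 14 (cell 0 (cell 3 (reg 10))) ;;
  assign 14 (add (reg 13) (add (reg 14) (reg 14))) ;;
  assign 16 (const 0)

def nextEnd : Program := ite (eq (reg 16) (const 0)) (assign 9 (const 1)) skip

/-- The least level of the vertex in register `10` that exceeds the integer in register `11`; the
latter condition is dropped if register `12` is not zero. -/
def nextLevel (σ : Bool) : Program := nextInit ;; nextLoop σ ;; nextEnd

def startStep (σ : Bool) : Program :=
  ite (eq (reg 9) (const 0))
    ((assign 10 (reg 2) ;; assign 12 (const 1)) ;; nextLevel σ ;; write (lev σ) (reg 10) (reg 15))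
    skip

/-- The edge to be relaxed next. -/
def edgeTerm : Bool → Term
  | true => cell 5 (reg 2)
  | false => cell 5 (sub (sub (reg 0) (const 1)) (reg 2))

def relaxStep (σ : Bool) : Program :=
  ite (eq (reg 9) (const 0))
    ((assign 19 (tl σ (edgeTerm σ)) ;; assign 10 (hd σ (edgeTerm σ)) ;;
        assign 11 (cell (lev σ) (reg 19)) ;; assign 12 (const 0)) ;;
      ite (le (cell (lev σ) (reg 10)) (reg 11))
        (nextLevel σ ;; write (lev σ) (reg 10) (reg 15)) skip)
    skip

/-- Compute the lowest levels of all vertices. -/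
def solve (σ : Bool) : Program :=
  forLoop (reg 0) (startStep σ) ;; forLoop (reg 0) (relaxStep σ)

/-- The array of the opposite side holds negated extreme levels. Among equal lowest levels the
larger entry there belongs to the vertex with less freedom to move up, and this vertex is preferred.
-/
def argminStep (σ : Bool) : Program :=
  assign 30 (cell 4 (reg 2)) ;; assign 31 (cell 4 (reg (base σ))) ;;
  ite (or (lt (cell (lev σ) (reg 30)) (cell (lev σ) (reg 31)))
      (and (eq (cell (lev σ) (reg 30)) (cell (lev σ) (reg 31)))
        (lt (cell (lev !σ) (reg 31)) (cell (lev !σ) (reg 30)))))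
    (assign (base σ) (reg 2)) skip

def argmin (σ : Bool) : Program := assign (base σ) (const 0) ;; forLoop (reg 0) (argminStep σ)

/-- The vertex at the position in register `22` is forced to be a lowest vertex, or it is the
chosen lowest vertex. -/
def markTest (σ : Bool) : Test :=
  or (eq (add (cell (lev !σ) (cell 4 (reg 22))) (cell (lev σ) (cell 4 (reg (base σ))))) (const 0))
    (eq (cell 4 (reg 22)) (cell 4 (reg (base σ))))

/-- Register `22` is not reset, so that consecutive searches continue along the tour. -/
def search (σ : Bool) (x : ℕ) : Program :=
  .while (not (markTest σ)) (incr 22) ;; assign x (reg 22)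

def placeStep : Program :=
  assign 30 (cell 4 (add (reg 24) (reg 2))) ;;
  ite (lt (add (reg 24) (reg 2)) (reg 25))
    (write 8 (reg 30) (sub (const 0) (reg 2)) ;; write 9 (reg 30) (cell 6 (reg 30)))
    (write 8 (reg 30) (reg 2) ;; write 9 (reg 30) (sub (const 0) (cell 7 (reg 30))))

def vertexStep : Program :=
  output (cell 8 (reg 2)) ;; output (const 1) ;; output (cell 9 (reg 2)) ;; output (const 1)

/-- Only the two edges that connect the paths have a bend. Its height is an odd number over `2`, so
numerator and denominator are already reduced. -/
def edgeStep : Program :=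
  assign 30 (tailTerm (reg 2)) ;; assign 31 (headTerm (reg 2)) ;;
  ite (and (eq (reg 30) (cell 4 (sub (reg 25) (const 1)))) (eq (reg 31) (cell 4 (reg 25))))
    (output (const 1) ;; output (cell 8 (reg 30)) ;; output (const 1) ;;
      output (sub (add (cell 9 (reg 31)) (cell 9 (reg 31))) (const 1)) ;; output (const 2))
    (ite (and (eq (reg 30) (cell 4 (reg 24)))
        (eq (reg 31) (cell 4 (sub (add (reg 24) (reg 0)) (const 1)))))
      (output (const 1) ;; output (cell 8 (reg 31)) ;; output (const 1) ;;
        output (add (add (cell 9 (reg 30)) (cell 9 (reg 30))) (const 1)) ;; output (const 2))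
      (output (const 0)))

def draw : Program :=
  output (const 1) ;; forLoop (reg 0) placeStep ;; forLoop (reg 0) vertexStep ;;
  forLoop (reg 1) edgeStep

/-- From the chosen bottom vertex the searches find the next top mark, then the next bottom mark,
then the next top mark. The marks alternate exactly if the last one comes before a full turn after
the first top mark. -/
def decideAndDraw : Program :=
  argmin true ;; argmin false ;; assign 22 (reg 20) ;;
  search false 23 ;; search true 24 ;; search false 25 ;;
  ite (le (add (reg 23) (reg 0)) (reg 25)) draw (output (const 0))

def levels : Program :=
  solve true ;;
  ite (eq (reg 9) (const 0))
    (solve false ;; ite (eq (reg 9) (const 0)) decideAndDraw (output (const 0)))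
    (output (const 0))

def prepare : Program :=
  (assign 0 (cell 0 (const 0)) ;; assign 1 (cell 0 (const 1))) ;;
  forLoop (reg 1) incidenceStep ;; forLoop (reg 1) sourceStep

def walkInit : Program :=
  assign 8 (add (const 2) (add (reg 1) (reg 1))) ;;
  assign 5 (tailTerm (reg 3)) ;; assign 6 (reg 3)

def mainProgram : Program :=
  prepare ;;
  ite (eq (reg 4) (const 0)) (output (const 0))
    (walkInit ;; forLoop (reg 0) offsetStep ;;
      -- Three turns: the searches start in the first turn, reach the first top mark within one
      -- turn, and stop at the latest one turn after it.
      forLoop (add (reg 0) (add (reg 0) (reg 0))) walkStep ;; levels)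

end RAM

/-! ### Reading the encoded input -/

namespace Input

variable {n : ℕ} (I : Input n)

/-- The position of the intervals of a vertex in the input. -/
def offset (v : ℕ) : ℕ :=
  2 + 2 * I.edges.length +
    (((List.finRange n).take v).flatMap fun v =>
      ((I.intervals v).length : ℤ) :: (I.intervals v).flatMap fun J => [J.1, J.2]).length

end Input

theorem getD_flatMap {α β : Type*} (f : α → List β) (l : List α) (d : β) (i : ℕ) (hi : i < l.length)
    (k : ℕ) (hk : k < (f l[i]).length) :
    (l.flatMap f).getD (((l.take i).flatMap f).length + k) d = (f l[i]).getD k d := by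
  have h : l.flatMap f = (l.take i).flatMap f ++ (f l[i] ++ (l.drop (i + 1)).flatMap f) := by
    have h0 : l = l.take i ++ l[i] :: l.drop (i + 1) := by
      rw [← List.drop_eq_getElem_cons hi, List.take_append_drop]
    have h1 := congrArg (List.flatMap f) h0
    rwa [List.flatMap_append, List.flatMap_cons] at h1
  rw [h, List.getD_append_right _ _ _ _ (by omega), Nat.add_sub_cancel_left,
    List.getD_append _ _ _ _ hk]

theorem length_flatMap_const {α β : Type*} (f : α → List β) (c : ℕ) (hf : ∀ a, (f a).length = c)
    (l : List α) : (l.flatMap f).length = l.length * c := by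
  induction l with
  | nil => simp
  | cons a l ih => simp [ih, hf]; ring

theorem getD_pairs (l : List (ℤ × ℤ)) (k : ℕ) (hk : k < l.length) :
    (l.flatMap fun J => [J.1, J.2]).getD (2 * k) 0 = l[k].1 ∧
    (l.flatMap fun J => [J.1, J.2]).getD (2 * k + 1) 0 = l[k].2 := by
  have h := fun j hj => getD_flatMap (fun J : ℤ × ℤ => [J.1, J.2]) l 0 k hk j hj
  rw [length_flatMap_const _ 2 (fun _ => rfl), List.length_take, min_eq_left hk.le, mul_comm] at h
  exact ⟨h 0 (by simp), h 1 (by simp)⟩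

namespace Input

open RAM

variable {n : ℕ} (I : Input n)

/-- The input array. -/
def cells : ℤ → ℤ := (init I.encode).arr 0

theorem cells_natCast (k : ℕ) : I.cells k = I.encode.getD k 0 := by
  simp [cells, init]

theorem cells_zero : I.cells 0 = n := by
  simpa [encode] using I.cells_natCast 0

theorem cells_one : I.cells 1 = I.edges.length := by
  simpa [encode] using I.cells_natCast 1

theorem cells_edge (k : ℕ) (hk : k < I.edges.length) :
    I.cells (2 + (k + k)) = (I.edges[k].1 : ℕ) ∧ I.cells (3 + (k + k)) = (I.edges[k].2 : ℕ) := by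
  have h := fun j hj => getD_flatMap
    (fun e : Fin n × Fin n => [((e.1 : ℕ) : ℤ), ((e.2 : ℕ) : ℤ)]) I.edges 0 k hk j hj
  have hl := length_flatMap_const (fun e : Fin n × Fin n => [((e.1 : ℕ) : ℤ), ((e.2 : ℕ) : ℤ)]) 2
    (fun _ => rfl)
  rw [hl, List.length_take, min_eq_left hk.le, mul_comm] at h
  have hl' := hl I.edges
  constructor
  · have := I.cells_natCast (2 * k + 1 + 1)
    have h0 := h 0 (by simp)
    rw [add_zero] at h0
    rw [encode, List.getD_cons_succ, List.getD_cons_succ,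
      List.getD_append _ _ _ _ (by omega), h0] at this
    simp only [List.getD_cons_zero] at this
    rw [← this]; congr 1; push_cast; ring
  · have := I.cells_natCast (2 * k + 1 + 1 + 1)
    rw [encode, List.getD_cons_succ, List.getD_cons_succ,
      List.getD_append _ _ _ _ (by omega), h 1 (by simp)] at this
    simp only [List.getD_cons_zero, List.getD_cons_succ] at this
    rw [← this]; congr 1; push_cast; ring

theorem cells_offset_add (v : Fin n) (k : ℕ) (hk : k < 1 + 2 * (I.intervals v).length) :
    I.cells (I.offset v + k) =
      (((I.intervals v).length : ℤ) :: (I.intervals v).flatMap fun J => [J.1, J.2]).getD k 0 := by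
  have h := getD_flatMap (fun v => ((I.intervals v).length : ℤ) ::
    (I.intervals v).flatMap fun J => [J.1, J.2]) (List.finRange n) 0 v (by simp) k (by
      simp only [List.getElem_finRange, List.length_cons]
      rw [length_flatMap_const _ 2 (fun _ => rfl)]
      simp only [Fin.cast_mk, Fin.eta]
      omega)
  simp only [List.getElem_finRange, Fin.cast_mk, Fin.eta] at h
  rw [← h]
  have := I.cells_natCast (I.offset v + k)
  push_cast at this
  rw [this, encode, offset]
  have hl' := length_flatMap_const (fun e : Fin n × Fin n => [((e.1 : ℕ) : ℤ), ((e.2 : ℕ) : ℤ)]) 2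
    (fun _ => rfl) I.edges
  set X := ((List.finRange n).take v).flatMap fun v =>
      ((I.intervals v).length : ℤ) :: (I.intervals v).flatMap fun J => [J.1, J.2]
  rw [show 2 + 2 * I.edges.length + X.length + k = (I.edges.length * 2 + (X.length + k)) + 1 + 1 by
    omega, List.getD_cons_succ, List.getD_cons_succ, List.getD_append_right _ _ _ _ (by omega), hl',
    Nat.add_sub_cancel_left]

theorem cells_offset (v : Fin n) : I.cells (I.offset v) = (I.intervals v).length := by
  simpa using I.cells_offset_add v 0 (by omega)

theorem cells_interval (v : Fin n) (k : ℕ) (hk : k < (I.intervals v).length) :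
    I.cells (I.offset v + 1 + (k + k)) = (I.intervals v)[k].1 ∧
    I.cells (I.offset v + 1 + (k + k) + 1) = (I.intervals v)[k].2 := by
  have h := getD_pairs (I.intervals v) k hk
  constructor
  · rw [← h.1, ← List.getD_cons_succ, ← I.cells_offset_add v _ (by omega)]
    congr 1; push_cast; ring
  · rw [← h.2, ← List.getD_cons_succ, ← I.cells_offset_add v _ (by omega)]
    congr 1; push_cast; ring

theorem offset_zero : I.offset 0 = 2 + 2 * I.edges.length := by
  simp [offset]

theorem offset_succ (v : Fin n) :
    I.offset (v + 1) = I.offset v + (1 + 2 * (I.intervals v).length) := by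
  have : (List.finRange n).take (v + 1) = (List.finRange n).take v ++ [v] := by
    rw [List.take_add_one]
    simp
  rw [offset, this, offset, List.flatMap_append, List.length_append]
  simp only [List.flatMap_cons, List.flatMap_nil, List.append_nil, List.length_cons]
  rw [length_flatMap_const (fun J : ℤ × ℤ => [J.1, J.2]) 2 (fun _ => rfl)]
  ring

theorem size_eq : I.size = 2 + 2 * I.edges.length + n + 2 * ∑ v, (I.intervals v).length := by
  rw [size, encode, List.length_cons, List.length_cons, List.length_append,
    length_flatMap_const _ 2 (fun _ => rfl), List.length_flatMap]
  have : ∀ v, (((I.intervals v).length : ℤ) ::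
      (I.intervals v).flatMap fun J => [J.1, J.2]).length = 1 + 2 * (I.intervals v).length := by
    intro v
    rw [List.length_cons, length_flatMap_const _ 2 (fun _ => rfl)]; ring
  simp only [this]
  rw [← List.ofFn_eq_map, List.sum_ofFn, Finset.sum_add_distrib, ← Finset.mul_sum]
  simp
  ring

end Input

/-! ### Walking around an oriented cycle -/

/-- A closed walk that visits the vertices of an oriented cycle in cyclic order. -/
structure IsTour {n : ℕ} (G : Digraph (Fin n)) (c : ℕ → Fin n) : Prop where
  cycle : IsOrientedCycle G
  eq_iff : ∀ i j, c i = c j ↔ i ≡ j [MOD n]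
  step : ∀ i, G.Adj (c i) (c (i + 1)) ∨ G.Adj (c (i + 1)) (c i)
  adj : ∀ i j, G.Adj (c i) (c j) → j ≡ i + 1 [MOD n] ∨ i ≡ j + 1 [MOD n]

/-- An isomorphism with the cycle graph maps `v` and `w` to elements that differ by `s = ±1`, a
generator of the cyclic group. Adding multiples of `s` walks around the cycle in the direction from
`v` to `w`. -/
theorem IsOrientedCycle.exists_tour {n : ℕ} {G : Digraph (Fin n)} (hG : IsOrientedCycle G)
    {v w : Fin n} (h : G.Adj v w) : ∃ c, IsTour G c ∧ c 0 = v ∧ c 1 = w := by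
  have h3 := hG.three_le
  obtain ⟨φ⟩ := hG.isCycle
  rw [Fintype.card_fin] at h3
  obtain ⟨φ⟩ : Nonempty (G.toSimpleGraphInclusive ≃g SimpleGraph.cycleGraph n) := by
    have := hG.isCycle
    rwa [Fintype.card_fin] at this
  obtain ⟨k, rfl⟩ : ∃ k, n = k + 2 := ⟨n - 2, by omega⟩
  have hadj : ∀ x y, (φ x - φ y = 1 ∨ φ y - φ x = 1) ↔ x ≠ y ∧ (G.Adj x y ∨ G.Adj y x) := by
    intro x y
    rw [← SimpleGraph.cycleGraph_adj, φ.map_adj_iff, Digraph.toSimpleGraphInclusive,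
      SimpleGraph.fromRel_adj]
  have hvw : v ≠ w := by rintro rfl; exact hG.loopless _ h
  set s := φ w - φ v with hs
  have hs1 : s = 1 ∨ s = -1 := by
    rcases (hadj v w).2 ⟨hvw, .inl h⟩ with h | h
    · right; rw [hs, ← h]; abel
    · exact .inl h
  have hord : addOrderOf s = k + 2 := by
    have h1 : addOrderOf (1 : Fin (k + 2)) = k + 2 := ZMod.addOrderOf_one (k + 2)
    rcases hs1 with h | h
    · rw [h, h1]
    · rw [h, addOrderOf_neg, h1]
  refine ⟨fun i => φ.symm (φ v + i • s), ⟨hG, fun i j => ?_, fun i => ?_, fun i j hij => ?_⟩, ?_, ?_⟩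
  · rw [φ.symm.injective.eq_iff, add_right_inj, nsmul_eq_nsmul_iff_modEq, hord]
  · refine ((hadj _ _).1 ?_).2
    simp only [RelIso.apply_symm_apply]
    rcases hs1 with h | h
    · right; rw [add_nsmul, h]; simp
    · left; rw [add_nsmul, h]; simp
  · have := (hadj _ _).2 ⟨fun h => hG.loopless _ (h ▸ hij), .inl hij⟩
    simp only [RelIso.apply_symm_apply, add_sub_add_left_eq_sub] at this
    rw [← hord, ← nsmul_eq_nsmul_iff_modEq, ← nsmul_eq_nsmul_iff_modEq, add_nsmul, add_nsmul,
      one_nsmul]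
    rcases this with h' | h' <;> rw [sub_eq_iff_eq_add] at h' <;> rcases hs1 with h | h <;>
      rw [h] at h' ⊢ <;> rw [h']
    · right; abel
    · left; abel
    · left; abel
    · right; abel
  · simp
  · simp [hs]

theorem IsOrientedCycle.exists_adj {n : ℕ} {G : Digraph (Fin n)}
    (hG : IsOrientedCycle G) :
    ∃ u v, G.Adj u v := by
  have h3 := hG.three_le
  obtain ⟨φ⟩ : Nonempty (G.toSimpleGraphInclusive ≃g SimpleGraph.cycleGraph n) := by
    have := hG.isCycle
    rwa [Fintype.card_fin] at this
  rw [Fintype.card_fin] at h3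
  obtain ⟨k, rfl⟩ : ∃ k, n = k + 2 := ⟨n - 2, by omega⟩
  have h : G.toSimpleGraphInclusive.Adj (φ.symm 1) (φ.symm 0) := by
    rw [φ.symm.map_adj_iff, SimpleGraph.cycleGraph_adj]
    simp
  replace h := (SimpleGraph.fromRel_adj G.Adj _ _).1 h
  rcases h.2 with h | h <;> exact ⟨_, _, h⟩

theorem Nat.ModEq.eq_of_lt_add {n i j : ℕ} (h : i ≡ j [MOD n]) (hij : i ≤ j) (hj : j < i + n) :
    i = j := by
  obtain ⟨k, rfl⟩ := Nat.exists_eq_add_of_le hij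
  have : k ≡ 0 [MOD n] := by
    have h' : i + 0 ≡ i + k [MOD n] := by simpa using h
    exact (Nat.ModEq.add_left_cancel' i h').symm
  by_contra hne
  have := Nat.le_of_dvd (by omega) ((Nat.modEq_zero_iff_dvd).1 this)
  omega

namespace IsTour

variable {n : ℕ} {G : Digraph (Fin n)} {c : ℕ → Fin n}

theorem three_le (h : IsTour G c) : 3 ≤ n := by simpa using h.cycle.three_le

theorem add_period (h : IsTour G c) (i : ℕ) : c (i + n) = c i :=
  (h.eq_iff _ _).2 (by simp [Nat.ModEq])

theorem inj (h : IsTour G c) {i j : ℕ} (hc : c i = c j) (hij : i ≤ j) (hj : j < i + n) : i = j :=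
  Nat.ModEq.eq_of_lt_add ((h.eq_iff i j).1 hc) hij hj

theorem surj (h : IsTour G c) (v : Fin n) (s : ℕ) : ∃ i, s ≤ i ∧ i < s + n ∧ c i = v := by
  have hi : Function.Injective fun i : Fin n => c (s + i) := by
    intro i j hij
    rcases le_total i j with hle | hle
    · have := h.inj hij (by simpa using hle) (by omega); exact Fin.ext (by omega)
    · have := h.inj hij.symm (by simpa using hle) (by omega); exact Fin.ext (by omega)
  obtain ⟨i, hi⟩ := Finite.injective_iff_surjective.1 hi v
  exact ⟨s + i, by omega, by omega, hi⟩

theorem shift (h : IsTour G c) (s : ℕ) : IsTour G fun i => c (s + i) := by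
  refine ⟨h.cycle, fun i j => ?_, fun i => h.step (s + i), fun i j hij => ?_⟩
  · rw [h.eq_iff]
    exact ⟨fun h => Nat.ModEq.add_left_cancel' _ h, fun h => h.add_left _⟩
  · exact (h.adj _ _ hij).imp (fun h => Nat.ModEq.add_left_cancel' s h)
      (fun h => Nat.ModEq.add_left_cancel' s h)

/-- Every edge joins two consecutive vertices of the tour. -/
theorem exists_step (h : IsTour G c) {u v : Fin n} (huv : G.Adj u v) (s : ℕ) :
    ∃ i, s ≤ i ∧ i < s + n ∧ (c i = u ∧ c (i + 1) = v ∨ c i = v ∧ c (i + 1) = u) := by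
  obtain ⟨i, hi, hi', rfl⟩ := h.surj u s
  obtain ⟨j, hj, hj', rfl⟩ := h.surj v s
  rcases h.adj _ _ huv with h1 | h1
  · exact ⟨i, hi, hi', .inl ⟨rfl, ((h.eq_iff _ _).2 h1).symm⟩⟩
  · exact ⟨j, hj, hj', .inr ⟨rfl, ((h.eq_iff _ _).2 h1).symm⟩⟩

end IsTour

/-- Tail of an edge of the input, after reflection if `σ = false`. -/
def Input.tail {n : ℕ} (I : Input n) (σ : Bool) (k : Fin I.edges.length) : Fin n :=
  bif σ then (I.edges.get k).1 else (I.edges.get k).2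

/-- Head of an edge of the input, after reflection if `σ = false`. -/
def Input.head {n : ℕ} (I : Input n) (σ : Bool) (k : Fin I.edges.length) : Fin n :=
  bif σ then (I.edges.get k).2 else (I.edges.get k).1

/-- A tour together with the indices of its edges in the input. It starts at a source. -/
structure IsRoute {n : ℕ} (I : Input n) (G : Digraph (Fin n)) (c : ℕ → Fin n)
    (e : ℕ → Fin I.edges.length) : Prop where
  tour : IsTour G c
  nodup : I.edges.Nodup
  mem_edges : ∀ u v, (u, v) ∈ I.edges ↔ G.Adj u v
  up : ∀ i, G.Adj (c i) (c (i + 1)) → I.edges.get (e i) = (c i, c (i + 1))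
  down : ∀ i, ¬ G.Adj (c i) (c (i + 1)) → I.edges.get (e i) = (c (i + 1), c i)
  source : ∀ u, ¬ G.Adj u (c 0)

/-- The tour is chosen so that its first step traverses the edge `k`. Then `e 0 = k`, because the
list has no duplicates. -/
theorem IsOrientedCycle.exists_route {n : ℕ} {G : Digraph (Fin n)} (hG : IsOrientedCycle G)
    {ℓ : Fin n → Finset ℤ} {I : Input n} (hI : I.Represents G ℓ) (k : Fin I.edges.length)
    (hk : ∀ u, ¬ G.Adj u (I.edges.get k).1) :
    ∃ c e, IsRoute I G c e ∧ c 0 = (I.edges.get k).1 ∧ e 0 = k := by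
  have hadj : G.Adj (I.edges.get k).1 (I.edges.get k).2 :=
    (hI.mem_edges _ _).1 (List.get_mem _ _)
  obtain ⟨c, hc, h0, h1⟩ := hG.exists_tour hadj
  have : ∀ i, ∃ j : Fin I.edges.length,
      (G.Adj (c i) (c (i + 1)) → I.edges.get j = (c i, c (i + 1))) ∧
      (¬ G.Adj (c i) (c (i + 1)) → I.edges.get j = (c (i + 1), c i)) := by
    intro i
    by_cases h : G.Adj (c i) (c (i + 1))
    · obtain ⟨j, hj⟩ := List.mem_iff_get.1 ((hI.mem_edges _ _).2 h)
      exact ⟨j, fun _ => hj, fun h' => absurd h h'⟩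
    · obtain ⟨j, hj⟩ := List.mem_iff_get.1 ((hI.mem_edges _ _).2 ((hc.step i).resolve_left h))
      exact ⟨j, fun h' => absurd h' h, fun _ => hj⟩
  choose e he he' using this
  refine ⟨c, e, ⟨hc, hI.nodup, hI.mem_edges, he, he', by rw [h0]; exact hk⟩, h0, ?_⟩
  refine List.nodup_iff_injective_get.1 hI.nodup ?_
  rw [he 0 (by simpa only [h0, zero_add, h1] using hadj), h0, zero_add, h1]

/-! ### Indices of the edges along a tour -/

namespace IsRoute

variable {n : ℕ} {I : Input n} {G : Digraph (Fin n)} {c : ℕ → Fin n}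
  {e : ℕ → Fin I.edges.length}

theorem adj_get (h : IsRoute I G c e) (k : Fin I.edges.length) :
    G.Adj (I.edges.get k).1 (I.edges.get k).2 :=
  (h.mem_edges _ _).1 (List.get_mem _ _)

theorem ends (h : IsRoute I G c e) (i : ℕ) :
    I.edges.get (e i) = (c i, c (i + 1)) ∨ I.edges.get (e i) = (c (i + 1), c i) := by
  by_cases hi : G.Adj (c i) (c (i + 1))
  · exact .inl (h.up i hi)
  · exact .inr (h.down i hi)

/-- There are no antiparallel edges, so both alternatives determine the same edge, and the list
contains it only once. -/
theorem eq_of_ends (h : IsRoute I G c e) {k : Fin I.edges.length} {i : ℕ}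
    (hk : I.edges.get k = (c i, c (i + 1)) ∨ I.edges.get k = (c (i + 1), c i)) : k = e i := by
  refine List.nodup_iff_injective_get.1 h.nodup ?_
  have ha := h.adj_get k
  rcases hk with hk | hk <;> rw [hk] at ha ⊢
  · rw [h.up i ha]
  · rw [h.down i (h.tour.cycle.oriented _ _ ha)]

/-- The edges at a vertex of the tour. -/
theorem incident_iff (h : IsRoute I G c e) (k : Fin I.edges.length) (i : ℕ) :
    (I.edges.get k).1 = c (i + 1) ∨ (I.edges.get k).2 = c (i + 1) ↔ k = e i ∨ k = e (i + 1) := by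
  have hn := h.tour.three_le
  constructor
  · intro hk
    obtain ⟨j, hj, hj', hc⟩ := h.tour.exists_step (h.adj_get k) (i + 1)
    have hkj : k = e j := h.eq_of_ends (by
      rcases hc with hc | hc
      · left; rw [hc.1, hc.2]
      · right; rw [hc.1, hc.2])
    have : c (i + 1) = c j ∨ c (i + 1) = c (j + 1) := by
      rcases hc with ⟨hc, hc'⟩ | ⟨hc, hc'⟩ <;> rw [hc, hc'] <;> rcases hk with hk | hk <;> tauto
    rcases this with h' | h'
    · have := h.tour.inj h' hj hj'
      right; rw [hkj, this]
    · rcases Nat.lt_or_ge (j + 1) (i + 1 + n) with hlt | hge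
      · have := h.tour.inj h' (by omega) hlt
        omega
      -- The edge that enters `c (i + 1)` is met at the end of the turn, as position `i + n`.
      · have hji : j = i + n := by omega
        left
        refine h.eq_of_ends ?_
        rw [hji, h.tour.add_period, show i + n + 1 = i + 1 + n by ring, h.tour.add_period] at hc
        rcases hc with hc | hc
        · left; rw [hc.1, hc.2]
        · right; rw [hc.1, hc.2]
  · rintro (rfl | rfl)
    · rcases h.ends i with h' | h' <;> rw [h'] <;> simp
    · rcases h.ends (i + 1) with h' | h' <;> rw [h'] <;> simp

/-- If an edge were repeated within a turn, it would be traversed back immediately, so that `c i = c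
(i + 2)`. This is impossible with at least three vertices. -/
theorem injOn (h : IsRoute I G c e) {i j : ℕ} (he : e i = e j) (hij : i ≤ j) (hj : j < i + n) :
    i = j := by
  have hn := h.tour.three_le
  have h1 : (c i = c j ∧ c (i + 1) = c (j + 1)) ∨ (c i = c (j + 1) ∧ c (i + 1) = c j) := by
    have h1 := h.ends i
    have h2 := h.ends j
    rw [he] at h1
    rcases h1 with h1 | h1 <;> rcases h2 with h2 | h2 <;> rw [h1] at h2 <;>
      simp only [Prod.mk.injEq] at h2 <;> tauto
  rcases h1 with ⟨h1, -⟩ | ⟨h1, h2⟩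
  · exact h.tour.inj h1 hij hj
  · rcases Nat.eq_or_lt_of_le hij with rfl | hlt
    · rfl
    · have := h.tour.inj h2 (by omega) (by omega)
      subst this
      have := h.tour.inj h1 (by omega) (by omega)
      omega

/-- This is why the walk finds the next edge by subtracting the current one. -/
theorem sum_incident (h : IsRoute I G c e) (i : ℕ) :
    (∑ k : Fin I.edges.length, if (I.edges.get k).1 = c (i + 1) ∨ (I.edges.get k).2 = c (i + 1)
      then (k : ℤ) else 0) = (e i : ℤ) + (e (i + 1) : ℤ) := by
  have hn := h.tour.three_le
  simp only [h.incident_iff]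
  rw [Fintype.sum_eq_add (e i) (e (i + 1))]
  · simp
  · intro he; have := h.injOn he (by omega) (by omega); omega
  · rintro k ⟨hk, hk'⟩; simp [hk, hk']

theorem exists_index (h : IsRoute I G c e) (k : Fin I.edges.length) : ∃ i < n, e i = k := by
  obtain ⟨i, -, hi, hc⟩ := h.tour.exists_step (h.adj_get k) 0
  refine ⟨i, by omega, (h.eq_of_ends ?_).symm⟩
  rcases hc with hc | hc
  · left; rw [hc.1, hc.2]
  · right; rw [hc.1, hc.2]

end IsRoute

/-! ### The order in which the edges are relaxed -/

section Order

open Classical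

/-- Number of edges among the first `i` ones of the tour that lead upwards. -/
noncomputable def ups {n : ℕ} (G : Digraph (Fin n)) (c : ℕ → Fin n) (i : ℕ) : ℕ :=
  Nat.count (fun i => G.Adj (c i) (c (i + 1))) i

/-- Position of the `i`-th edge of the tour in the topological order. -/
noncomputable def rank {n : ℕ} (G : Digraph (Fin n)) (c : ℕ → Fin n) (σ : Bool) (i : ℕ) : ℕ :=
  let r := if G.Adj (c i) (c (i + 1)) then ups G c i else n - 1 - (i - ups G c i)
  bif σ then r else n - 1 - r

variable {n : ℕ} {G : Digraph (Fin n)} {c : ℕ → Fin n}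

theorem ups_le (i : ℕ) : ups G c i ≤ i := Nat.count_le _

theorem ups_succ_of_adj {i : ℕ} (h : G.Adj (c i) (c (i + 1))) : ups G c (i + 1) = ups G c i + 1 := by
  simp [ups, Nat.count_succ, h]

theorem ups_succ_of_not_adj {i : ℕ} (h : ¬ G.Adj (c i) (c (i + 1))) :
    ups G c (i + 1) = ups G c i := by
  simp [ups, Nat.count_succ, h]

theorem ups_mono {i j : ℕ} (h : i ≤ j) : ups G c i ≤ ups G c j := Nat.count_monotone _ h

theorem sub_ups_mono {i j : ℕ} (h : i ≤ j) : i - ups G c i ≤ j - ups G c j := by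
  induction j, h using Nat.le_induction with
  | base => rfl
  | succ j _ ih =>
    have := ups_le (G := G) (c := c) j
    by_cases hj : G.Adj (c j) (c (j + 1))
    · rw [ups_succ_of_adj hj]; omega
    · rw [ups_succ_of_not_adj hj]; omega

theorem rank_lt {σ : Bool} {i : ℕ} (hi : i < n) : rank G c σ i < n := by
  have := ups_le (G := G) (c := c) i
  unfold rank
  cases σ <;> dsimp only [cond_true, cond_false] <;> split <;> omega

/-- Upward edges receive the ranks below `ups G c n`, in the order of the tour. Downward edges
receive the remaining ones, in reverse order. -/
theorem rank_injOn {σ : Bool} {i j : ℕ} (hi : i < n) (hj : j < n)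
    (h : rank G c σ i = rank G c σ j) : i = j := by
  have h' : rank G c true i = rank G c true j := by
    cases σ with
    | true => exact h
    | false =>
      have h1 := rank_lt (G := G) (c := c) (σ := true) hi
      have h2 := rank_lt (G := G) (c := c) (σ := true) hj
      simp only [rank, cond_true, cond_false] at h h1 h2 ⊢
      omega
  clear h
  wlog hij : i < j generalizing i j
  · rcases Nat.eq_or_lt_of_le (Nat.le_of_not_lt hij) with h | h
    · exact h.symm
    · exact (this hj hi h'.symm h).symm
  have h1 := ups_mono (G := G) (c := c) (Nat.succ_le_of_lt hij)
  have h2 := sub_ups_mono (G := G) (c := c) (Nat.succ_le_of_lt hij)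
  have h3 := ups_mono (G := G) (c := c) (Nat.succ_le_of_lt hj)
  have h4 := sub_ups_mono (G := G) (c := c) (Nat.succ_le_of_lt hj)
  have h5 := ups_le (G := G) (c := c) i
  have h6 := ups_le (G := G) (c := c) j
  have h7 := ups_le (G := G) (c := c) n
  simp only [rank, cond_true, Nat.succ_eq_add_one] at *
  by_cases hi' : G.Adj (c i) (c (i + 1)) <;> by_cases hj' : G.Adj (c j) (c (j + 1)) <;>
    simp only [hi', hj', if_true, if_false, ups_succ_of_adj, ups_succ_of_not_adj,
      not_false_eq_true] at * <;> omega

theorem rank_surjOn {σ : Bool} {j : ℕ} (hj : j < n) : ∃ i < n, rank G c σ i = j := by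
  have hi : Function.Injective fun i : Fin n =>
      (⟨rank G c σ i, rank_lt i.2⟩ : Fin n) := by
    intro i j hij
    exact Fin.ext (rank_injOn i.2 j.2 (by simpa using hij))
  obtain ⟨i, hi⟩ := Finite.injective_iff_surjective.1 hi ⟨j, hj⟩
  exact ⟨i, i.2, by simpa using hi⟩

/-- No edge enters the tail of an edge after that edge. -/
theorem IsRoute.head_ne_tail {I : Input n} {e : ℕ → Fin I.edges.length} (h : IsRoute I G c e)
    {σ : Bool} {i j : ℕ} (hi : i < n) (hj : j < n) (hij : rank G c σ i ≤ rank G c σ j) :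
    I.head σ (e j) ≠ I.tail σ (e i) := by
  -- Reflection exchanges heads with tails and reverses the ranks, so the unreflected case suffices.
  have key : ∀ i j, i < n → j < n → rank G c true i ≤ rank G c true j →
      I.head true (e j) ≠ I.tail true (e i) := by
    clear hij hi hj i j
    intro i j hi hj hij heq
    have hn := h.tour.three_le
    have src : ∀ k, k < n → ∀ u, G.Adj u (c k) → k ≠ 0 := by
      rintro k - u hu rfl; exact h.source _ hu
    simp only [Input.head, Input.tail, cond_true] at heq
    by_cases hi' : G.Adj (c i) (c (i + 1)) <;> by_cases hj' : G.Adj (c j) (c (j + 1))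
    · rw [h.up i hi', h.up j hj'] at heq
      simp only at heq
      simp only [rank, cond_true, hi', hj', if_true] at hij
      have hle : i ≤ j := by
        by_contra hlt
        have := ups_mono (G := G) (c := c) (show j + 1 ≤ i by omega)
        rw [ups_succ_of_adj hj'] at this; omega
      rcases Nat.lt_or_ge (j + 1) (i + n) with hlt | hge
      · have := h.tour.inj heq.symm (by omega) hlt; omega
      -- The only possible coincidence across the end of the turn is at `c n = c 0`, and no edge
      -- enters this source.
      · obtain rfl : i = 0 := by omega
        exact h.source (c j) (heq ▸ hj')
    -- In the mixed cases the common vertex would force `i = j`, but one of the edges leads upwards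
    -- and the other downwards.
    · rw [h.up i hi', h.down j hj'] at heq
      simp only at heq
      rcases le_total i j with hle | hle
      · have := h.tour.inj heq.symm hle (by omega); subst this; exact hj' hi'
      · have := h.tour.inj heq hle (by omega); subst this; exact hj' hi'
    · rw [h.down i hi', h.up j hj'] at heq
      simp only at heq
      have : i = j := by
        rcases le_total i j with hle | hle
        · have := h.tour.inj heq.symm (by omega) (by omega); omega
        · have := h.tour.inj heq (by omega) (by omega); omega
      subst this; exact hi' hj'
    · rw [h.down i hi', h.down j hj'] at heq
      simp only at heq
      have h1 := ups_le (G := G) (c := c) i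
      have h2 := ups_le (G := G) (c := c) j
      simp only [rank, cond_true, hi', hj', if_false] at hij
      have hle : j ≤ i := by
        by_contra hlt
        have := sub_ups_mono (G := G) (c := c) (show i + 1 ≤ j by omega)
        rw [ups_succ_of_not_adj hi'] at this; omega
      rcases Nat.lt_or_ge (i + 1) (j + n) with hlt | hge
      · have := h.tour.inj heq (by omega) hlt; omega
      · obtain rfl : j = 0 := by omega
        exact h.source _ ((h.tour.step 0).resolve_left hj')
  cases σ with
  | true => exact key i j hi hj hij
  | false =>
    have h1 := rank_lt (G := G) (c := c) (σ := true) hi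
    have h2 := rank_lt (G := G) (c := c) (σ := true) hj
    have := key j i hj hi (by
      simp only [rank, cond_true, cond_false] at hij h1 h2 ⊢
      omega)
    exact fun h' => this h'.symm

end Order

/-! ### Disjoint curves in a strip -/

/-- The hypotheses say that `A` is an odd multiple of `π`, and the sine is negative immediately to
the right of such a point. -/
theorem Real.exists_sin_neg_between {A B : ℝ} (hA : Real.sin A = 0) (hA' : Real.cos A < 0)
    (hAB : A < B) : ∃ x, A ≤ x ∧ x ≤ B ∧ Real.sin x < 0 := by
  have hpi := Real.pi_pos
  have h1 := min_le_left (Real.pi / 2) (B - A)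
  have h2 := min_le_right (Real.pi / 2) (B - A)
  have h3 : 0 < min (Real.pi / 2) (B - A) := lt_min (by linarith) (by linarith)
  refine ⟨A + min (Real.pi / 2) (B - A), by linarith, by linarith, ?_⟩
  rw [Real.sin_add, hA, zero_mul, zero_add]
  exact mul_neg_of_neg_of_pos hA' (Real.sin_pos_of_pos_of_lt_pi h3 (by linarith))

/-- Two disjoint curves that lead from the lower to the upper border of a horizontal strip have
the same order on both borders. -/
theorem JoinedIn.strip_lt {S S' : Set (ℝ × ℝ)} {m M : ℝ} {a z a' z' : ℝ × ℝ}
    (hd : Disjoint S S') (hS : ∀ p ∈ S, m ≤ p.2 ∧ p.2 ≤ M) (hS' : ∀ p ∈ S', m ≤ p.2 ∧ p.2 ≤ M)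
    (h : JoinedIn S a z) (h' : JoinedIn S' a' z') (ha : a.2 = m) (ha' : a'.2 = m) (hz : z.2 = M)
    (hz' : z'.2 = M) (haa : a.1 < a'.1) : z.1 < z'.1 := by
  obtain ⟨γ, hγ⟩ := h
  obtain ⟨γ', hγ'⟩ := h'
  have hne : ∀ p ∈ S, ∀ q ∈ S', p ≠ q := fun p hp q hq hpq =>
    Set.disjoint_left.1 hd hp (hpq ▸ hq)
  by_contra hlt
  have hzz : z'.1 < z.1 := by
    refine lt_of_le_of_ne (not_lt.1 hlt) fun h => ?_
    refine hne z ?_ z' ?_ (Prod.ext h.symm (hz.trans hz'.symm))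
    · simpa using hγ 1
    · simpa using hγ' 1
  have hE : ∀ t : ℝ, γ.extend t ∈ S := fun t => by
    obtain ⟨u, hu⟩ : γ.extend t ∈ Set.range γ := by rw [← γ.extend_range]; exact ⟨t, rfl⟩
    rw [← hu]; exact hγ u
  have hE' : ∀ t : ℝ, γ'.extend t ∈ S' := fun t => by
    obtain ⟨u, hu⟩ : γ'.extend t ∈ Set.range γ' := by rw [← γ'.extend_range]; exact ⟨t, rfl⟩
    rw [← hu]; exact hγ' u
  -- The difference of the two curves as a complex number, one parameter for each curve. It never
  -- vanishes, since the curves are disjoint. Extending the curves to all real parameters makes the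
  -- domain the whole plane.
  let f : C(ℝ × ℝ, ℂ) := ⟨fun p =>
    (((γ.extend p.1).1 - (γ'.extend p.2).1 : ℝ) : ℂ) +
      (((γ.extend p.1).2 - (γ'.extend p.2).2 : ℝ) : ℂ) * Complex.I, by
        have h1 := γ.continuous_extend
        have h2 := γ'.continuous_extend
        fun_prop⟩
  have hre : ∀ s t, (f (s, t)).re = (γ.extend s).1 - (γ'.extend t).1 := fun s t => by
    simp [f]
  have him : ∀ s t, (f (s, t)).im = (γ.extend s).2 - (γ'.extend t).2 := fun s t => by
    simp [f]
  have hf0 : ∀ p, f p ∈ ({0} : Set ℂ)ᶜ := by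
    rintro ⟨s, t⟩ h0
    rw [Set.mem_singleton_iff] at h0
    have h1 := hre s t
    have h2 := him s t
    rw [h0] at h1 h2
    simp only [Complex.zero_re, Complex.zero_im] at h1 h2
    exact hne _ (hE s) _ (hE' t) (Prod.ext (by linarith) (by linarith))
  -- The plane is simply connected, so `f` lifts through the exponential covering. The imaginary
  -- part `θ` of the lift is a continuous argument of `f`.
  obtain ⟨F, ⟨-, hF⟩, -⟩ := Complex.isCoveringMapOn_exp.existsUnique_continuousMap_lifts f
    (a₀ := (0, 0)) (Complex.exp_log (hf0 (0, 0))) hf0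
  have hF' : ∀ p, Complex.exp (F p) = f p := fun p => congrFun hF p
  set θ : ℝ × ℝ → ℝ := fun p => (F p).im with hθ
  have hθc : Continuous θ := by fun_prop
  have hsin : ∀ p, (f p).im = Real.exp (F p).re * Real.sin (θ p) := fun p => by
    rw [← hF', Complex.exp_im]
  have hcos : ∀ p, (f p).re = Real.exp (F p).re * Real.cos (θ p) := fun p => by
    rw [← hF', Complex.exp_re]
  have hsA : Real.sin (θ (0, 0)) = 0 := by
    have h1 := hsin (0, 0)
    rw [him] at h1
    simpa [ha, ha', Real.exp_ne_zero] using h1.symm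
  have hcA : Real.cos (θ (0, 0)) < 0 := by
    have h1 := hcos (0, 0)
    rw [hre] at h1
    simp only [Path.extend_zero] at h1
    by_contra hc
    have := mul_nonneg (Real.exp_pos (F (0, 0)).re).le (not_lt.1 hc)
    linarith
  have hcB : 0 < Real.cos (θ (1, 1)) := by
    have h1 := hcos (1, 1)
    rw [hre] at h1
    simp only [Path.extend_one] at h1
    by_contra hc
    have := mul_nonpos_of_nonneg_of_nonpos (Real.exp_pos (F (1, 1)).re).le (not_lt.1 hc)
    linarith
  have conn : ∀ u : ℝ × ℝ, IsPreconnected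
      (θ '' (segment ℝ (0, 0) u ∪ segment ℝ u (1, 1))) := fun u =>
    ((convex_segment _ _).isPreconnected.union u (right_mem_segment ℝ _ _)
      (left_mem_segment ℝ _ _) (convex_segment _ _).isPreconnected).image _ hθc.continuousOn
  have hmemA : ∀ u : ℝ × ℝ, θ (0, 0) ∈ θ '' (segment ℝ (0, 0) u ∪ segment ℝ u (1, 1)) :=
    fun u => ⟨_, .inl (left_mem_segment ℝ _ _), rfl⟩
  have hmemB : ∀ u : ℝ × ℝ, θ (1, 1) ∈ θ '' (segment ℝ (0, 0) u ∪ segment ℝ u (1, 1)) :=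
    fun u => ⟨_, .inr (right_mem_segment ℝ _ _), rfl⟩
  have hg0 : γ.extend 0 = a := γ.extend_zero
  have hg1 : γ.extend 1 = z := γ.extend_one
  have hg0' : γ'.extend 0 = a' := γ'.extend_zero
  have hg1' : γ'.extend 1 = z' := γ'.extend_one
  -- At `(0, 0)` the value of `f` is a negative real number, at `(1, 1)` a positive one. On the
  -- broken line through `(1, 0)` the imaginary part of `f` is nonnegative, so `θ` cannot rise past
  -- the odd multiple of `π` where it starts. On the one through `(0, 1)` it is nonpositive, so `θ`
  -- cannot fall.
  rcases lt_trichotomy (θ (0, 0)) (θ (1, 1)) with hlt | heq | hgt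
  · obtain ⟨x, hx, hx', hneg⟩ := Real.exists_sin_neg_between hsA hcA hlt
    obtain ⟨⟨s, t⟩, hp, hpx⟩ := (conn (1, 0)).ordConnected.out (hmemA _) (hmemB _) ⟨hx, hx'⟩
    have h1 : 0 ≤ (f (s, t)).im := by
      rw [him]
      rcases hp with ⟨α, β, -, -, -, h⟩ | ⟨α, β, -, -, hαβ, h⟩
      · have ht : t = 0 := by simpa using (congrArg Prod.snd h).symm
        rw [ht, hg0', ha']; linarith [(hS _ (hE s)).1]
      · have hs : s = 1 := by simpa [hαβ] using (congrArg Prod.fst h).symm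
        rw [hs, hg1, hz]; linarith [(hS' _ (hE' t)).2]
    rw [hsin, hpx] at h1
    linarith [mul_neg_of_pos_of_neg (Real.exp_pos (F (s, t)).re) hneg]
  · rw [heq] at hcA; linarith
  · obtain ⟨x, hx, hx', hneg⟩ := Real.exists_sin_neg_between (A := - θ (0, 0)) (B := - θ (1, 1))
      (by simpa using hsA) (by simpa using hcA) (by linarith)
    obtain ⟨⟨s, t⟩, hp, hpx⟩ := (conn (0, 1)).ordConnected.out (hmemB _) (hmemA _)
      (⟨by linarith, by linarith⟩ : -x ∈ Set.Icc _ _)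
    have h1 : (f (s, t)).im ≤ 0 := by
      rw [him]
      rcases hp with ⟨α, β, -, -, -, h⟩ | ⟨α, β, -, -, hαβ, h⟩
      · have hs : s = 0 := by simpa using (congrArg Prod.fst h).symm
        rw [hs, hg0, ha]; linarith [(hS' _ (hE' t)).1]
      · have ht : t = 1 := by simpa [hαβ] using (congrArg Prod.snd h).symm
        rw [ht, hg1', hz']; linarith [(hS _ (hE s)).2]
    rw [hsin, hpx, Real.sin_neg] at h1
    have := mul_neg_of_pos_of_neg (Real.exp_pos (F (s, t)).re) hneg
    linarith

/-! ### Arcs of a drawn cycle -/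

namespace Drawing

variable {n : ℕ} {G : Digraph (Fin n)} {c : ℕ → Fin n}

/-- The points of the edge that joins two vertices. -/
def link (D : Drawing G) (u v : Fin n) : Set (ℝ × ℝ) :=
  {x | (∃ h : G.Adj u v, x ∈ Set.range (D.curve h)) ∨ ∃ h : G.Adj v u, x ∈ Set.range (D.curve h)}

/-- The points of the edges between the `i`-th and the `j`-th vertex of a tour. -/
def arc (D : Drawing G) (c : ℕ → Fin n) (i j : ℕ) : Set (ℝ × ℝ) :=
  {x | ∃ k, i ≤ k ∧ k < j ∧ x ∈ D.link (c k) (c (k + 1))}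

theorem joinedIn_link (D : Drawing G) (hc : IsTour G c) (k : ℕ) :
    JoinedIn (D.link (c k) (c (k + 1))) (D.pos (c k)) (D.pos (c (k + 1))) := by
  rcases hc.step k with h | h
  · exact ⟨D.curve h, fun t => .inl ⟨h, t, rfl⟩⟩
  · exact JoinedIn.symm ⟨D.curve h, fun t => .inr ⟨h, t, rfl⟩⟩

theorem joinedIn_arc (D : Drawing G) (hc : IsTour G c) {i j : ℕ} (hij : i < j) :
    JoinedIn (D.arc c i j) (D.pos (c i)) (D.pos (c j)) := by
  induction j, hij using Nat.le_induction with
  | base =>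
    exact (D.joinedIn_link hc i).mono fun x hx => ⟨i, le_rfl, Nat.lt_succ_self i, hx⟩
  | succ j hij ih =>
    refine (ih.mono ?_).trans ((D.joinedIn_link hc j).mono fun x hx => ⟨j, by omega, by omega, hx⟩)
    rintro x ⟨k, hk, hk', hx⟩
    exact ⟨k, hk, by omega, hx⟩

theorem disjoint_link {D : Drawing G} (hD : D.IsPlanar) {u v u' v' : Fin n} (h1 : u ≠ u')
    (h2 : u ≠ v') (h3 : v ≠ u') (h4 : v ≠ v') : Disjoint (D.link u v) (D.link u' v') := by
  rw [Set.disjoint_left]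
  rintro x (⟨h, hx⟩ | ⟨h, hx⟩) (⟨h', hx'⟩ | ⟨h', hx'⟩) <;>
  · obtain ⟨w, hw, hw', -⟩ := hD.curves_disjoint h h' (by simp [h1, h2, h3, h4]) x ⟨hx, hx'⟩
    rcases hw with rfl | rfl <;> rcases hw' with rfl | rfl <;> contradiction

theorem disjoint_arc {D : Drawing G} (hD : D.IsPlanar) (hc : IsTour G c) {p q r s : ℕ}
    (hqr : q < r) (hs : s < p + n) : Disjoint (D.arc c p q) (D.arc c r s) := by
  rw [Set.disjoint_left]
  rintro x ⟨k, hk, hk', hx⟩ ⟨j, hj, hj', hx'⟩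
  refine Set.disjoint_left.1 (disjoint_link hD ?_ ?_ ?_ ?_) hx hx' <;> intro h
  · have := hc.inj h (by omega) (by omega); omega
  · have := hc.inj h (by omega) (by omega); omega
  · have := hc.inj h (by omega) (by omega); omega
  · have := hc.inj h (by omega) (by omega); omega

theorem snd_mem_of_mem_arc {D : Drawing G} (hD : D.IsUpward) {m M : ℝ}
    (hm : ∀ v, m ≤ (D.pos v).2 ∧ (D.pos v).2 ≤ M) {i j : ℕ} {x : ℝ × ℝ} (hx : x ∈ D.arc c i j) :
    m ≤ x.2 ∧ x.2 ≤ M := by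
  have key : ∀ {u v} (h : G.Adj u v), x ∈ Set.range (D.curve h) → m ≤ x.2 ∧ x.2 ≤ M := by
    rintro u v h ⟨t, rfl⟩
    have h0 := (hD h).monotone (unitInterval.nonneg' : 0 ≤ t)
    have h1 := (hD h).monotone (unitInterval.le_one' : t ≤ 1)
    simp only [Path.source, Path.target] at h0 h1
    exact ⟨(hm u).1.trans h0, h1.trans (hm v).2⟩
  obtain ⟨k, -, -, ⟨h, hx⟩ | ⟨h, hx⟩⟩ := hx
  · exact key h hx
  · exact key h hx

/-- Lowest and highest vertices do not alternate around an upward-planar drawing of a cycle. -/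
theorem not_alternating {D : Drawing G} (hD : D.IsPlanar) (hU : D.IsUpward) (hc : IsTour G c)
    {m M : ℝ} (hm : ∀ v, m ≤ (D.pos v).2 ∧ (D.pos v).2 ≤ M) {p q r s : ℕ} (hpq : p < q)
    (hqr : q < r) (hrs : r < s) (hs : s < p + n) (hp : (D.pos (c p)).2 = m)
    (hq : (D.pos (c q)).2 = M) (hr : (D.pos (c r)).2 = m) (hs' : (D.pos (c s)).2 = M) : False := by
  -- The arcs from `p` to `q` and from `r` to `s` give `q` and `s` the order of `p` and `r`. The
  -- other two arcs, read from bottom to top, join `r` to `q` and `p` to `s` and give the opposite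
  -- order.
  have J1 := D.joinedIn_arc hc hpq
  have J2 := D.joinedIn_arc hc hrs
  have J3 := (D.joinedIn_arc hc hqr).symm
  have J4 := (D.joinedIn_arc hc hs).symm
  rw [hc.add_period] at J4
  have d1 := disjoint_arc hD hc hqr hs
  have d2 := disjoint_arc hD hc hrs (show p + n < q + n by omega)
  have hsnd : ∀ i j, ∀ x ∈ D.arc c i j, m ≤ x.2 ∧ x.2 ≤ M := fun i j x hx =>
    snd_mem_of_mem_arc hU hm hx
  have hne : (D.pos (c p)).1 ≠ (D.pos (c r)).1 := fun h => by
    have := hc.inj (hD.pos_injective (Prod.ext h (hp.trans hr.symm))) (by omega) (by omega)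
    omega
  rcases lt_or_gt_of_ne hne with h | h
  · have h1 := JoinedIn.strip_lt d1 (hsnd _ _) (hsnd _ _) J1 J2 hp hr hq hs' h
    have h2 := JoinedIn.strip_lt d2.symm (hsnd _ _) (hsnd _ _) J4 J3 hp hr hs' hq h
    exact lt_asymm h1 h2
  · have h1 := JoinedIn.strip_lt d1.symm (hsnd _ _) (hsnd _ _) J2 J1 hr hp hs' hq h
    have h2 := JoinedIn.strip_lt d2 (hsnd _ _) (hsnd _ _) J3 J4 hr hp hq hs' h
    exact lt_asymm h1 h2

end Drawing

/-! ### Lowest and highest levels -/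

namespace Input

variable {n : ℕ} (I : Input n)

/-- The levels of a vertex, after reflection if `σ = false`. -/
def levels (σ : Bool) (v : Fin n) : Set ℤ :=
  {x | ∃ J ∈ I.intervals v, (bif σ then J.1 else -J.2) ≤ x ∧ x ≤ bif σ then J.2 else -J.1}

/-- An assignment of levels for which all edges lead upwards. -/
structure IsLeveling (σ : Bool) (y : Fin n → ℤ) : Prop where
  mem : ∀ v, y v ∈ I.levels σ v
  lt : ∀ k, y (I.tail σ k) < y (I.head σ k)

/-- The assignment of lowest levels. -/
structure IsLowest (σ : Bool) (y : Fin n → ℤ) : Prop extends I.IsLeveling σ y where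
  le : ∀ y', I.IsLeveling σ y' → ∀ v, y v ≤ y' v

variable {I}

theorem tail_not (σ : Bool) (k : Fin I.edges.length) : I.tail (!σ) k = I.head σ k := by
  cases σ <;> rfl

theorem head_not (σ : Bool) (k : Fin I.edges.length) : I.head (!σ) k = I.tail σ k := by
  cases σ <;> rfl

theorem neg_mem_levels {σ : Bool} {v : Fin n} {x : ℤ} (h : x ∈ I.levels σ v) :
    -x ∈ I.levels (!σ) v := by
  obtain ⟨J, hJ, h1, h2⟩ := h
  refine ⟨J, hJ, ?_⟩
  cases σ <;> simp only [cond_true, cond_false, Bool.not_true, Bool.not_false] at * <;> omega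

theorem IsLeveling.neg {σ : Bool} {y : Fin n → ℤ} (h : I.IsLeveling σ y) :
    I.IsLeveling (!σ) fun v => -y v :=
  ⟨fun v => neg_mem_levels (h.mem v), fun k => by
    rw [tail_not, head_not]; exact neg_lt_neg (h.lt k)⟩

theorem mem_levels_true {G : Digraph (Fin n)} {ℓ : Fin n → Finset ℤ} (hI : I.Represents G ℓ)
    (v : Fin n) (x : ℤ) : x ∈ I.levels true v ↔ x ∈ ℓ v := by
  simp [hI.levels v, levelSet, levels]

theorem exists_leveling {G : Digraph (Fin n)} {ℓ : Fin n → Finset ℤ} (hI : I.Represents G ℓ)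
    {D : Drawing G} (hD : D.IsMultilevelPlanar ℓ) :
    ∃ y, I.IsLeveling true y ∧ ∀ v, (D.pos v).2 = (y v : ℝ) := by
  choose y hy hy' using hD.level
  refine ⟨y, ⟨fun v => (mem_levels_true hI v _).2 (hy v), fun k => ?_⟩, hy'⟩
  have h : G.Adj (I.edges.get k).1 (I.edges.get k).2 := (hI.mem_edges _ _).1 (List.get_mem _ _)
  have := hD.upward h (show (0 : unitInterval) < 1 from zero_lt_one)
  simp only [Path.source, Path.target, hy', Int.cast_lt] at this
  exact this

end Input

/-- The lowest levels, before and after reflection, together with lowest vertices. Among the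
vertices with the same lowest level, one with the lowest highest level is chosen. -/
structure IsExtreme {n : ℕ} (I : Input n) (L : Bool → Fin n → ℤ) (a : Bool → Fin n) : Prop where
  lowest : ∀ σ, I.IsLowest σ (L σ)
  le : ∀ σ v, L σ (a σ) < L σ v ∨ L σ (a σ) = L σ v ∧ L (!σ) v ≤ L (!σ) (a σ)

/-- The vertex is forced to be a lowest vertex, or it is the chosen lowest vertex. -/
def Mark {n : ℕ} (L : Bool → Fin n → ℤ) (a : Bool → Fin n) (σ : Bool) (v : Fin n) : Prop :=
  L (!σ) v + L σ (a σ) = 0 ∨ v = a σ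

/-! ### Marked vertices and the obstruction to a drawing -/

namespace IsExtreme

variable {n : ℕ} {I : Input n} {L : Bool → Fin n → ℤ} {a : Bool → Fin n}

theorem min_le (h : IsExtreme I L a) (σ : Bool) (v : Fin n) : L σ (a σ) ≤ L σ v := by
  rcases h.le σ v with h | h <;> omega

/-- The assignment `-L (!σ)` is the highest leveling for `σ`, and it lies above the lowest one. -/
theorem add_le (h : IsExtreme I L a) (σ : Bool) (v : Fin n) : L σ v + L (!σ) v ≤ 0 := by
  have := (h.lowest (!σ)).le _ (h.lowest σ).neg v
  omega

theorem eq_of_mark (h : IsExtreme I L a) {σ : Bool} {v : Fin n} (hv : Mark L a σ v) :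
    L σ v = L σ (a σ) := by
  rcases hv with hv | rfl
  · have := h.add_le σ v
    have := h.min_le σ v
    omega
  · rfl

/-- The highest level of an unmarked vertex is not the minimum, so placing the vertex there keeps it
off the border of the strip. -/
theorem lt_of_not_mark (h : IsExtreme I L a) {σ : Bool} {v : Fin n} (hv : ¬ Mark L a σ v) :
    L σ (a σ) < -L (!σ) v := by
  have := h.add_le σ v
  have := h.min_le σ v
  have : L (!σ) v + L σ (a σ) ≠ 0 := fun h => hv (.inl h)
  omega

/-- One of two distinct marked vertices is not the chosen one, hence forced. The choice minimizes
the highest level among the vertices with minimal lowest level, so the chosen vertex is then forced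
as well. -/
theorem forced (h : IsExtreme I L a) {σ : Bool} {v w : Fin n} (hv : Mark L a σ v)
    (hw : Mark L a σ w) (hvw : v ≠ w) : L (!σ) v + L σ (a σ) = 0 ∧ L (!σ) w + L σ (a σ) = 0 := by
  have key : ∀ x, L (!σ) x + L σ (a σ) = 0 → L (!σ) (a σ) + L σ (a σ) = 0 := by
    intro x hx
    have := h.add_le σ x
    have := h.add_le σ (a σ)
    rcases h.le σ x with h | h <;> omega
  rcases hv with hv | rfl <;> rcases hw with hw | rfl
  · exact ⟨hv, hw⟩
  · exact ⟨hv, key _ hv⟩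
  · exact ⟨key _ hw, hw⟩
  · exact absurd rfl hvw

/-- If two vertices are marked, then both are lowest vertices in every assignment of levels. -/
theorem forced_eq (h : IsExtreme I L a) {σ : Bool} {v w : Fin n} (hv : Mark L a σ v)
    (hw : Mark L a σ w) (hvw : v ≠ w) {y : Fin n → ℤ} (hy : I.IsLeveling σ y) :
    y v = L σ (a σ) ∧ y w = L σ (a σ) := by
  obtain ⟨h1, h2⟩ := h.forced hv hw hvw
  have := fun x => (h.lowest σ).le _ hy x
  have h3 := fun x => (h.lowest (!σ)).le _ hy.neg x
  have := h.eq_of_mark hv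
  have := h.eq_of_mark hw
  constructor
  · have := h3 v; have := (h.lowest σ).le _ hy v; omega
  · have := h3 w; have := (h.lowest σ).le _ hy w; omega

/-- The tail of an edge that enters a marked vertex would lie below the minimum. Thus bottom marks
are sources, and after reflection top marks are sinks. -/
theorem head_ne_of_mark (h : IsExtreme I L a) {σ : Bool} {v : Fin n} (hv : Mark L a σ v)
    (k : Fin I.edges.length) : I.head σ k ≠ v := by
  rintro rfl
  have := (h.lowest σ).lt k
  have := h.min_le σ (I.tail σ k)
  have := h.eq_of_mark hv
  omega

variable {G : Digraph (Fin n)} {c : ℕ → Fin n} {e : ℕ → Fin I.edges.length}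

theorem adj_of_mark_true (h : IsExtreme I L a) (hr : IsRoute I G c e) {v w : Fin n}
    (hv : Mark L a true v) : ¬ G.Adj w v := by
  intro hadj
  obtain ⟨k, hk⟩ := List.mem_iff_get.1 ((hr.mem_edges _ _).2 hadj)
  exact h.head_ne_of_mark hv k (by simp only [Input.head, cond_true, hk])

theorem adj_of_mark_false (h : IsExtreme I L a) (hr : IsRoute I G c e) {v w : Fin n}
    (hv : Mark L a false v) : ¬ G.Adj v w := by
  intro hadj
  obtain ⟨k, hk⟩ := List.mem_iff_get.1 ((hr.mem_edges _ _).2 hadj)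
  exact h.head_ne_of_mark hv k (by simp only [Input.head, cond_false, hk])

theorem not_mark_both (h : IsExtreme I L a) (hr : IsRoute I G c e) {v : Fin n}
    (hv : Mark L a true v) (hv' : Mark L a false v) : False := by
  obtain ⟨i, -, -, rfl⟩ := hr.tour.surj v 0
  rcases hr.tour.step i with hs | hs
  · exact h.adj_of_mark_false hr hv' hs
  · exact h.adj_of_mark_true hr hv hs

/-- If the marks alternate around the cycle, there is no drawing. -/
theorem not_drawable (h : IsExtreme I L a) (hr : IsRoute I G c e) {ℓ : Fin n → Finset ℤ}
    (hI : I.Represents G ℓ) {p q r s : ℕ} (hpq : p < q) (hqr : q < r) (hrs : r < s)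
    (hs : s < p + n) (mp : Mark L a true (c p)) (mq : Mark L a false (c q))
    (mr : Mark L a true (c r)) (ms : Mark L a false (c s)) :
    ¬ ∃ D : Drawing G, D.IsMultilevelPlanar ℓ := by
  rintro ⟨D, hD⟩
  obtain ⟨y, hy, hpos⟩ := Input.exists_leveling hI hD
  have ne : ∀ i j, i < j → j < i + n → c i ≠ c j := fun i j hij hj hc => by
    have := hr.tour.inj hc hij.le hj; omega
  -- Each side carries two distinct marks, so all four marked vertices lie on the border of the
  -- strip in every leveling.
  have h1 := h.forced_eq mp mr (ne p r (by omega) (by omega)) hy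
  have h2 := h.forced_eq mq ms (ne q s (by omega) (by omega)) hy.neg
  refine D.not_alternating hD.planar hD.upward hr.tour (m := (L true (a true) : ℤ))
    (M := ((-L false (a false) : ℤ) : ℝ)) (fun v => ?_) hpq hqr hrs hs ?_ ?_ ?_ ?_
  · rw [hpos, Int.cast_le, Int.cast_le]
    have := (h.lowest true).le _ hy v
    have := (h.lowest false).le _ hy.neg v
    have := h.min_le true v
    have := h.min_le false v
    omega
  all_goals rw [hpos, Int.cast_inj]; omega

end IsExtreme

/-! ### Relaxation -/

section Relaxation

variable {n : ℕ} {I : Input n} {G : Digraph (Fin n)} {c : ℕ → Fin n}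
  {e : ℕ → Fin I.edges.length}

/-- State of the computation of the lowest levels after the relaxation of `j` edges. -/
structure Relaxed (I : Input n) (G : Digraph (Fin n)) (c : ℕ → Fin n)
    (e : ℕ → Fin I.edges.length) (σ : Bool) (j : ℕ) (y : Fin n → ℤ) : Prop where
  mem : ∀ v, y v ∈ I.levels σ v
  le : ∀ y', I.IsLeveling σ y' → ∀ v, y v ≤ y' v
  lt : ∀ i < n, rank G c σ i < j → y (I.tail σ (e i)) < y (I.head σ (e i))

theorem Relaxed.isLowest (hr : IsRoute I G c e) {σ : Bool} {y : Fin n → ℤ}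
    (h : Relaxed I G c e σ n y) : I.IsLowest σ y :=
  ⟨⟨h.mem, fun k => by
    obtain ⟨i, hi, rfl⟩ := hr.exists_index k
    exact h.lt i hi (rank_lt hi)⟩, h.le⟩

theorem Relaxed.skip {σ : Bool} {i : ℕ} {y : Fin n → ℤ} (hi : i < n)
    (h : Relaxed I G c e σ (rank G c σ i) y) (hlt : y (I.tail σ (e i)) < y (I.head σ (e i))) :
    Relaxed I G c e σ (rank G c σ i + 1) y := by
  refine ⟨h.mem, h.le, fun k hk hlt' => ?_⟩
  rcases Nat.lt_succ_iff_lt_or_eq.1 hlt' with h' | h'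
  · exact h.lt k hk h'
  · rw [rank_injOn hk hi h']; exact hlt

/-- In topological order the head of the current edge is not the tail of this edge or of an earlier
one. Raising it therefore preserves the inequalities already established. Minimality of `x` keeps
`y` below all levelings. -/
theorem Relaxed.update (hr : IsRoute I G c e) {σ : Bool} {i : ℕ} {y : Fin n → ℤ} (hi : i < n)
    (h : Relaxed I G c e σ (rank G c σ i) y) (hle : y (I.head σ (e i)) ≤ y (I.tail σ (e i)))
    {x : ℤ} (hx : IsLeast {x ∈ I.levels σ (I.head σ (e i)) | y (I.tail σ (e i)) < x} x) :
    Relaxed I G c e σ (rank G c σ i + 1) (Function.update y (I.head σ (e i)) x) := by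
  have hx' : y (I.tail σ (e i)) < x := hx.1.2
  refine ⟨fun v => ?_, fun y' hy' v => ?_, fun k hk hlt => ?_⟩
  · by_cases hv : v = I.head σ (e i)
    · subst hv; simpa using hx.1.1
    · simpa [hv] using h.mem v
  · by_cases hv : v = I.head σ (e i)
    · subst hv
      simpa using hx.2 ⟨hy'.mem _, (h.le _ hy' _).trans_lt (hy'.lt _)⟩
    · simpa [hv] using h.le _ hy' v
  · have hne : I.tail σ (e k) ≠ I.head σ (e i) :=
      (hr.head_ne_tail hk hi (by omega)).symm
    rw [Function.update_of_ne hne]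
    rcases Nat.lt_succ_iff_lt_or_eq.1 hlt with h' | h'
    · by_cases hv : I.head σ (e k) = I.head σ (e i)
      · rw [hv, Function.update_self]
        have := h.lt k hk h'
        rw [hv] at this
        omega
      · rw [Function.update_of_ne hv]; exact h.lt k hk h'
    · rw [rank_injOn hk hi h', Function.update_self]; exact hx'

/-- Since `y` bounds all levelings from below, each of them would put the head on an admissible
level above `y` of the tail. -/
theorem Relaxed.no_leveling {σ : Bool} {i j : ℕ} {y : Fin n → ℤ} (h : Relaxed I G c e σ j y)
    (hx : {x ∈ I.levels σ (I.head σ (e i)) | y (I.tail σ (e i)) < x} = ∅) (y' : Fin n → ℤ) :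
    ¬ I.IsLeveling σ y' := fun hy' => by
  have : y' (I.head σ (e i)) ∈ {x ∈ I.levels σ (I.head σ (e i)) | y (I.tail σ (e i)) < x} :=
    ⟨hy'.mem _, (h.le _ hy' _).trans_lt (hy'.lt _)⟩
  rw [hx] at this
  exact this

end Relaxation

/-! ### Polylines as paths -/

theorem exists_segment_path (p q : ℝ × ℝ) (h : p.2 < q.2) :
    ∃ γ : Path p q, (StrictMono fun t => (γ t).2) ∧ Set.range γ = segment ℝ p q := by
  refine ⟨⟨⟨fun t => AffineMap.lineMap p q (t : ℝ), by fun_prop⟩, by simp, by simp⟩, ?_, ?_⟩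
  · intro s t hst
    have hst' : (s : ℝ) < t := hst
    simp only [Path.coe_mk', ContinuousMap.coe_mk, AffineMap.lineMap_apply_module, Prod.snd_add,
      Prod.smul_snd, smul_eq_mul]
    nlinarith
  · rw [segment_eq_image_lineMap]
    ext x
    simp [unitInterval]

theorem Path.strictMono_trans {p q r : ℝ × ℝ} {γ : Path p q} {γ' : Path q r}
    (h : StrictMono fun t => (γ t).2) (h' : StrictMono fun t => (γ' t).2) :
    StrictMono fun t => (γ.trans γ' t).2 := by
  intro s t hst
  have hst' : (s : ℝ) < t := hst
  simp only [Path.trans_apply]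
  split_ifs with hs ht ht
  · exact h (by rw [← Subtype.coe_lt_coe]; simp only; linarith)
  · have h1 := h.monotone (unitInterval.le_one' :
      (⟨2 * s, (unitInterval.mul_pos_mem_iff zero_lt_two).2 ⟨s.2.1, hs⟩⟩ : unitInterval) ≤ 1)
    have h2 := h' (show (0 : unitInterval) <
      ⟨2 * t - 1, unitInterval.two_mul_sub_one_mem_iff.2 ⟨(not_le.1 ht).le, t.2.2⟩⟩ by
        rw [← Subtype.coe_lt_coe]; simp only [Set.Icc.coe_zero]; linarith)
    simp only [Path.target, Path.source] at h1 h2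
    exact h1.trans_lt h2
  · linarith
  · exact h' (by rw [← Subtype.coe_lt_coe]; simp only; linarith)

theorem exists_polyline_path (p q : ℝ × ℝ) (l : List (ℝ × ℝ))
    (h : (p :: (l ++ [q])).Pairwise fun a b => a.2 < b.2) :
    ∃ γ : Path p q, (StrictMono fun t => (γ t).2) ∧ Set.range γ = polyline (p :: (l ++ [q])) := by
  induction l generalizing p with
  | nil =>
    obtain ⟨γ, h1, h2⟩ := exists_segment_path p q (by simpa using h)
    refine ⟨γ, h1, h2.trans ?_⟩
    simp only [List.nil_append, polyline]
    exact (Set.union_eq_self_of_subset_right (by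
      rintro x rfl; exact right_mem_segment ℝ _ _)).symm
  | cons b l ih =>
    have h' := List.pairwise_cons.1 h
    obtain ⟨γ, h1, h2⟩ := exists_segment_path p b (h'.1 b (by simp))
    obtain ⟨γ', h1', h2'⟩ := ih b h'.2
    refine ⟨γ.trans γ', Path.strictMono_trans h1 h1', ?_⟩
    rw [Path.trans_range, h2, h2', List.cons_append, polyline]

theorem exists_of_mem_segment {p q x : ℝ × ℝ} (h : x ∈ segment ℝ p q) :
    ∃ t : ℝ, 0 ≤ t ∧ t ≤ 1 ∧ x.1 = p.1 + t * (q.1 - p.1) ∧ x.2 = p.2 + t * (q.2 - p.2) := by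
  obtain ⟨a, b, ha, hb, hab, rfl⟩ := h
  refine ⟨b, hb, by linarith, ?_, ?_⟩
  · simp only [Prod.fst_add, Prod.smul_fst, smul_eq_mul]
    linear_combination p.1 * hab
  · simp only [Prod.snd_add, Prod.smul_snd, smul_eq_mul]
    linear_combination p.2 * hab

/-! ### The drawing -/

/-- A drawing with two paths next to each other. The right-hand path starts at the vertex `d K`,
which is connected to the left end of the left-hand path by an edge above the latter; the
right end of the left-hand path is `d 0`, which is connected to the right end of the right-hand
path by an edge below the latter. -/
noncomputable def layout {n : ℕ} (d : ℕ → Fin n) (K : ℕ) (x y : Fin n → ℤ) : PolylineData n where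
  pos v := (x v, y v)
  bends e :=
    if e = (d (K - 1), d K) then [((x e.1 : ℚ), (y e.2 : ℚ) - 1 / 2)]
    else if e = (d 0, d (n - 1)) then [((x e.2 : ℚ), (y e.1 : ℚ) + 1 / 2)]
    else []

/-- Positions before `K` form the left path, the others the right path. As all heights are integers,
`lt_max` and `min_lt` leave free corridors just below `M` over the left path and just above `m`
under the right path. -/
structure IsLayout {n : ℕ} (G : Digraph (Fin n)) (d : ℕ → Fin n) (K : ℕ) (x y : Fin n → ℤ)
    (m M : ℤ) : Prop where
  tour : IsTour G d
  pos : 1 ≤ K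
  lt : K < n
  left : ∀ i < K, x (d i) = -i
  right : ∀ i, K ≤ i → i < n → x (d i) = i
  mono : ∀ u v, G.Adj u v → y u < y v
  lt_max : ∀ i < K, y (d i) < M
  min_lt : ∀ i, K ≤ i → i < n → m < y (d i)
  zero : y (d 0) = m
  top : y (d K) = M
  adj_top : G.Adj (d (K - 1)) (d K)
  adj_bot : G.Adj (d 0) (d (n - 1))

/-! ### Planarity of the layout -/

namespace IsLayout

variable {n : ℕ} {G : Digraph (Fin n)} {d : ℕ → Fin n} {K : ℕ} {x y : Fin n → ℤ} {m M : ℤ}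

/-- The region in which the edge between the vertices `d i` and `d (i + 1)` is drawn. -/
def Region (d : ℕ → Fin n) (K : ℕ) (x y : Fin n → ℤ) (m M : ℤ) (i : ℕ) (p : ℝ × ℝ) : Prop :=
  (i + 1 < K ∧ -(i + 1 : ℝ) ≤ p.1 ∧ p.1 ≤ -i ∧ p.2 ≤ M - 1 ∧
    (p.1 = -i → p = ((x (d i) : ℝ), (y (d i) : ℝ))) ∧
    (p.1 = -(i + 1 : ℝ) → p = ((x (d (i + 1)) : ℝ), (y (d (i + 1)) : ℝ)))) ∨
  (i + 1 = K ∧ -(i : ℝ) ≤ p.1 ∧ p.1 ≤ i + 1 ∧ (p.1 = -i ∨ (M : ℝ) - 1 / 2 < p.2) ∧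
    (p.1 = i + 1 → p = ((x (d (i + 1)) : ℝ), (y (d (i + 1)) : ℝ)))) ∨
  (K ≤ i ∧ i + 1 < n ∧ (i : ℝ) ≤ p.1 ∧ p.1 ≤ i + 1 ∧ (m : ℝ) + 1 ≤ p.2 ∧
    (p.1 = i → p = ((x (d i) : ℝ), (y (d i) : ℝ))) ∧
    (p.1 = (i + 1 : ℝ) → p = ((x (d (i + 1)) : ℝ), (y (d (i + 1)) : ℝ)))) ∨
  (i + 1 = n ∧ 0 ≤ p.1 ∧ p.1 ≤ i ∧ (p.1 = i ∨ p.2 ≤ (m : ℝ) + 1 / 2) ∧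
    (p.1 = 0 → p = ((x (d 0) : ℝ), (y (d 0) : ℝ))))

/-- The regions of two edges meet in a common end vertex only. -/
theorem region_inter (h : IsLayout G d K x y m M) {i j : ℕ} (hij : i < j) {p : ℝ × ℝ}
    (hi : Region d K x y m M i p) (hj : Region d K x y m M j p) :
    (j = i + 1 ∧ p = ((x (d j) : ℝ), (y (d j) : ℝ))) ∨
      (i = 0 ∧ j + 1 = n ∧ p = ((x (d 0) : ℝ), (y (d 0) : ℝ))) := by
  have hmM : m < M := by
    have := h.lt_max 0 h.pos
    rw [h.zero] at this
    exact this
  have hmM' : (m : ℝ) + 1 ≤ M := by exact_mod_cast hmM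
  have hn := h.tour.three_le
  have hK := h.pos
  have hKn := h.lt
  have hij' : (i : ℝ) + 1 ≤ j := by exact_mod_cast hij
  have hi0 : (0 : ℝ) ≤ i := Nat.cast_nonneg i
  have consec : ∀ i j : ℕ, i < j → (j : ℝ) ≤ i + 1 → j = i + 1 := fun i j h1 h2 => by
    have : j ≤ i + 1 := by exact_mod_cast h2
    omega
  have eq0 : (i : ℝ) ≤ 0 → i = 0 := fun h => by
    have := le_antisymm h hi0
    exact_mod_cast this
  -- The cases are left path, upper connecting edge, right path, lower connecting edge. Edges of the
  -- paths occupy vertical slabs that at most touch. The upper edge is either vertical at the left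
  -- end or above `M - 1 / 2`, while the left path is below `M - 1`; the lower edge and the right
  -- path are symmetric. The two connecting edges are kept apart by `m + 1 ≤ M`.
  rcases hi with ⟨hi, h1, h2, h3, h4, h5⟩ | ⟨hi, h1, h2, h3, h4⟩ | ⟨hi, hi', h1, h2, h3, h4, h5⟩ |
    ⟨hi, h1, h2, h3, h4⟩ <;>
  rcases hj with ⟨hj, g1, g2, g3, g4, g5⟩ | ⟨hj, g1, g2, g3, g4⟩ | ⟨hj, hj', g1, g2, g3, g4, g5⟩ |
    ⟨hj, g1, g2, g3, g4⟩
  · obtain rfl := consec _ _ hij (by linarith)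
    push_cast at g4
    exact .inl ⟨rfl, g4 (by push_cast at *; linarith)⟩
  · rcases g3 with g3 | g3
    · obtain rfl := consec _ _ hij (by linarith)
      exact .inl ⟨rfl, h5 (by push_cast at *; linarith)⟩
    · linarith
  · have : (0 : ℝ) < j := by exact_mod_cast (by omega : 0 < j)
    linarith
  · have hi2 := eq0 (by linarith)
    exact .inr ⟨hi2, hj, g4 (by linarith)⟩
  · omega
  · omega
  · obtain rfl := consec _ _ hij (by linarith)
    exact .inl ⟨rfl, g4 (by push_cast at *; linarith)⟩
  · rcases h3 with h3 | h3
    · have hi2 := eq0 (by linarith)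
      subst hi2
      exact .inr ⟨rfl, hj, g4 (by simpa using h3)⟩
    · rcases g3 with g3 | g3
      · obtain rfl := consec _ _ hij (by linarith)
        exact .inl ⟨rfl, by simpa using h4 (by push_cast at *; linarith)⟩
      · linarith
  · omega
  · omega
  · obtain rfl := consec _ _ hij (by linarith)
    exact .inl ⟨rfl, g4 (by push_cast at *; linarith)⟩
  · rcases g3 with g3 | g3
    · obtain rfl := consec _ _ hij (by linarith)
      exact .inl ⟨rfl, h5 (by push_cast at *; linarith)⟩
    · linarith
  · omega
  · omega
  · omega
  · omega

theorem polyline_straight {p q z : ℝ × ℝ} (hz : z ∈ polyline [p, q]) :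
    ∃ t : ℝ, 0 ≤ t ∧ t ≤ 1 ∧ z.1 = p.1 + t * (q.1 - p.1) ∧ z.2 = p.2 + t * (q.2 - p.2) := by
  simp only [polyline] at hz
  rcases hz with hz | rfl
  · exact exists_of_mem_segment hz
  · exact ⟨1, by norm_num, le_rfl, by ring, by ring⟩

theorem polyline_bent {p b q z : ℝ × ℝ} (hz : z ∈ polyline [p, b, q]) :
    (∃ t : ℝ, 0 ≤ t ∧ t ≤ 1 ∧ z.1 = p.1 + t * (b.1 - p.1) ∧ z.2 = p.2 + t * (b.2 - p.2)) ∨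
    ∃ t : ℝ, 0 ≤ t ∧ t ≤ 1 ∧ z.1 = b.1 + t * (q.1 - b.1) ∧ z.2 = b.2 + t * (q.2 - b.2) := by
  rw [polyline] at hz
  rcases hz with hz | hz
  · exact .inl (exists_of_mem_segment hz)
  · exact .inr (polyline_straight hz)

theorem region_straight (h : IsLayout G d K x y m M) {i : ℕ} (hi : i + 1 < n) (hK : i + 1 ≠ K)
    {z : ℝ × ℝ} {t : ℝ} (ht : 0 ≤ t) (ht' : t ≤ 1)
    (h1 : z.1 = x (d i) + t * (x (d (i + 1)) - x (d i)))
    (h2 : z.2 = y (d i) + t * (y (d (i + 1)) - y (d i))) : Region d K x y m M i z := by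
  have ends : (t = 0 → z = ((x (d i) : ℝ), (y (d i) : ℝ))) ∧
      (t = 1 → z = ((x (d (i + 1)) : ℝ), (y (d (i + 1)) : ℝ))) := by
    constructor <;> rintro rfl <;> refine Prod.ext ?_ ?_ <;> simp only [h1, h2] <;> ring
  rcases Nat.lt_or_ge (i + 1) K with hlt | hge
  · left
    rw [h.left i (by omega), h.left (i + 1) hlt] at h1
    push_cast at h1
    have e1 : (y (d i) : ℝ) ≤ M - 1 := by
      have := h.lt_max i (by omega); exact_mod_cast Int.le_sub_one_of_lt this
    have e2 : (y (d (i + 1)) : ℝ) ≤ M - 1 := by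
      have := h.lt_max (i + 1) hlt; exact_mod_cast Int.le_sub_one_of_lt this
    refine ⟨hlt, by linarith, by linarith, ?_, fun h' => ends.1 (by linarith),
      fun h' => ends.2 (by linarith)⟩
    rw [h2]
    nlinarith
  · right; right; left
    rw [h.right i (by omega) (by omega), h.right (i + 1) hge hi] at h1
    push_cast at h1
    have e1 : (m : ℝ) + 1 ≤ y (d i) := by
      have := h.min_lt i (by omega) (by omega); exact_mod_cast this
    have e2 : (m : ℝ) + 1 ≤ y (d (i + 1)) := by
      have := h.min_lt (i + 1) hge hi; exact_mod_cast this
    refine ⟨by omega, hi, by linarith, by linarith, ?_, fun h' => ends.1 (by linarith),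
      fun h' => ends.2 (by linarith)⟩
    rw [h2]
    nlinarith

theorem ne_of_lt (h : IsLayout G d K x y m M) {i j : ℕ} (hi : i < j) (hj : j < n) :
    d i ≠ d j := fun he => by
  have := h.tour.inj he hi.le (by omega); omega

/-- The sequence of points of an edge. -/
theorem region_of_mem (h : IsLayout G d K x y m M) {u v : Fin n} (huv : G.Adj u v) {i : ℕ}
    (hi : i < n) (hc : d i = u ∧ d (i + 1) = v ∨ d i = v ∧ d (i + 1) = u) {z : ℝ × ℝ}
    (hz : z ∈ polyline (((layout d K x y).pos u ::
      ((layout d K x y).bends (u, v) ++ [(layout d K x y).pos v])).map toPlane)) :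
    Region d K x y m M i z := by
  have hn := h.tour.three_le
  have hK := h.pos
  have hKn := h.lt
  have hd0 : d n = d 0 := by simpa using h.tour.add_period 0
  by_cases h1 : (u, v) = (d (K - 1), d K)
  · obtain ⟨rfl, rfl⟩ := Prod.mk.inj h1
    obtain rfl : i = K - 1 := by
      rcases hc with ⟨hc, -⟩ | ⟨hc, hc'⟩
      · by_contra hne
        rcases lt_or_gt_of_ne hne with h' | h'
        · exact h.ne_of_lt h' (by omega) hc
        · exact h.ne_of_lt h' (by omega) hc.symm
      · have hiK : i = K := by
          by_contra hne
          rcases lt_or_gt_of_ne hne with h' | h'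
          · exact h.ne_of_lt h' (by omega) hc
          · exact h.ne_of_lt h' (by omega) hc.symm
        subst hiK
        have := h.tour.inj hc'.symm (by omega) (by omega)
        omega
    simp only [layout, if_true, List.cons_append, List.nil_append, List.map_cons, List.map_nil] at hz
    right; left
    have hx := h.left (K - 1) (by omega)
    have hx' := h.right K le_rfl hKn
    have hKK : K - 1 + 1 = K := by omega
    have hcast : ((K - 1 : ℕ) : ℝ) + 1 = K := by exact_mod_cast congrArg (Nat.cast (R := ℝ)) hKK
    have hK1 : (0 : ℝ) ≤ ((K - 1 : ℕ) : ℝ) := Nat.cast_nonneg _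
    rcases polyline_bent hz with ⟨t, ht, ht', e1, e2⟩ | ⟨t, ht, ht', e1, e2⟩ <;>
      simp only [toPlane, hx, hx', h.top] at e1 e2 <;> push_cast at e1 e2
    · have e3 : z.1 = -((K - 1 : ℕ) : ℝ) := by linarith
      refine ⟨hKK, e3.ge, by linarith, .inl e3, fun h' => ?_⟩
      linarith
    · refine ⟨hKK, by nlinarith, by nlinarith, ?_, fun h' => ?_⟩
      · rcases ht.eq_or_lt with rfl | hlt
        · left; linarith
        · right; linarith
      · rw [hKK, hx', h.top]
        -- The slanted segment has horizontal extent `2 * (K - 1) + 1`, which is not zero, so the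
        -- abscissa determines the parameter.
        have ht1 : t = 1 := by
          have : (t - 1) * (2 * ((K - 1 : ℕ) : ℝ) + 1) = 0 := by
            rw [h', ← hcast] at e1; linear_combination -e1
          rcases mul_eq_zero.1 this with h0 | h0
          · linarith
          · linarith
        subst ht1
        refine Prod.ext ?_ ?_ <;> simp only [e1, e2] <;> push_cast <;> ring
  · by_cases h2 : (u, v) = (d 0, d (n - 1))
    · obtain ⟨rfl, rfl⟩ := Prod.mk.inj h2
      obtain rfl : i = n - 1 := by
        rcases hc with ⟨hc, hc'⟩ | ⟨hc, -⟩
        · by_contra hne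
          rcases Nat.eq_zero_or_pos i with rfl | hpos
          · exact h.ne_of_lt (show 0 + 1 < n - 1 by omega) (by omega) hc'
          · exact h.ne_of_lt hpos hi hc.symm
        · by_contra hne
          exact h.ne_of_lt (show i < n - 1 by omega) (by omega) hc
      simp only [layout, if_neg h1, if_true, List.cons_append, List.nil_append, List.map_cons,
        List.map_nil] at hz
      right; right; right
      have hx := h.left 0 (by omega)
      have hx' := h.right (n - 1) (by omega) (by omega)
      have hn1 : (1 : ℝ) ≤ ((n - 1 : ℕ) : ℝ) := by exact_mod_cast (by omega : 1 ≤ n - 1)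
      rcases polyline_bent hz with ⟨t, ht, ht', e1, e2⟩ | ⟨t, ht, ht', e1, e2⟩ <;>
        simp only [toPlane, hx, hx', h.zero] at e1 e2 <;> push_cast at e1 e2
      · refine ⟨by omega, by nlinarith, by nlinarith, .inr (by linarith), fun h' => ?_⟩
        rw [hx, h.zero]
        have ht1 : t = 0 := by
          have : t * ((n - 1 : ℕ) : ℝ) = 0 := by rw [h'] at e1; linear_combination -e1
          rcases mul_eq_zero.1 this with h0 | h0
          · exact h0
          · linarith
        subst ht1
        refine Prod.ext ?_ ?_ <;> simp only [e1, e2] <;> push_cast <;> ring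
      · have e3 : z.1 = ((n - 1 : ℕ) : ℝ) := by linarith
        refine ⟨by omega, by linarith, e3.le, .inl e3, fun h' => ?_⟩
        linarith
    · simp only [layout, if_neg h1, if_neg h2, List.nil_append, List.map_cons, List.map_nil] at hz
      obtain ⟨t, ht, ht', e1, e2⟩ := polyline_straight hz
      simp only [toPlane] at e1 e2
      push_cast at e1 e2
      -- The positions that pass from one path to the other carry the two bent edges only, so a
      -- straight edge lies within one path.
      have hiK : i + 1 ≠ K := by
        rintro rfl
        rw [Nat.add_sub_cancel] at h1
        rcases hc with ⟨rfl, rfl⟩ | ⟨rfl, rfl⟩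
        · exact h1 rfl
        · have := h.adj_top
          rw [Nat.add_sub_cancel] at this
          exact h.tour.cycle.oriented _ _ huv this
      have hin : i + 1 ≠ n := by
        intro hin
        rw [hin, hd0, show i = n - 1 by omega] at hc
        rcases hc with ⟨rfl, rfl⟩ | ⟨rfl, rfl⟩
        · exact h.tour.cycle.oriented _ _ huv h.adj_bot
        · exact h2 rfl
      rcases hc with ⟨rfl, rfl⟩ | ⟨rfl, rfl⟩
      · exact h.region_straight (by omega) hiK ht ht' e1 e2
      -- The edge is directed against the tour, so its parameter is reversed.
      · exact h.region_straight (t := 1 - t) (by omega) hiK (by linarith) (by linarith)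
          (by rw [e1]; ring) (by rw [e2]; ring)

theorem pos_injective (h : IsLayout G d K x y m M) {i j : ℕ} (hi : i < n) (hj : j < n)
    (he : x (d i) = x (d j)) : i = j := by
  have hK := h.pos
  rcases Nat.lt_or_ge i K with h1 | h1 <;> rcases Nat.lt_or_ge j K with h2 | h2
  · rw [h.left i h1, h.left j h2] at he; omega
  · rw [h.left i h1, h.right j h2 hj] at he; omega
  · rw [h.right i h1 hi, h.left j h2] at he; omega
  · rw [h.right i h1 hi, h.right j h2 hj] at he; omega

/-- Every edge stays in the region of its position, and the vertex `d i` lies in the region of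
position `i`. Hence all conditions on incidences and crossings follow from `region_inter`. -/
theorem exists_drawing (h : IsLayout G d K x y m M) {ℓ : Fin n → Finset ℤ}
    (hy : ∀ v, y v ∈ ℓ v) :
    ∃ D : Drawing G, D.IsMultilevelPlanar ℓ ∧ (layout d K x y).Describes D := by
  have hn := h.tour.three_le
  have hK := h.pos
  have hKn := h.lt
  have hd0 : d n = d 0 := by simpa using h.tour.add_period 0
  have hex : ∀ u v, G.Adj u v → ∃ γ : Path (toPlane ((layout d K x y).pos u))
      (toPlane ((layout d K x y).pos v)), (StrictMono fun t => (γ t).2) ∧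
      Set.range γ = polyline (((layout d K x y).pos u ::
        ((layout d K x y).bends (u, v) ++ [(layout d K x y).pos v])).map toPlane) := by
    intro u v huv
    have hlt : (y u : ℝ) < y v := by exact_mod_cast h.mono u v huv
    rw [List.map_cons, List.map_append, List.map_cons, List.map_nil]
    apply exists_polyline_path
    by_cases h1 : (u, v) = (d (K - 1), d K)
    · obtain ⟨rfl, rfl⟩ := Prod.mk.inj h1
      have : (y (d (K - 1)) : ℝ) + 1 ≤ y (d K) := by exact_mod_cast h.mono _ _ huv
      simp [layout, toPlane, hlt]
      linarith
    · by_cases h2 : (u, v) = (d 0, d (n - 1))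
      · obtain ⟨rfl, rfl⟩ := Prod.mk.inj h2
        have : (y (d 0) : ℝ) + 1 ≤ y (d (n - 1)) := by exact_mod_cast h.mono _ _ huv
        simp only [layout, if_neg h1]
        simp [toPlane, hlt]
        linarith
      · simp only [layout, if_neg h1, if_neg h2]
        simpa [toPlane] using hlt
  choose γ hγ hγ' using hex
  let D : Drawing G := ⟨fun v => toPlane ((layout d K x y).pos v), fun {u v} h => γ u v h,
    fun {u v} h s t hst => (hγ u v h).injective (congrArg Prod.snd hst)⟩
  have hpos : ∀ v, D.pos v = ((x v : ℝ), (y v : ℝ)) := fun v => by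
    simp [D, layout, toPlane]
  have hreg : ∀ {u v : Fin n} (huv : G.Adj u v) {i : ℕ}, i < n →
      (d i = u ∧ d (i + 1) = v ∨ d i = v ∧ d (i + 1) = u) → ∀ z ∈ Set.range (D.curve huv),
      Region d K x y m M i z := by
    intro u v huv i hi hc z hz
    have hz' : z ∈ Set.range (γ u v huv) := hz
    rw [hγ'] at hz'
    exact h.region_of_mem huv hi hc hz'
  have hinj : Function.Injective D.pos := by
    intro u v huv
    rw [hpos, hpos] at huv
    obtain ⟨i, -, hi, rfl⟩ := h.tour.surj u 0
    obtain ⟨j, -, hj, rfl⟩ := h.tour.surj v 0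
    have he : x (d i) = x (d j) := by exact_mod_cast (Prod.mk.inj huv).1
    rw [h.pos_injective (by omega) (by omega) he]
  have hmem : ∀ i < n, Region d K x y m M i (D.pos (d i)) := by
    intro i hi
    rcases h.tour.step i with hs | hs
    · exact hreg hs hi (.inl ⟨rfl, rfl⟩) _ ⟨0, by simp⟩
    · exact hreg hs hi (.inr ⟨rfl, rfl⟩) _ ⟨1, by simp⟩
  refine ⟨D, ⟨⟨hinj, ?_, ?_⟩, fun {u v} h => hγ u v h, fun v => ⟨y v, hy v, by rw [hpos]⟩⟩,
    fun v => rfl, fun {u v} huv => hγ' u v huv⟩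
  · intro u v huv w hw
    obtain ⟨i, -, hi, hc⟩ := h.tour.exists_step huv 0
    obtain ⟨k, -, hk, rfl⟩ := h.tour.surj w 0
    rw [zero_add] at hi hk
    have h1 := hreg huv hi hc _ hw
    have h2 := hmem k hk
    have key : d k = d i ∨ d k = d (i + 1) := by
      rcases lt_trichotomy i k with hlt | rfl | hgt
      · rcases h.region_inter hlt h1 h2 with ⟨rfl, -⟩ | ⟨rfl, -, hp⟩
        · exact .inr rfl
        · rw [← hpos] at hp; exact .inl (hinj hp)
      · exact .inl rfl
      · rcases h.region_inter hgt h2 h1 with ⟨rfl, hp⟩ | ⟨rfl, hin, hp⟩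
        · rw [← hpos] at hp; exact .inl (hinj hp)
        · right; rw [hin, hd0]
    rcases hc with ⟨hc, hc'⟩ | ⟨hc, hc'⟩ <;> rw [hc, hc'] at key <;> tauto
  · intro u v u' v' huv huv' hne z ⟨hz, hz'⟩
    obtain ⟨i, -, hi, hc⟩ := h.tour.exists_step huv 0
    obtain ⟨j, -, hj, hc'⟩ := h.tour.exists_step huv' 0
    rw [zero_add] at hi hj
    have h1 := hreg huv hi hc _ hz
    have h2 := hreg huv' hj hc' _ hz'
    have hij : i ≠ j := by
      rintro rfl
      rcases hc with ⟨rfl, rfl⟩ | ⟨rfl, rfl⟩ <;> rcases hc' with ⟨rfl, rfl⟩ | ⟨rfl, rfl⟩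
      · exact hne rfl
      · exact h.tour.cycle.oriented _ _ huv huv'
      · exact h.tour.cycle.oriented _ _ huv huv'
      · exact hne rfl
    have key : ∃ w, (w = d i ∨ w = d (i + 1)) ∧ (w = d j ∨ w = d (j + 1)) ∧ z = D.pos w := by
      rcases lt_or_gt_of_ne hij with hlt | hgt
      · rcases h.region_inter hlt h1 h2 with ⟨rfl, hp⟩ | ⟨rfl, hin, hp⟩
        · exact ⟨_, .inr rfl, .inl rfl, by rw [hp, hpos]⟩
        · exact ⟨_, .inl rfl, .inr (by rw [hin, hd0]), by rw [hp, hpos]⟩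
      · rcases h.region_inter hgt h2 h1 with ⟨rfl, hp⟩ | ⟨rfl, hin, hp⟩
        · exact ⟨_, .inl rfl, .inr rfl, by rw [hp, hpos]⟩
        · exact ⟨_, .inr (by rw [hin, hd0]), .inl rfl, by rw [hp, hpos]⟩
    obtain ⟨w, hw, hw', hp⟩ := key
    refine ⟨w, ?_, ?_, hp⟩
    · rcases hc with ⟨hc, hc'⟩ | ⟨hc, hc'⟩ <;> rw [hc, hc'] at hw <;> tauto
    · rcases hc' with ⟨hc, hc'⟩ | ⟨hc, hc'⟩ <;> rw [hc, hc'] at hw' <;> tauto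

end IsLayout

namespace RAM

open Program Term Test

attribute [local simp] Program.run Term.eval Test.Holds Term.cost Test.cost Program.bound
  tailTerm headTerm incr

/-! ### Counting loops -/

theorem Runs.le {p : Program} {s : State} {B B' : ℕ} {Q : State → Prop} (h : Runs p s B Q)
    (hB : B ≤ B') : Runs p s B' Q :=
  h.mono hB fun _ _ h => h

/-- The invariant refers to the state after the counter is increased. Separate bounds `b k` allow
amortization. The test takes `e.cost + 4` steps and the increment `4`; the extra round pays for the
initialization and the last test. -/
theorem Runs.forLoop {e : Term} {p : Program} {s : State} (N : ℕ) (b : ℕ → ℕ)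
    (J : ℕ → State → Prop) (hp : p.keepsReg 2 = true)
    (he : ∀ s', Frame (forLoop e p) s s' → e.eval s' = N)
    (h0 : J 0 { s with reg := Function.update s.reg 2 0 })
    (hstep : ∀ k < N, ∀ s', Frame (RAM.forLoop e p) s s' → s'.reg 2 = k → J k s' →
      Runs p s' (b k) fun s'' => J (k + 1) { s'' with reg := Function.update s''.reg 2 (k + 1) }) :
    Runs (RAM.forLoop e p) s ((e.cost + 8) * (N + 1) + ∑ k ∈ Finset.range N, b k) (J N) := by
  have h1 : Runs (assign 2 (const 0)) s 2 fun s' => s'.reg 2 = 0 ∧ J 0 s' :=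
    (Runs.of_run rfl (by simpa using h0)).mono le_rfl fun _ _ h => h
  refine (h1.seq (B' := ∑ k ∈ Finset.range N, (e.cost + 4 + (b k + 4)) + (e.cost + 4))
    fun s₁ hf ⟨hz, hJ⟩ => ?_).mono ?_ fun _ _ h => h
  · refine (Runs.loop N (fun k => b k + 4) (fun k s' => s'.reg 2 = k ∧ J k s') ⟨by simpa using hz, hJ⟩
      (fun k hk s' hf' ⟨hr, hJ'⟩ => ?_) fun s' hf' ⟨hr, _⟩ => ?_).mono ?_ fun _ _ h => h.2
    · have hF : Frame (RAM.forLoop e p) s s' :=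
        hf.seq_left.trans (Frame.seq_right ⟨hf'.reg, hf'.arr, hf'.out⟩)
      refine ⟨by simp [he s' hF, hr, hk], ?_⟩
      refine (hstep k hk s' hF hr hJ').seq (B' := 4) fun s'' hf'' hJ'' => ?_
      have h2 : s''.reg 2 = k := (hf''.reg 2 hp).trans hr
      refine (Runs.of_run rfl ?_).mono (by simp) fun _ _ h => h
      simp only [incr, Program.run, Term.eval, h2]
      exact ⟨by simp, hJ''⟩
    · have hF : Frame (RAM.forLoop e p) s s' :=
        hf.seq_left.trans (Frame.seq_right ⟨hf'.reg, hf'.arr, hf'.out⟩)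
      simp [he s' hF, hr]
    · simp only [Test.lt, Test.cost, Term.cost]
      have : ∀ k, (1 + e.cost + 1 + 1 + 1 + (b k + 4)) = e.cost + 4 + (b k + 4) := fun k => by ring
      simp only [add_comm e.cost 1, this]
      omega
  · simp only [Finset.sum_add_distrib, Finset.sum_const, Finset.card_range, smul_eq_mul]
    ring_nf
    omega

theorem Runs.forLoop_run {e : Term} {p : Program} {s : State} (N : ℕ)
    (J : ℕ → State → Prop) (hp : p.keepsReg 2 = true) (hl : p.LoopFree = true)
    (he : ∀ s', Frame (RAM.forLoop e p) s s' → e.eval s' = N)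
    (h0 : J 0 { s with reg := Function.update s.reg 2 0 })
    (hstep : ∀ k < N, ∀ s', Frame (RAM.forLoop e p) s s' → s'.reg 2 = k → J k s' →
      J (k + 1) { p.run s' with reg := Function.update (p.run s').reg 2 (k + 1) }) :
    Runs (RAM.forLoop e p) s ((e.cost + 8 + p.bound) * (N + 1)) (J N) := by
  refine (Runs.forLoop N (fun _ => p.bound) J hp he h0
    fun k hk s' hf hr hJ => Runs.of_run hl (hstep k hk s' hf hr hJ)).mono ?_ fun _ _ h => h
  simp only [Finset.sum_const, Finset.card_range, smul_eq_mul]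
  ring_nf
  omega

/-! ### Incidences and sources -/

/-- The input and its parameters are in place. -/
structure Ready {n : ℕ} (I : Input n) (s : State) : Prop where
  vertices : s.reg 0 = n
  edges : s.reg 1 = I.edges.length
  input : s.arr 0 = I.cells

theorem Ready.frame {n : ℕ} {I : Input n} {p : Program} {s s' : State} (h : Ready I s)
    (hf : Frame p s s') (h0 : p.keepsReg 0 = true) (h1 : p.keepsReg 1 = true)
    (h2 : p.keepsArr 0 = true) : Ready I s' :=
  ⟨(hf.reg 0 h0).trans h.vertices, (hf.reg 1 h1).trans h.edges, (hf.arr 0 h2).trans h.input⟩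

variable {n : ℕ} {I : Input n} {G : Digraph (Fin n)} {ℓ : Fin n → Finset ℤ}

theorem Ready.tail {s : State} (h : Ready I s) (k : Fin I.edges.length) :
    s.arr 0 (2 + ((k : ℤ) + k)) = ((I.edges.get k).1 : ℕ) := by
  rw [h.input, (I.cells_edge k k.2).1]; rfl

theorem Ready.head {s : State} (h : Ready I s) (k : Fin I.edges.length) :
    s.arr 0 (3 + ((k : ℤ) + k)) = ((I.edges.get k).2 : ℕ) := by
  rw [h.input, (I.cells_edge k k.2).2]; rfl

theorem natCast_val_eq_iff {n : ℕ} (u v : Fin n) : (((u : ℕ) : ℤ) = ((v : ℕ) : ℤ)) ↔ u = v := by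
  rw [Nat.cast_inj, Fin.val_inj]

theorem runs_incidence (hG : IsOrientedCycle G) (hI : I.Represents G ℓ) {s : State}
    (hs : Ready I s) (h1 : s.arr 1 = fun _ => 0) (h2 : s.arr 2 = fun _ => 0) :
    Runs (forLoop (reg 1) incidenceStep) s (50 * (I.edges.length + 1)) fun s' =>
      (∀ w : Fin n, s'.arr 1 w = ∑ k : Fin I.edges.length,
        if (I.edges.get k).1 = w ∨ (I.edges.get k).2 = w then (k : ℤ) else 0) ∧
      ∀ w : Fin n, s'.arr 2 w = 0 ↔ ∀ k, (I.edges.get k).2 ≠ w := by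
  refine (Runs.forLoop_run I.edges.length (fun k s' =>
    (∀ w : Fin n, s'.arr 1 w = ∑ j ∈ Finset.range k, if h : j < I.edges.length then
        (if (I.edges.get ⟨j, h⟩).1 = w ∨ (I.edges.get ⟨j, h⟩).2 = w then (j : ℤ) else 0) else 0) ∧
      ∀ w : Fin n, s'.arr 2 w = 0 ↔ ∀ j : Fin I.edges.length, j < k → (I.edges.get j).2 ≠ w)
    rfl rfl (fun s' hf => ?_) ?_ fun k hk s' hf hr hJ => ?_).mono ?_ fun s' hf hJ => ?_
  · exact (hf.reg 1 rfl).trans hs.edges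
  · simp [h1, h2]
  · have hs' := hs.frame hf rfl rfl rfl
    have ht := hs'.tail ⟨k, hk⟩
    have hh := hs'.head ⟨k, hk⟩
    -- For a loop both additions would hit the same cell and count the index twice.
    have hne : (I.edges.get ⟨k, hk⟩).1 ≠ (I.edges.get ⟨k, hk⟩).2 := fun h => by
      have := (hI.mem_edges _ _).1 (List.get_mem I.edges ⟨k, hk⟩)
      rw [h] at this
      exact hG.loopless _ this
    simp only at ht hh
    constructor
    · intro w
      rw [Finset.sum_range_succ, dif_pos hk, ← hJ.1 w]
      by_cases hu : (I.edges.get ⟨k, hk⟩).1 = w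
      · have hv : (I.edges.get ⟨k, hk⟩).2 ≠ w := fun h => hne (hu.trans h.symm)
        rw [if_pos (.inl hu)]
        rw [hu] at ht
        have hvw := (natCast_val_eq_iff _ _).not.2 hv.symm
        simp [incidenceStep, hr, ht, hh, hvw, -List.get_eq_getElem, Function.update_apply]
      · by_cases hv : (I.edges.get ⟨k, hk⟩).2 = w
        · rw [if_pos (.inr hv)]
          rw [hv] at hh
          have huw := (natCast_val_eq_iff _ _).not.2 (Ne.symm hu)
          simp [incidenceStep, hr, ht, hh, huw, -List.get_eq_getElem]
        · rw [if_neg (by tauto)]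
          have huw := (natCast_val_eq_iff _ _).not.2 (Ne.symm hu)
          have hvw := (natCast_val_eq_iff _ _).not.2 (Ne.symm hv)
          simp [incidenceStep, hr, ht, hh, huw, hvw, -List.get_eq_getElem, Function.update_apply]
    · intro w
      by_cases hv : (I.edges.get ⟨k, hk⟩).2 = w
      · rw [hv] at hh
        have h1 : ¬ ∀ j : Fin I.edges.length, (j : ℕ) < k + 1 → (I.edges.get j).2 ≠ w := fun h =>
          h ⟨k, hk⟩ (Nat.lt_succ_self k) hv
        simpa [incidenceStep, hr, hh, -List.get_eq_getElem] using h1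
      · have hvw := (natCast_val_eq_iff _ _).not.2 (Ne.symm hv)
        have : (∀ j : Fin I.edges.length, (j : ℕ) < k + 1 → (I.edges.get j).2 ≠ w) ↔
            ∀ j : Fin I.edges.length, (j : ℕ) < k → (I.edges.get j).2 ≠ w := by
          refine ⟨fun h j hj => h j (by omega), fun h j hj => ?_⟩
          rcases Nat.lt_succ_iff_lt_or_eq.1 hj with hj | hj
          · exact h j hj
          · have : j = ⟨k, hk⟩ := Fin.ext hj
            rw [this]; exact hv
        rw [this, ← hJ.2 w]
        simp [incidenceStep, hr, ht, hh, hvw, -List.get_eq_getElem, Function.update_apply]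
  · simp [incidenceStep]
  · refine ⟨fun w => ?_, fun w => ?_⟩
    · rw [hJ.1 w, Finset.sum_range]
      exact Finset.sum_congr rfl fun k _ => dif_pos k.2
    · rw [hJ.2 w]
      exact ⟨fun h k => h k k.2, fun h k _ => h k⟩

theorem runs_source {s : State} (hs : Ready I s) (h4 : s.reg 4 = 0)
    (h2 : ∀ w : Fin n, s.arr 2 w = 0 ↔ ∀ k, (I.edges.get k).2 ≠ w) :
    Runs (forLoop (reg 1) sourceStep) s (50 * (I.edges.length + 1)) fun s' =>
      (s'.reg 4 = 0 ∧ ∀ k, ∃ j, (I.edges.get j).2 = (I.edges.get k).1) ∨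
      (s'.reg 4 = 1 ∧ ∃ k : Fin I.edges.length, s'.reg 3 = (k : ℕ) ∧
        ∀ j, (I.edges.get j).2 ≠ (I.edges.get k).1) := by
  refine (Runs.forLoop_run I.edges.length (fun i s' =>
    (s'.reg 4 = 0 ∧ ∀ k : Fin I.edges.length, k < i → ∃ j, (I.edges.get j).2 = (I.edges.get k).1) ∨
      (s'.reg 4 = 1 ∧ ∃ k : Fin I.edges.length, s'.reg 3 = (k : ℕ) ∧
        ∀ j, (I.edges.get j).2 ≠ (I.edges.get k).1))
    rfl rfl (fun s' hf => ?_) ?_ fun k hk s' hf hr hJ => ?_).mono ?_ fun s' hf hJ => ?_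
  · exact (hf.reg 1 rfl).trans hs.edges
  · left; simp [h4]
  · have ht := (hs.frame hf rfl rfl rfl).tail ⟨k, hk⟩
    have h2' : s'.arr 2 = s.arr 2 := hf.arr 2 rfl
    simp only at ht
    by_cases h0 : s.arr 2 ((I.edges.get ⟨k, hk⟩).1 : ℕ) = 0
    · right
      have hb : (eq (cell 2 (tailTerm (reg 2))) (const 0)).Holds s' := by
        simp [hr, ht, h2', h0, -List.get_eq_getElem]
      simp only [sourceStep, run, if_pos hb]
      exact ⟨by simp, ⟨k, hk⟩, by simp [hr], (h2 _).1 h0⟩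
    · have hb : ¬ (eq (cell 2 (tailTerm (reg 2))) (const 0)).Holds s' := by
        simp [hr, ht, h2', h0, -List.get_eq_getElem]
      simp only [sourceStep, run, if_neg hb]
      rcases hJ with ⟨h, hJ⟩ | ⟨h, j, hj, hJ⟩
      · refine .inl ⟨by simpa using h, fun j hj => ?_⟩
        rcases Nat.lt_succ_iff_lt_or_eq.1 hj with hj | hj
        · exact hJ j hj
        · obtain rfl : j = ⟨k, hk⟩ := Fin.ext hj
          by_contra hno
          exact h0 ((h2 _).2 (by simpa using hno))
      · exact .inr ⟨by simpa using h, j, by simpa using hj, hJ⟩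
  · simp [sourceStep]
  · exact hJ.imp_left fun h => ⟨h.1, fun k => h.2 k k.2⟩

theorem runs_prepare (hG : IsOrientedCycle G) (hI : I.Represents G ℓ) :
    Runs prepare (init I.encode) (200 * I.size) fun s' => Ready I s' ∧
      (∀ w : Fin n, s'.arr 1 w = ∑ k : Fin I.edges.length,
        if (I.edges.get k).1 = w ∨ (I.edges.get k).2 = w then (k : ℤ) else 0) ∧
      ((s'.reg 4 = 0 ∧ ∀ k, ∃ j, (I.edges.get j).2 = (I.edges.get k).1) ∨
      (s'.reg 4 = 1 ∧ ∃ k : Fin I.edges.length, s'.reg 3 = (k : ℕ) ∧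
        ∀ j, (I.edges.get j).2 ≠ (I.edges.get k).1)) := by
  have h1 : Runs (assign 0 (cell 0 (const 0)) ;; assign 1 (cell 0 (const 1))) (init I.encode) 6
      fun s' => Ready I s' := by
    refine Runs.of_run rfl ⟨?_, ?_, rfl⟩
    · exact I.cells_zero
    · exact I.cells_one
  refine Runs.le (B := 6 + (50 * (I.edges.length + 1) + 50 * (I.edges.length + 1)))
    (h1.seq fun s₁ hf₁ hs₁ => (runs_incidence hG hI hs₁ ?_ ?_).seq fun s₂ hf₂ h₂ =>
    (runs_source (hs₁.frame hf₂ rfl rfl rfl) ?_ h₂.2).mono le_rfl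
      fun s₃ hf₃ h₃ => ⟨hs₁.frame (hf₂.seq_left.trans hf₃.seq_right) rfl rfl rfl, fun w =>
        (congrFun (hf₃.arr 1 rfl) w).trans (h₂.1 w), h₃⟩) ?_
  · rw [hf₁.arr 1 rfl]; simp [init]
  · rw [hf₁.arr 2 rfl]; simp [init]
  · rw [hf₂.reg 4 rfl, hf₁.reg 4 rfl]; rfl
  · rw [I.size_eq]; omega

/-! ### Offsets and the tour -/

theorem runs_offset {s : State} (hs : Ready I s) (h8 : s.reg 8 = 2 + 2 * I.edges.length) :
    Runs (forLoop (reg 0) offsetStep) s (50 * (n + 1)) fun s' =>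
      ∀ v : Fin n, s'.arr 3 v = I.offset v := by
  refine (Runs.forLoop_run n (fun i s' => s'.reg 8 = I.offset i ∧
      ∀ v : Fin n, (v : ℕ) < i → s'.arr 3 v = I.offset v)
    rfl rfl (fun s' hf => ?_) ?_ fun k hk s' hf hr hJ => ?_).mono ?_ fun s' hf hJ v => ?_
  · exact (hf.reg 0 rfl).trans hs.vertices
  · simp [h8, I.offset_zero]
  · have h0 : s'.arr 0 = I.cells := (hs.frame hf rfl rfl rfl).input
    have hc := I.cells_offset ⟨k, hk⟩
    have hsucc := I.offset_succ ⟨k, hk⟩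
    simp only at hc hsucc
    refine ⟨?_, fun v hv => ?_⟩
    · simp [offsetStep, hr, h0, hJ.1, hc, hsucc]
      ring
    · rcases Nat.lt_succ_iff_lt_or_eq.1 hv with hv | hv
      · have : ((v : ℕ) : ℤ) ≠ k := by exact_mod_cast hv.ne
        simp [offsetStep, hr, this, hJ.2 v hv]
      · simp [offsetStep, hr, hv, hJ.1]
  · simp [offsetStep]
  · exact hJ.2 v v.2

variable {c : ℕ → Fin n} {e : ℕ → Fin I.edges.length}

theorem runs_walk (h : IsRoute I G c e) {s : State} (hs : Ready I s)
    (h1 : ∀ w : Fin n, s.arr 1 w = ∑ k : Fin I.edges.length,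
        if (I.edges.get k).1 = w ∨ (I.edges.get k).2 = w then (k : ℤ) else 0)
    (h5 : s.reg 5 = (c 0 : ℕ)) (h6 : s.reg 6 = (e 0 : ℕ)) (h7 : s.reg 7 = 0) :
    Runs (forLoop (add (reg 0) (add (reg 0) (reg 0))) walkStep) s (500 * (n + 1)) fun s' =>
      (∀ i < 3 * n, s'.arr 4 i = (c i : ℕ)) ∧
      ∀ i < n, s'.arr 5 (rank G c true i) = (e i : ℕ) := by
  refine (Runs.forLoop_run (n + (n + n)) (fun i s' =>
      (s'.reg 5 = (c i : ℕ) ∧ s'.reg 6 = (e i : ℕ) ∧ s'.reg 7 = ups G c i) ∧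
      (∀ j < i, s'.arr 4 j = (c j : ℕ)) ∧
      ∀ j < i, j < n → s'.arr 5 (rank G c true j) = (e j : ℕ))
    rfl rfl (fun s' hf => ?_) ?_ fun k hk s' hf hr hJ => ?_).mono ?_ fun s' hf hJ => ?_
  · simp [hf.reg 0 rfl, hs.vertices]
  · simp [h5, h6, h7, ups]
  · have hs' := hs.frame hf rfl rfl rfl
    have hn := hs'.vertices
    have ht := hs'.tail (e k)
    have hh := hs'.head (e k)
    obtain ⟨⟨g5, g6, g7⟩, g4, gr⟩ := hJ
    have hsum := (h1 (c (k + 1))).trans (h.sum_incident k)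
    rw [← hf.arr 1 rfl] at hsum
    have hu := ups_le (G := G) (c := c) k
    have h4 : ∀ j < k + 1, Function.update (s'.arr 4) (k : ℤ) ((c k : ℕ) : ℤ) j = (c j : ℕ) := by
      intro j hj
      rcases Nat.lt_succ_iff_lt_or_eq.1 hj with hj | rfl
      · rw [Function.update_of_ne (by exact_mod_cast hj.ne), g4 j hj]
      · rw [Function.update_self]
    -- Ranks are injective on the first turn, so a new entry overwrites none of the old ones;
    -- afterwards nothing is written.
    have hR : ∀ j < k + 1, j < n → (if k < n then
        Function.update (s'.arr 5) (rank G c true k : ℤ) ((e k : ℕ) : ℤ) else s'.arr 5)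
          (rank G c true j) = (e j : ℕ) := by
      intro j hj hjn
      rcases Nat.lt_succ_iff_lt_or_eq.1 hj with hj | rfl
      · split_ifs with hkn
        · rw [Function.update_of_ne, gr j hj hjn]
          intro h'
          have := rank_injOn hjn hkn (Nat.cast_injective h')
          omega
        · exact gr j hj hjn
      · rw [if_pos hjn, Function.update_self]
    by_cases ha : G.Adj (c k) (c (k + 1))
    · rw [h.up k ha] at ht hh
      simp only at ht hh
      have hrank : rank G c true k = ups G c k := by simp [rank, ha]
      rw [hrank] at hR
      have hups := ups_succ_of_adj ha
      by_cases hkn : k < n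
      · simp only [if_pos hkn] at hR
        refine ⟨⟨?_, ?_, ?_⟩, ?_, ?_⟩
        · simp [walkStep, hr, g5, g6, g7, ht, hh, hn, hkn]
        · simp [walkStep, hr, g5, g6, g7, ht, hh, hn, hkn, hsum]
        · simp [walkStep, hr, g5, g6, g7, ht, hh, hn, hkn, hups]
        · simpa [walkStep, hr, g5, g6, g7, ht, hh, hn, hkn] using h4
        · simpa [walkStep, hr, g5, g6, g7, ht, hh, hn, hkn] using hR
      · simp only [if_neg hkn] at hR
        refine ⟨⟨?_, ?_, ?_⟩, ?_, ?_⟩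
        · simp [walkStep, hr, g5, g6, g7, ht, hh, hn, hkn]
        · simp [walkStep, hr, g5, g6, g7, ht, hh, hn, hkn, hsum]
        · simp [walkStep, hr, g5, g6, g7, ht, hh, hn, hkn, hups]
        · simpa [walkStep, hr, g5, g6, g7, ht, hh, hn, hkn] using h4
        · simpa [walkStep, hr, g5, g6, g7, ht, hh, hn, hkn] using hR
    · rw [h.down k ha] at ht hh
      simp only at ht hh
      -- The tail of a downward edge differs from the current vertex, so the test selects the second
      -- branch.
      have hne : ((c (k + 1) : ℕ) : ℤ) ≠ (c k : ℕ) := fun h' => by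
        have h3 := h.tour.three_le
        have := h.tour.inj ((natCast_val_eq_iff _ _).1 h').symm (by omega) (by omega)
        omega
      have hups := ups_succ_of_not_adj ha
      by_cases hkn : k < n
      · simp only [if_pos hkn] at hR
        have hrank : (rank G c true k : ℤ) = (n : ℤ) - 1 - (k - ups G c k) := by
          simp only [rank, ha, if_false, cond_true]; omega
        rw [hrank] at hR
        refine ⟨⟨?_, ?_, ?_⟩, ?_, ?_⟩
        · simp [walkStep, hr, g5, g6, g7, ht, hn, hkn, hne]
        · simp [walkStep, hr, g5, g6, g7, ht, hn, hkn, hne, hsum]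
        · simp [walkStep, hr, g5, g6, g7, ht, hn, hkn, hne, hups]
        · simpa [walkStep, hr, g5, g6, g7, ht, hh, hn, hkn, hne] using h4
        · simpa [walkStep, hr, g5, g6, g7, ht, hh, hn, hkn, hne] using hR
      · simp only [if_neg hkn] at hR
        refine ⟨⟨?_, ?_, ?_⟩, ?_, ?_⟩
        · simp [walkStep, hr, g5, g6, ht, hn, hkn, hne]
        · simp [walkStep, hr, g5, g6, ht, hn, hkn, hne, hsum]
        · simp [walkStep, hr, g5, g6, g7, ht, hn, hkn, hne, hups]
        · simpa [walkStep, hr, g5, g6, g7, ht, hh, hn, hkn, hne] using h4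
        · simpa [walkStep, hr, g5, g6, g7, ht, hh, hn, hkn, hne] using hR
  · simp [walkStep, Test.lt]
    omega
  · exact ⟨fun i hi => hJ.2.1 i (by omega), fun i hi => hJ.2.2 i (by omega) hi⟩

end RAM
namespace RAM

open Program Term Test

attribute [local simp] Program.run Term.eval Test.Holds Term.cost Test.cost Program.bound
  tailTerm headTerm incr

variable {n : ℕ} {I : Input n} {G : Digraph (Fin n)} {c : ℕ → Fin n} {e : ℕ → Fin I.edges.length}

/-- The input, the positions of the intervals, the tour, and the order of the edges are in
place. -/
structure Prepared (I : Input n) (G : Digraph (Fin n)) (c : ℕ → Fin n)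
    (e : ℕ → Fin I.edges.length) (s : State) : Prop extends Ready I s where
  offset : ∀ v : Fin n, s.arr 3 v = I.offset v
  tour : ∀ i < 3 * n, s.arr 4 i = (c i : ℕ)
  order : ∀ i < n, s.arr 5 (rank G c true i) = (e i : ℕ)

theorem Prepared.frame {p : Program} {s s' : State} (h : Prepared I G c e s)
    (hf : Frame p s s') (h0 : p.keepsReg 0 = true) (h1 : p.keepsReg 1 = true)
    (h2 : p.keepsArr 0 = true) (h3 : p.keepsArr 3 = true) (h4 : p.keepsArr 4 = true)
    (h5 : p.keepsArr 5 = true) : Prepared I G c e s' :=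
  ⟨h.toReady.frame hf h0 h1 h2, by rw [hf.arr 3 h3]; exact h.offset,
    by rw [hf.arr 4 h4]; exact h.tour, by rw [hf.arr 5 h5]; exact h.order⟩

/-! ### The least level above a bound -/

/-- The set `S` is empty if the flag `f` is zero, and it has the least element `b` if the flag is
one. -/
def IsMinFlag (S : Set ℤ) (f b : ℤ) : Prop := (f = 1 ∧ IsLeast S b) ∨ (f = 0 ∧ S = ∅)

/-- The lower end `a` becomes the minimum exactly if the interval is not empty and no previous
minimum is at most `a`. -/
theorem IsMinFlag.union {S : Set ℤ} {f b a h : ℤ} (hS : IsMinFlag S f b) :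
    IsMinFlag (S ∪ Set.Icc a h) (if a ≤ h ∧ ¬ (f = 1 ∧ b ≤ a) then 1 else f)
      (if a ≤ h ∧ ¬ (f = 1 ∧ b ≤ a) then a else b) := by
  split_ifs with hc
  · refine .inl ⟨rfl, .inr ⟨le_rfl, hc.1⟩, ?_⟩
    rintro x (hx | hx)
    · rcases hS with ⟨hf, hS⟩ | ⟨hf, rfl⟩
      · have := hS.2 hx
        have : ¬ b ≤ a := fun h => hc.2 ⟨hf, h⟩
        omega
      · exact absurd hx (Set.notMem_empty x)
    · exact hx.1
  · rcases hS with ⟨hf, hS⟩ | ⟨hf, rfl⟩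
    · refine .inl ⟨hf, .inl hS.1, ?_⟩
      rintro x (hx | hx)
      · exact hS.2 hx
      · have h1 := hx.1
        have h2 := hx.2
        by_contra hlt
        exact hc ⟨h1.trans h2, fun h => hlt (h.2.trans h1)⟩
    · refine .inr ⟨hf, ?_⟩
      rw [Set.empty_union, Set.Icc_eq_empty]
      intro h
      exact hc ⟨h, fun h' => by omega⟩

theorem intervalStep_run (σ : Bool) (s : State) :
    ∀ a, a = (if s.reg 12 = 0 ∧ (lo σ (reg 13)).eval s ≤ s.reg 11 then s.reg 11 + 1
        else (lo σ (reg 13)).eval s) →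
    ((intervalStep σ).run s).reg 13 = s.reg 13 + 2 ∧
    ((intervalStep σ).run s).reg 15 = (if a ≤ (hi σ (reg 13)).eval s ∧
      ¬ (s.reg 16 = 1 ∧ s.reg 15 ≤ a) then a else s.reg 15) ∧
    ((intervalStep σ).run s).reg 16 = (if a ≤ (hi σ (reg 13)).eval s ∧
      ¬ (s.reg 16 = 1 ∧ s.reg 15 ≤ a) then 1 else s.reg 16) := by
  intro a ha
  have h17 : (ite (and (eq (reg 12) (const 0)) (le (reg 17) (reg 11)))
      (assign 17 (add (reg 11) (const 1))) skip).run ((assign 17 (lo σ (reg 13))).run s) =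
      { s with reg := Function.update s.reg 17 a } := by
    subst ha
    simp only [run, Test.Holds, Term.eval, ne_eq, Nat.reduceEqDiff,
      not_false_eq_true, Function.update_of_ne, Function.update_self]
    split_ifs <;> simp
  have hhi : (hi σ (reg 13)).eval { s with reg := Function.update s.reg 17 a } =
      (hi σ (reg 13)).eval s := by
    cases σ <;> simp [hi]
  have hb : Test.Holds { s with reg := Function.update s.reg 17 a }
      (and (le (reg 17) (hi σ (reg 13))) (not (and (eq (reg 16) (const 1)) (le (reg 15) (reg 17))))) ↔
      a ≤ (hi σ (reg 13)).eval s ∧ ¬ (s.reg 16 = 1 ∧ s.reg 15 ≤ a) := by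
    simp only [Test.Holds, hhi]
    simp
  have h := congrArg (Program.run
    (ite (and (le (reg 17) (hi σ (reg 13)))
        (not (and (eq (reg 16) (const 1)) (le (reg 15) (reg 17)))))
      (assign 15 (reg 17) ;; assign 16 (const 1)) skip ;;
    assign 13 (add (reg 13) (const 2)))) h17
  rw [show (intervalStep σ).run s = _ from h]
  simp only [run, Term.eval, hb]
  split_ifs <;> simp

/-- The levels of `v` that are admissible for the given content of the registers. -/
def admissible (I : Input n) (σ : Bool) (v : Fin n) (s : State) : Set ℤ :=
  {x ∈ I.levels σ v | s.reg 12 = 0 → s.reg 11 < x}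

/-- Over the integers a strict lower bound amounts to raising the lower end of each interval to the
next integer. The admissible levels thus remain a union of intervals, and one unsorted pass finds
the minimum. -/
theorem runs_nextLevel (σ : Bool) (v : Fin n) {s : State} (hs : Prepared I G c e s)
    (h10 : s.reg 10 = (v : ℕ)) :
    Runs (nextLevel σ) s (100 * ((I.intervals v).length + 1)) fun s' =>
      (IsLeast (admissible I σ v s) (s'.reg 15) ∧ s'.reg 9 = s.reg 9) ∨
      (admissible I σ v s = ∅ ∧ s'.reg 9 = 1) := by
  set m := (I.intervals v).length with hm
  have h1 : Runs nextInit s nextInit.bound fun s' => s'.reg 13 = I.offset v + 1 ∧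
      s'.reg 14 = I.offset v + 1 + (m + m) ∧ s'.reg 16 = 0 := by
    refine Runs.of_run rfl ?_
    have := hs.offset v
    have := I.cells_offset v
    simp [nextInit, h10, hs.offset v, hs.input, I.cells_offset v, hm]
  let S : ℕ → Set ℤ := fun k => {x | ∃ j : Fin m, (j : ℕ) < k ∧
    (bif σ then ((I.intervals v).get j).1 else -((I.intervals v).get j).2) ≤ x ∧
    (x ≤ bif σ then ((I.intervals v).get j).2 else -((I.intervals v).get j).1) ∧
    (s.reg 12 = 0 → s.reg 11 < x)}
  have hSm : S m = admissible I σ v s := by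
    ext x
    constructor
    · rintro ⟨j, -, h1, h2, h3⟩
      exact ⟨⟨_, List.get_mem _ j, h1, h2⟩, h3⟩
    · rintro ⟨⟨J, hJ, h1, h2⟩, h3⟩
      obtain ⟨j, rfl⟩ := List.mem_iff_get.1 hJ
      exact ⟨j, j.2, h1, h2, h3⟩
  refine Runs.le (B := nextInit.bound + (_ + nextEnd.bound))
    (h1.seq fun s₁ hf₁ ⟨g13, g14, g16⟩ => (Runs.loop_run (p := intervalStep σ) (by cases σ <;> rfl) m
      (fun k s' => s'.reg 13 = I.offset v + 1 + (k + k) ∧ IsMinFlag (S k) (s'.reg 16) (s'.reg 15))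
      ⟨by simpa using g13, .inr ⟨g16, by simp [S]⟩⟩
      (fun k hk s' hf ⟨r13, hS⟩ => ⟨?_, ?_⟩) fun s' hf ⟨r13, hS⟩ => ?_).seq
        fun s₂ hf₂ ⟨_, hS⟩ => Runs.of_run rfl ?_) ?_
  · have : s'.reg 14 = s₁.reg 14 := hf.reg 14 (by cases σ <;> rfl)
    simp [this, g14, r13]
    omega
  · have hI0 : s'.arr 0 = I.cells := by
      rw [hf.arr 0 (by cases σ <;> rfl), hf₁.arr 0 rfl]; exact hs.input
    have e12 : s'.reg 12 = s.reg 12 := by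
      rw [hf.reg 12 (by cases σ <;> rfl), hf₁.reg 12 rfl]
    have e11 : s'.reg 11 = s.reg 11 := by
      rw [hf.reg 11 (by cases σ <;> rfl), hf₁.reg 11 rfl]
    obtain ⟨c1, c2⟩ := I.cells_interval v k hk
    have hlo : (lo σ (reg 13)).eval s' = bif σ then ((I.intervals v).get ⟨k, hk⟩).1
        else -((I.intervals v).get ⟨k, hk⟩).2 := by
      cases σ <;> simp [lo, hI0, r13, c1, c2]
    have hhi : (hi σ (reg 13)).eval s' = bif σ then ((I.intervals v).get ⟨k, hk⟩).2
        else -((I.intervals v).get ⟨k, hk⟩).1 := by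
      cases σ <;> simp [hi, hI0, r13, c1, c2]
    obtain ⟨w1, w2, w3⟩ := intervalStep_run σ s' _ rfl
    refine ⟨by rw [w1, r13]; push_cast; ring, ?_⟩
    rw [w2, w3]
    convert hS.union using 1
    ext x
    rw [e11, e12, hlo, hhi]
    simp only [S, Set.mem_union, Set.mem_ofPred_eq, Set.mem_Icc]
    constructor
    · rintro ⟨j, hj, h1, h2, h3⟩
      rcases Nat.lt_succ_iff_lt_or_eq.1 hj with hj | hj
      · exact .inl ⟨j, hj, h1, h2, h3⟩
      · obtain rfl : j = ⟨k, hk⟩ := Fin.ext hj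
        right
        refine ⟨?_, h2⟩
        split_ifs with hc
        · exact h3 hc.1
        · exact h1
    · rintro (⟨j, hj, h⟩ | ⟨h1, h2⟩)
      · exact ⟨j, by omega, h⟩
      · refine ⟨⟨k, hk⟩, Nat.lt_succ_self k, ?_⟩
        split_ifs at h1 with hc
        · exact ⟨by omega, h2, fun _ => h1⟩
        · refine ⟨h1, h2, fun h0 => ?_⟩
          by_contra hlt
          exact hc ⟨h0, by omega⟩
  · have : s'.reg 14 = s₁.reg 14 := hf.reg 14 (by cases σ <;> rfl)
    simp [this, g14, r13]
  · have e9 : s₂.reg 9 = s.reg 9 := by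
      rw [hf₂.reg 9 (by cases σ <;> rfl), hf₁.reg 9 rfl]
    rw [hSm] at hS
    rcases hS with ⟨h, hS⟩ | ⟨h, hS⟩
    · left; simp [nextEnd, h, e9, hS]
    · right; simp [nextEnd, h, hS]
  · have : (intervalStep σ).bound ≤ 60 := by
      cases σ <;> decide
    simp only [Test.lt, Test.cost, Term.cost, nextInit, nextEnd, Program.bound]
    nlinarith

/-! ### Lowest levels -/

theorem edgeTerm_eval {σ : Bool} {s : State} (hs : Prepared I G c e s)
    {i : ℕ} (hi : i < n) (h2 : s.reg 2 = rank G c σ i) : (edgeTerm σ).eval s = (e i : ℕ) := by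
  cases σ with
  | true => simp [edgeTerm, h2, hs.order i hi]
  | false =>
    have := rank_lt (G := G) (c := c) (σ := true) hi
    have h' : (n : ℤ) - 1 - s.reg 2 = rank G c true i := by
      rw [h2]
      simp only [rank, cond_true, cond_false] at this ⊢
      omega
    simp [edgeTerm, hs.vertices, h', hs.order i hi]

theorem tl_eval {σ : Bool} {s : State} (hs : Ready I s) {t : Term}
    {k : Fin I.edges.length} (ht : t.eval s = (k : ℕ)) : (tl σ t).eval s = (I.tail σ k : ℕ) := by
  cases σ <;> simp [tl, ht, hs.tail, hs.head, Input.tail]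

theorem hd_eval {σ : Bool} {s : State} (hs : Ready I s) {t : Term}
    {k : Fin I.edges.length} (ht : t.eval s = (k : ℕ)) : (hd σ t).eval s = (I.head σ k : ℕ) := by
  cases σ <;> simp [hd, ht, hs.tail, hs.head, Input.head]

theorem runs_start {σ : Bool} {s : State} (hs : Prepared I G c e s) (h9 : s.reg 9 = 0) :
    Runs (forLoop (reg 0) (startStep σ)) s (500 * I.size) fun s' =>
      (s'.reg 9 = 0 ∧ Relaxed I G c e σ 0 fun v => s'.arr (lev σ) v) ∨
      (s'.reg 9 = 1 ∧ ∀ y, ¬ I.IsLeveling σ y) := by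
  -- Round `k` is charged to the intervals of vertex `k`; the default `0` beyond `n` never
  -- contributes.
  refine ((Runs.forLoop (e := reg 0) n (fun k => 20 + 100 * ((if h : k < n then (I.intervals ⟨k, h⟩).length
      else 0) + 1))
    (fun k s' => (s'.reg 9 = 0 ∧ ∀ v : Fin n, (v : ℕ) < k → IsLeast (I.levels σ v)
      (s'.arr (lev σ) v)) ∨ (s'.reg 9 = 1 ∧ ∀ y, ¬ I.IsLeveling σ y))
    (by cases σ <;> rfl) (fun s' hf => (hf.reg 0 (by cases σ <;> rfl)).trans hs.vertices) ?_
    fun k hk s' hf hr hJ => ?_).mono ?_ fun s' hf hJ => ?_)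
  · left; simp [h9]
  · have hs' := hs.frame hf (by cases σ <;> rfl) (by cases σ <;> rfl) (by cases σ <;> rfl)
      (by cases σ <;> rfl) (by cases σ <;> rfl) (by cases σ <;> rfl)
    rw [dif_pos hk]
    refine Runs.le (B := (eq (reg 9) (const 0)).cost + 1 +
      (4 + (100 * ((I.intervals ⟨k, hk⟩).length + 1) + 3))) (Runs.ite (fun hb => ?_) fun hb => ?_) ?_
    · have h9' : s'.reg 9 = 0 := by simpa using hb
      have hJ' := (hJ.resolve_right fun h => by omega).2
      have h1 : Runs (assign 10 (reg 2) ;; assign 12 (const 1)) s' 4 fun s'' =>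
          s''.reg 10 = k ∧ s''.reg 12 = 1 := Runs.of_run rfl (by simp [hr])
      refine h1.seq fun s₁ hf₁ ⟨g10, g12⟩ => (runs_nextLevel σ ⟨k, hk⟩
        (hs'.frame hf₁ rfl rfl rfl rfl rfl rfl) g10).seq fun s₂ hf₂ hJ₂ =>
        (Runs.of_run rfl ?_).le le_rfl
      have hadm : admissible I σ ⟨k, hk⟩ s₁ = I.levels σ ⟨k, hk⟩ := by
        simp [admissible, g12]
      rw [hadm, hf₁.reg 9 rfl] at hJ₂
      have g10' : s₂.reg 10 = k := (hf₂.reg 10 (by cases σ <;> rfl)).trans g10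
      have ga : s₂.arr (lev σ) = s'.arr (lev σ) :=
        (hf₂.arr _ (by cases σ <;> rfl)).trans (hf₁.arr _ (by cases σ <;> rfl))
      rcases hJ₂ with ⟨hl, h9₂⟩ | ⟨he, h9₂⟩
      · left
        refine ⟨by simp [h9₂, h9'], fun v hv => ?_⟩
        rcases Nat.lt_succ_iff_lt_or_eq.1 hv with hv | hv
        · have hne : ((v : ℕ) : ℤ) ≠ k := by exact_mod_cast hv.ne
          simpa [g10', hne, ga] using hJ' v hv
        · obtain rfl : v = ⟨k, hk⟩ := Fin.ext hv
          simpa [g10'] using hl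
      · right
        refine ⟨by simp [h9₂], fun y hy => ?_⟩
        have := hy.mem ⟨k, hk⟩
        rw [he] at this
        exact this
    · have h9' : s'.reg 9 ≠ 0 := by simpa using hb
      refine (Runs.of_run rfl ?_).le (by simp only [Program.bound]; omega)
      have hJ' := hJ.resolve_left fun h => h9' h.1
      exact .inr ⟨by simpa using hJ'.1, hJ'.2⟩
    · simp only [Test.cost, Term.cost]; omega
  · rw [Finset.sum_add_distrib, ← Finset.mul_sum, Finset.sum_add_distrib, Finset.sum_range,
      Finset.sum_range, Finset.sum_range]
    simp only [Fin.is_lt, dite_true, Fin.eta, Finset.sum_const, Finset.card_univ, Fintype.card_fin,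
      smul_eq_mul, Term.cost]
    rw [I.size_eq]
    omega
  · exact hJ.imp_left fun h => ⟨h.1, fun v => (h.2 v v.2).1, fun y hy v => (h.2 v v.2).2 (hy.mem v),
      fun i _ h => absurd h (Nat.not_lt_zero _)⟩

theorem sum_tour (h : IsTour G c) (f : Fin n → ℕ) : ∑ i ∈ Finset.range n, f (c i) = ∑ v, f v := by
  rw [Finset.sum_range]
  refine Function.Bijective.sum_comp (e := fun i : Fin n => c i)
    ((Finite.injective_iff_bijective).1 fun i j hij => ?_) f
  have hij' : c i = c j := hij
  rcases le_total (i : ℕ) j with hle | hle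
  · exact Fin.ext (h.inj hij' hle (by omega))
  · exact Fin.ext (h.inj hij'.symm hle (by omega)).symm

/-- The head of the `i`-th edge is `c i` or `c (i + 1)`. Charging both charges every vertex twice in
a turn. -/
theorem sum_heads_le (h : IsRoute I G c e) (σ : Bool) (f : Fin n → ℕ) :
    ∑ i ∈ Finset.range n, f (I.head σ (e i)) ≤ 2 * ∑ v, f v := by
  have h1 := sum_tour h.tour f
  have h2 := sum_tour (h.tour.shift 1) f
  calc ∑ i ∈ Finset.range n, f (I.head σ (e i))
      ≤ ∑ i ∈ Finset.range n, (f (c i) + f (c (1 + i))) := by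
        refine Finset.sum_le_sum fun i _ => ?_
        rw [add_comm 1 i]
        rcases h.ends i with h' | h' <;> cases σ <;>
          simp only [Input.head, cond_true, cond_false, h'] <;> omega
    _ = 2 * ∑ v, f v := by rw [Finset.sum_add_distrib, h1, h2]; ring

theorem runs_relax (h : IsRoute I G c e) {σ : Bool} {s : State} (hs : Prepared I G c e s)
    (hJ : (s.reg 9 = 0 ∧ Relaxed I G c e σ 0 fun v => s.arr (lev σ) v) ∨
      (s.reg 9 = 1 ∧ ∀ y, ¬ I.IsLeveling σ y)) :
    Runs (forLoop (reg 0) (relaxStep σ)) s (500 * I.size) fun s' =>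
      (s'.reg 9 = 0 ∧ I.IsLowest σ fun v => s'.arr (lev σ) v) ∨
      (s'.reg 9 = 1 ∧ ∀ y, ¬ I.IsLeveling σ y) := by
  -- The edges are relaxed by rank; `inv` gives the position in the tour of the edge with a given
  -- rank.
  choose! inv hinv hinv' using fun j => rank_surjOn (G := G) (c := c) (σ := σ) (j := j)
  refine ((Runs.forLoop (e := reg 0) n (fun k => 60 + 100 * ((I.intervals (I.head σ (e (inv k)))).length + 1))
    (fun k s' => (s'.reg 9 = 0 ∧ Relaxed I G c e σ k fun v => s'.arr (lev σ) v) ∨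
      (s'.reg 9 = 1 ∧ ∀ y, ¬ I.IsLeveling σ y))
    (by cases σ <;> rfl) (fun s' hf => (hf.reg 0 (by cases σ <;> rfl)).trans hs.vertices) ?_
    fun k hk s' hf hr hJ => ?_).mono ?_ fun s' hf hJ => ?_)
  · simpa using hJ
  · have hs' := hs.frame hf (by cases σ <;> rfl) (by cases σ <;> rfl) (by cases σ <;> rfl)
      (by cases σ <;> rfl) (by cases σ <;> rfl) (by cases σ <;> rfl)
    have hi := hinv k hk
    have hik := hinv' k hk
    generalize inv k = i at *
    subst hik
    set t := I.tail σ (e i)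
    set v := I.head σ (e i)
    refine Runs.le (B := (eq (reg 9) (const 0)).cost + 1 + (40 +
      ((le (cell (lev σ) (reg 10)) (reg 11)).cost + 1 +
        (100 * ((I.intervals v).length + 1) + 3)))) (Runs.ite (fun hb => ?_) fun hb => ?_) ?_
    · have h9' : s'.reg 9 = 0 := by simpa using hb
      have hJ' := (hJ.resolve_right fun h => by omega).2
      have h1 : Runs (assign 19 (tl σ (edgeTerm σ)) ;; assign 10 (hd σ (edgeTerm σ)) ;;
          assign 11 (cell (lev σ) (reg 19)) ;; assign 12 (const 0)) s' 40 fun s'' =>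
          s''.reg 10 = (v : ℕ) ∧ s''.reg 11 = s'.arr (lev σ) t ∧ s''.reg 12 = 0 := by
        refine (Runs.of_run rfl ?_).le (by cases σ <;> decide)
        have ht := tl_eval (σ := σ) hs'.toReady (edgeTerm_eval hs' hi hr)
        -- The head is read after register `19` has been assigned, so the evaluation is repeated in
        -- the changed state.
        have hv : (hd σ (edgeTerm σ)).eval { s' with reg := Function.update s'.reg 19 t } =
            (v : ℕ) := by
          refine hd_eval (σ := σ) (I := I) ⟨?_, ?_, ?_⟩ 
            (edgeTerm_eval (G := G) (c := c) ⟨⟨?_, ?_, ?_⟩, ?_, ?_, ?_⟩ hi ?_)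
          · simpa using hs'.vertices
          · simpa using hs'.edges
          · exact hs'.input
          · simpa using hs'.vertices
          · simpa using hs'.edges
          · exact hs'.input
          · exact hs'.offset
          · exact hs'.tour
          · exact hs'.order
          · simpa using hr
        have hv' : (hd σ (edgeTerm σ)).eval
            { s' with reg := Function.update s'.reg 19 (I.tail σ (e i) : ℕ) } =
              (I.head σ (e i) : ℕ) := hv
        simp only [Program.run, ht, hv', Term.eval]
        simp [t, v]
      refine h1.seq fun s₁ hf₁ ⟨g10, g11, g12⟩ => Runs.ite (fun hb => ?_) fun hb => ?_
      · have ga₁ : s₁.arr (lev σ) = s'.arr (lev σ) := hf₁.arr _ (by cases σ <;> rfl)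
        have hle : s'.arr (lev σ) v ≤ s'.arr (lev σ) t := by
          simpa [g10, g11, ga₁] using hb
        refine (runs_nextLevel σ v (hs'.frame hf₁ (by cases σ <;> rfl) (by cases σ <;> rfl)
          (by cases σ <;> rfl) (by cases σ <;> rfl) (by cases σ <;> rfl) (by cases σ <;> rfl))
          g10).seq fun s₂ hf₂ hJ₂ => (Runs.of_run rfl ?_).le le_rfl
        have hadm : admissible I σ v s₁ = {x ∈ I.levels σ v | s'.arr (lev σ) t < x} := by
          simp [admissible, g12, g11]
        rw [hadm, hf₁.reg 9 (by cases σ <;> rfl)] at hJ₂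
        have g10' : s₂.reg 10 = (v : ℕ) := (hf₂.reg 10 (by cases σ <;> rfl)).trans g10
        have ga : s₂.arr (lev σ) = s'.arr (lev σ) := (hf₂.arr _ (by cases σ <;> rfl)).trans ga₁
        rcases hJ₂ with ⟨hl, h9₂⟩ | ⟨he, h9₂⟩
        · left
          refine ⟨by simp [h9₂, h9'], ?_⟩
          convert hJ'.update h hi hle hl using 1
          funext w
          by_cases hw : w = v
          · subst hw; simp [g10', v]
          · have hw' := (natCast_val_eq_iff _ _).not.2 hw
            simp [g10', hw', hw, ga, v] at hw ⊢
        · right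
          exact ⟨by simp [h9₂], hJ'.no_leveling he⟩
      · have ga₁ : s₁.arr (lev σ) = s'.arr (lev σ) := hf₁.arr _ (by cases σ <;> rfl)
        have hlt : s'.arr (lev σ) t < s'.arr (lev σ) v := by
          simpa [g10, g11, ga₁] using hb
        refine (Runs.of_run rfl ?_).le (by simp only [Program.bound]; omega)
        left
        refine ⟨?_, ?_⟩
        · simpa [h9'] using hf₁.reg 9 (by cases σ <;> rfl)
        · simpa [ga₁] using hJ'.skip hi hlt
    · have h9' : s'.reg 9 ≠ 0 := by simpa using hb
      refine (Runs.of_run rfl ?_).le (by simp only [Program.bound]; omega)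
      have hJ' := hJ.resolve_left fun h => h9' h.1
      exact .inr ⟨by simpa using hJ'.1, hJ'.2⟩
    · simp only [Test.cost, Term.cost]; omega
  -- Ranks permute the positions, so the cost can be summed in the order of the tour.
  · have hsum : ∑ k ∈ Finset.range n, (I.intervals (I.head σ (e (inv k)))).length =
        ∑ i ∈ Finset.range n, (I.intervals (I.head σ (e i))).length := by
      symm
      refine Finset.sum_nbij (rank G c σ) (fun i hi => ?_) (fun i hi j hj hij => ?_) (fun j hj => ?_)
        fun i hi => ?_
      · simpa using rank_lt (by simpa using hi)
      · exact rank_injOn (by simpa using hi) (by simpa using hj) hij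
      · obtain ⟨i, hi, hij⟩ := rank_surjOn (G := G) (c := c) (σ := σ) (j := j) (by simpa using hj)
        exact ⟨i, by simpa using hi, hij⟩
      · have hi' : i < n := by simpa using hi
        have hlt := rank_lt (G := G) (c := c) (σ := σ) hi'
        rw [rank_injOn (hinv _ hlt) hi' (hinv' _ hlt)]
    have hle := sum_heads_le h σ fun v => (I.intervals v).length
    rw [Finset.sum_add_distrib, ← Finset.mul_sum, Finset.sum_add_distrib, hsum]
    simp only [Finset.sum_const, Finset.card_range, smul_eq_mul, Term.cost]
    rw [I.size_eq]
    omega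
  · exact hJ.imp_left fun h' => ⟨h'.1, h'.2.isLowest h⟩

theorem runs_solve (h : IsRoute I G c e) {σ : Bool} {s : State} (hs : Prepared I G c e s)
    (h9 : s.reg 9 = 0) :
    Runs (solve σ) s (1000 * I.size) fun s' =>
      (s'.reg 9 = 0 ∧ I.IsLowest σ fun v => s'.arr (lev σ) v) ∨
      (s'.reg 9 = 1 ∧ ∀ y, ¬ I.IsLeveling σ y) := by
  refine Runs.le (B := 500 * I.size + 500 * I.size) ((runs_start hs h9).seq fun s₁ hf₁ h₁ =>
    runs_relax h (hs.frame hf₁ ?_ ?_ ?_ ?_ ?_ ?_) h₁) (by omega) <;> cases σ <;> rfl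

end RAM
namespace RAM

open Program Term Test

attribute [local simp] Program.run Term.eval Test.Holds Term.cost Test.cost Program.bound
  tailTerm headTerm incr

variable {n : ℕ} {I : Input n} {G : Digraph (Fin n)} {c : ℕ → Fin n} {e : ℕ → Fin I.edges.length}

/-! ### Lowest vertices -/

/-- The levels of all vertices are in place. -/
structure Leveled (I : Input n) (G : Digraph (Fin n)) (c : ℕ → Fin n)
    (e : ℕ → Fin I.edges.length) (L : Bool → Fin n → ℤ) (s : State) : Prop
    extends Prepared I G c e s where
  level : ∀ σ (v : Fin n), s.arr (lev σ) v = L σ v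

theorem Leveled.frame {L : Bool → Fin n → ℤ} {p : Program} {s s' : State}
    (h : Leveled I G c e L s) (hf : Frame p s s') (h0 : p.keepsReg 0 = true)
    (h1 : p.keepsReg 1 = true) (ha : ∀ a ∈ [0, 3, 4, 5, 6, 7], p.keepsArr a = true) :
    Leveled I G c e L s' := by
  refine ⟨h.toPrepared.frame hf h0 h1 (ha _ ?_) (ha _ ?_) (ha _ ?_) (ha _ ?_), fun σ v => ?_⟩
  · simp
  · simp
  · simp
  · simp
  · rw [hf.arr _ (ha _ (by cases σ <;> simp [lev]))]; exact h.level σ v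

/-- The vertex `v` is at most as low as `w`; vertices with the same lowest level are compared
by their highest levels. -/
def LexLe (L : Bool → Fin n → ℤ) (σ : Bool) (v w : Fin n) : Prop :=
  L σ v < L σ w ∨ L σ v = L σ w ∧ L (!σ) w ≤ L (!σ) v

theorem runs_argmin (h : IsTour G c) {L : Bool → Fin n → ℤ} (σ : Bool) {s : State}
    (hs : Leveled I G c e L s) :
    Runs (argmin σ) s (300 * I.size) fun s' =>
      ∃ i : ℕ, i < n ∧ s'.reg (base σ) = i ∧ ∀ v, LexLe L σ (c i) v := by
  classical
  have hn := h.three_le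
  have h1 : Runs (assign (base σ) (const 0)) s 2 fun s' => s'.reg (base σ) = 0 :=
    Runs.of_run rfl (by simp)
  refine Runs.le (B := 2 + _) (h1.seq fun s₁ hf₁ hb => (Runs.forLoop_run (e := reg 0) n (fun k s' =>
    ∃ i : ℕ, i < n ∧ s'.reg (base σ) = i ∧ ∀ j < k, LexLe L σ (c i) (c j))
    (by cases σ <;> rfl) (by cases σ <;> rfl) (fun s' hf => ?_) ⟨0, by omega, ?_, by simp⟩
    fun k hk s' hf hr hJ => ?_).mono le_rfl fun s' hf hJ => ?_) ?_
  · rw [Term.eval, hf.reg 0 (by cases σ <;> rfl), hf₁.reg 0 (by cases σ <;> rfl)]; exact hs.vertices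
  · cases σ <;> simpa [base] using hb
  · have hs' : Leveled I G c e L s' :=
      (hs.frame hf₁ (by cases σ <;> rfl) (by cases σ <;> rfl) (by cases σ <;> decide)).frame hf
        (by cases σ <;> rfl) (by cases σ <;> rfl) (by cases σ <;> decide)
    obtain ⟨i, hi, hri, hJ⟩ := hJ
    have h4k := hs'.tour k (by omega)
    have h4i := hs'.tour i (by omega)
    have hrun : ((argminStep σ).run s').reg (base σ) =
        if LexLe L σ (c i) (c k) then (i : ℤ) else k := by
      have l1 := fun v => hs'.level true v
      have l2 := fun v => hs'.level false v
      simp only [lev] at l1 l2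
      cases σ <;> simp only [base] at hri h4i <;> unfold LexLe <;> split_ifs with hc <;>
        simp [argminStep, base, lev, hr, hri, h4k, h4i, l1, l2] <;> split_ifs <;>
        simp [hri] <;> simp at hc <;> omega
    have hb2 : ∀ z, Function.update ((argminStep σ).run s').reg 2 z (base σ) =
        ((argminStep σ).run s').reg (base σ) := fun z =>
      Function.update_of_ne (by cases σ <;> decide) _ _
    by_cases hc : LexLe L σ (c i) (c k)
    · rw [if_pos hc] at hrun
      refine ⟨i, hi, (hb2 _).trans hrun, fun j hj => ?_⟩
      rcases Nat.lt_succ_iff_lt_or_eq.1 hj with hj | rfl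
      · exact hJ j hj
      · exact hc
    · rw [if_neg hc] at hrun
      refine ⟨k, hk, (hb2 _).trans hrun, fun j hj => ?_⟩
      rcases Nat.lt_succ_iff_lt_or_eq.1 hj with hj | rfl
      -- The new candidate beats the old one, which was at least as good as all earlier ones:
      -- transitivity of the lexicographic order.
      · have := hJ j hj
        unfold LexLe at *
        omega
      · exact .inr ⟨rfl, le_rfl⟩
  · obtain ⟨i, hi, hri, hJ⟩ := hJ
    refine ⟨i, hi, hri, fun v => ?_⟩
    obtain ⟨j, -, hj, rfl⟩ := h.surj v 0
    exact hJ j (by omega)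
  · have hb : (argminStep σ).bound ≤ 60 := by cases σ <;> decide
    have := Nat.mul_le_mul_right (n + 1) (show (reg 0).cost + 8 + (argminStep σ).bound ≤ 70 by
      simp only [Term.cost]; omega)
    rw [I.size_eq]
    simp only [Term.cost] at this ⊢
    omega

/-! ### Searching for marked vertices -/

/-- The levels of all vertices and the chosen lowest vertices are in place. -/
structure Based (I : Input n) (G : Digraph (Fin n)) (c : ℕ → Fin n)
    (e : ℕ → Fin I.edges.length) (L : Bool → Fin n → ℤ) (p : Bool → ℕ) (s : State) : Prop
    extends Leveled I G c e L s where
  base : ∀ σ, s.reg (base σ) = p σ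

theorem Based.frame {L : Bool → Fin n → ℤ} {p : Bool → ℕ} {q : Program} {s s' : State}
    (h : Based I G c e L p s) (hf : Frame q s s') (hr : ∀ r ∈ [0, 1, 20, 21], q.keepsReg r = true)
    (ha : ∀ a ∈ [0, 3, 4, 5, 6, 7], q.keepsArr a = true) : Based I G c e L p s' :=
  ⟨h.toLeveled.frame hf (hr _ (by simp)) (hr _ (by simp)) ha, fun σ => by
    rw [hf.reg _ (hr _ (by cases σ <;> simp [RAM.base]))]; exact h.base σ⟩

theorem markTest_iff {L : Bool → Fin n → ℤ} {p : Bool → ℕ} (σ : Bool) {s : State}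
    (hs : Based I G c e L p s) (hp : ∀ σ, p σ < n) {k : ℕ} (hk : k < 3 * n) (h22 : s.reg 22 = k) :
    (markTest σ).Holds s ↔ Mark L (fun σ => c (p σ)) σ (c k) := by
  have h4k := hs.tour k hk
  have h4p := hs.tour (p σ) (by have := hp σ; omega)
  simp [markTest, h22, h4k, hs.base σ, h4p, hs.level, Mark, Fin.val_inj]

/-- A mark at a position below `3 * n` guarantees that the search ends, stays within the recorded
tour, and takes linear time. -/
theorem runs_search {L : Bool → Fin n → ℤ} {p : Bool → ℕ} (σ : Bool) (x : ℕ)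
    (hx : x = 23 ∨ x = 24 ∨ x = 25) {s : State} (hs : Based I G c e L p s) (hp : ∀ σ, p σ < n)
    {j₀ : ℕ} (h22 : s.reg 22 = j₀)
    (hex : ∃ j, j₀ ≤ j ∧ j < 3 * n ∧ Mark L (fun σ => c (p σ)) σ (c j)) :
    Runs (search σ x) s (300 * I.size) fun s' => ∃ j, j₀ ≤ j ∧ s'.reg 22 = j ∧ s'.reg x = j ∧
      Mark L (fun σ => c (p σ)) σ (c j) ∧
      ∀ k, j₀ ≤ k → k < j → ¬ Mark L (fun σ => c (p σ)) σ (c k) := by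
  classical
  obtain ⟨hj1, hj2, hj3⟩ := Nat.find_spec hex
  have hmin := fun k (hk : k < Nat.find hex) => Nat.find_min hex hk
  set j := Nat.find hex
  have hx22 : (incr 22).keepsReg x = true := by rcases hx with rfl | rfl | rfl <;> rfl
  refine Runs.le (B := _ + 2) ((Runs.loop_run (b := .not (markTest σ)) (p := incr 22) rfl (j - j₀)
    (fun k s' => s'.reg 22 = (j₀ + k : ℕ)) (by simpa using h22)
    (fun k hk s' hf hr => ⟨?_, ?_⟩) fun s' hf hr => ?_).seq fun s₁ hf₁ hr₁ =>
      (Runs.of_run (p := assign x (reg 22)) rfl ⟨j, hj1, ?_, ?_, hj3, fun k hk hk' hm =>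
        hmin k hk' ⟨hk, by omega, hm⟩⟩)) ?_
  · have hs' := hs.frame hf (by decide) (by decide)
    rw [Test.Holds, markTest_iff σ hs' hp (by omega) hr]
    exact fun hm => hmin _ (by omega) ⟨by omega, by omega, hm⟩
  · simp [hr]; ring
  · have hs' := hs.frame hf (by decide) (by decide)
    rw [Test.Holds, markTest_iff σ hs' hp (by omega) hr, not_not, Nat.add_sub_cancel' hj1]
    exact hj3
  · rw [Nat.add_sub_cancel' hj1] at hr₁
    rcases hx with rfl | rfl | rfl <;> simpa using hr₁
  · rw [Nat.add_sub_cancel' hj1] at hr₁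
    simpa using hr₁
  · have : (Test.not (markTest σ)).cost + 1 + (incr 22).bound ≤ 50 := by cases σ <;> decide
    have h3 : j - j₀ + 1 ≤ 3 * n + 1 := by omega
    have := Nat.mul_le_mul this h3
    rw [I.size_eq]
    omega

/-! ### The output -/

theorem runs_place {L : Bool → Fin n → ℤ} {j₂ j₃ : ℕ} {s : State} (h : IsTour G c)
    (hs : Leveled I G c e L s)
    (h24 : s.reg 24 = j₂) (h25 : s.reg 25 = j₃) (hj : j₂ + n ≤ 3 * n) :
    Runs (forLoop (reg 0) placeStep) s (100 * I.size) fun s' =>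
      ∀ i < n, s'.arr 8 (c (j₂ + i)) = (if j₂ + i < j₃ then -(i : ℤ) else i) ∧
        s'.arr 9 (c (j₂ + i)) = (if j₂ + i < j₃ then L true (c (j₂ + i)) else -L false (c (j₂ + i))) := by
  refine (Runs.forLoop_run (e := reg 0) n (fun k s' =>
    ∀ i < k, s'.arr 8 (c (j₂ + i)) = (if j₂ + i < j₃ then -(i : ℤ) else i) ∧
        s'.arr 9 (c (j₂ + i)) = (if j₂ + i < j₃ then L true (c (j₂ + i)) else -L false (c (j₂ + i))))
    rfl rfl (fun s' hf => (hf.reg 0 rfl).trans hs.vertices) (by simp)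
    fun k hk s' hf hr hJ i hi => ?_).mono ?_ fun s' hf hJ => hJ
  · have hs' := hs.frame hf rfl rfl (by decide)
    have h4 := hs'.tour (j₂ + k) (by omega)
    have g24 : s'.reg 24 = j₂ := (hf.reg 24 rfl).trans h24
    have g25 : s'.reg 25 = j₃ := (hf.reg 25 rfl).trans h25
    have l1 := hs'.level true (c (j₂ + k))
    have l2 := hs'.level false (c (j₂ + k))
    simp only [lev] at l1 l2
    push_cast at h4
    have hlt : ((j₂ : ℤ) + k < j₃) ↔ j₂ + k < j₃ := by exact_mod_cast Iff.rfl
    rcases Nat.lt_succ_iff_lt_or_eq.1 hi with hi | rfl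
    · have hne : ((c (j₂ + i) : ℕ) : ℤ) ≠ (c (j₂ + k) : ℕ) := fun he => by
        have := h.inj ((natCast_val_eq_iff _ _).1 he) (by omega) (by omega); omega
      by_cases hc : j₂ + k < j₃ <;>
        simp [placeStep, hr, g24, g25, h4, hlt, hc, hne] <;> simpa using hJ i hi
    · by_cases hc : j₂ + i < j₃ <;> simp [placeStep, hr, g24, g25, h4, hlt, hc, l1, l2]
  · simp [placeStep, Test.lt, I.size_eq]; omega

theorem runs_vertices {s : State} (hs : Ready I s) (x y : Fin n → ℤ)
    (hx : ∀ v : Fin n, s.arr 8 v = x v) (hy : ∀ v : Fin n, s.arr 9 v = y v) :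
    Runs (forLoop (reg 0) vertexStep) s (100 * I.size) fun s' =>
      s'.out = s.out ++ (List.finRange n).flatMap fun v => [x v, 1, y v, 1] := by
  refine (Runs.forLoop_run (e := reg 0) n (fun k s' =>
    s'.out = s.out ++ ((List.finRange n).take k).flatMap fun v => [x v, 1, y v, 1])
    rfl rfl (fun s' hf => (hf.reg 0 rfl).trans hs.vertices) (by simp)
    fun k hk s' hf hr hJ => ?_).mono ?_ fun s' hf hJ => ?_
  · have hx' := hx ⟨k, hk⟩
    have hy' := hy ⟨k, hk⟩
    rw [← hf.arr 8 rfl] at hx'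
    rw [← hf.arr 9 rfl] at hy'
    have : (List.finRange n).take (k + 1) = (List.finRange n).take k ++ [⟨k, hk⟩] := by
      rw [List.take_add_one]
      simp [hk]
    simp only at hx' hy'
    rw [this]
    simp [vertexStep, hr, hJ, hx', hy']
  · simp [vertexStep, I.size_eq]; omega
  · rw [hJ, List.take_of_length_le (by simp)]

theorem encodePoint_intCast (a b : ℤ) : PolylineData.encodePoint (a, b) = [a, 1, b, 1] := by
  simp [PolylineData.encodePoint]

/-- The numerator `b + b - 1` is odd, as witnessed by a Bézout identity, so the machine need not
reduce the fraction. -/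
theorem encodePoint_sub_half (a b : ℤ) :
    PolylineData.encodePoint (a, (b : ℚ) - 1 / 2) = [a, 1, b + b - 1, 2] := by
  have h : (b : ℚ) - 1 / 2 = ((b + b - 1 : ℤ) : ℚ) / ((2 : ℤ) : ℚ) := by push_cast; ring
  have hc : Nat.Coprime (b + b - 1).natAbs (2 : ℤ).natAbs :=
    Int.isCoprime_iff_gcd_eq_one.1 ⟨-1, b, by ring⟩
  rw [PolylineData.encodePoint, h, Rat.num_div_eq_of_coprime (by norm_num) hc,
    Rat.den_div_eq_of_coprime (by norm_num) hc]
  simp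

theorem encodePoint_add_half (a b : ℤ) :
    PolylineData.encodePoint (a, (b : ℚ) + 1 / 2) = [a, 1, b + b + 1, 2] := by
  have h : (b : ℚ) + 1 / 2 = ((b + b + 1 : ℤ) : ℚ) / ((2 : ℤ) : ℚ) := by push_cast; ring
  have hc : Nat.Coprime (b + b + 1).natAbs (2 : ℤ).natAbs :=
    Int.isCoprime_iff_gcd_eq_one.1 ⟨1, -b, by ring⟩
  rw [PolylineData.encodePoint, h, Rat.num_div_eq_of_coprime (by norm_num) hc,
    Rat.den_div_eq_of_coprime (by norm_num) hc]
  simp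

theorem runs_edges {s : State} (hs : Prepared I G c e s) (x y : Fin n → ℤ)
    (hx : ∀ v : Fin n, s.arr 8 v = x v) (hy : ∀ v : Fin n, s.arr 9 v = y v) {j₂ j₃ : ℕ}
    (h24 : s.reg 24 = j₂) (h25 : s.reg 25 = j₃) (hj₂ : j₂ < j₃) (hj₃ : j₃ < 3 * n)
    (hn : 0 < n) (hj : j₂ + n ≤ 3 * n) :
    Runs (forLoop (reg 1) edgeStep) s (200 * I.size) fun s' =>
      s'.out = s.out ++ I.edges.flatMap fun ed =>
        (((layout (fun i => c (j₂ + i)) (j₃ - j₂) x y).bends ed).length : ℤ) ::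
          ((layout (fun i => c (j₂ + i)) (j₃ - j₂) x y).bends ed).flatMap
            PolylineData.encodePoint := by
  refine (Runs.forLoop_run (e := reg 1) I.edges.length (fun k s' =>
    s'.out = s.out ++ (I.edges.take k).flatMap fun ed =>
        (((layout (fun i => c (j₂ + i)) (j₃ - j₂) x y).bends ed).length : ℤ) ::
          ((layout (fun i => c (j₂ + i)) (j₃ - j₂) x y).bends ed).flatMap
            PolylineData.encodePoint)
    rfl rfl (fun s' hf => (hf.reg 1 rfl).trans hs.edges) (by simp)
    fun k hk s' hf hr hJ => ?_).mono ?_ fun s' hf hJ => ?_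
  · have hs' := hs.frame hf rfl rfl rfl rfl rfl rfl
    have ht := hs'.tail ⟨k, hk⟩
    have hh := hs'.head ⟨k, hk⟩
    have hx' : ∀ v : Fin n, s'.arr 8 v = x v := by rw [hf.arr 8 rfl]; exact hx
    have hy' : ∀ v : Fin n, s'.arr 9 v = y v := by rw [hf.arr 9 rfl]; exact hy
    have g24 : s'.reg 24 = j₂ := (hf.reg 24 rfl).trans h24
    have g25 : s'.reg 25 = j₃ := (hf.reg 25 rfl).trans h25
    have t1 := hs'.tour (j₃ - 1) (by omega)
    have t2 := hs'.tour j₃ hj₃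
    have t3 := hs'.tour j₂ (by omega)
    have t4 := hs'.tour (j₂ + n - 1) (by omega)
    rw [Nat.cast_sub (by omega)] at t1 t4
    push_cast at t1 t4
    have htake : I.edges.take (k + 1) = I.edges.take k ++ [I.edges.get ⟨k, hk⟩] := by
      rw [List.take_add_one]
      simp [hk]
    rw [htake, List.flatMap_append, ← List.append_assoc, ← hJ]
    simp only at ht hh
    generalize I.edges.get ⟨k, hk⟩ = uv at *
    obtain ⟨u, v⟩ := uv
    simp only at ht hh
    have e1 : j₂ + (j₃ - j₂ - 1) = j₃ - 1 := by omega
    have e2 : j₂ + (j₃ - j₂) = j₃ := by omega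
    have e3 : j₂ + (n - 1) = j₂ + n - 1 := by omega
    simp only [layout, e1, e2, e3, add_zero, Prod.mk.injEq, List.flatMap_cons, List.flatMap_nil,
      List.append_nil]
    by_cases h1 : u = c (j₃ - 1) ∧ v = c j₃
    · obtain ⟨rfl, rfl⟩ := h1
      simp [edgeStep, hr, ht, hh, g25, t1, t2, hx', hy', -one_div, encodePoint_sub_half]
    · have h1' : ¬ (((u : ℕ) : ℤ) = (c (j₃ - 1) : ℕ) ∧ ((v : ℕ) : ℤ) = (c j₃ : ℕ)) := by
        rwa [natCast_val_eq_iff, natCast_val_eq_iff]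
      by_cases h2 : u = c j₂ ∧ v = c (j₂ + n - 1)
      · rw [if_neg h1]
        obtain ⟨rfl, rfl⟩ := h2
        simp [edgeStep, hr, ht, hh, g24, g25, t1, t2, t3, t4, hx', hy', hs'.vertices, -one_div,
          -Nat.cast_inj, h1', encodePoint_add_half]
      · have h2' : ¬ (((u : ℕ) : ℤ) = (c j₂ : ℕ) ∧ ((v : ℕ) : ℤ) = (c (j₂ + n - 1) : ℕ)) := by
          rwa [natCast_val_eq_iff, natCast_val_eq_iff]
        rw [if_neg h1, if_neg h2]
        simp [edgeStep, hr, ht, hh, g24, g25, t1, t2, t3, t4, hs'.vertices,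
          -Nat.cast_inj, h1', h2']
  · simp [edgeStep, I.size_eq]; omega
  · rw [hJ, List.take_of_length_le le_rfl]

end RAM

/-! ### Layouts from marks -/

namespace IsExtreme

variable {n : ℕ} {I : Input n} {L : Bool → Fin n → ℤ} {a : Bool → Fin n} {G : Digraph (Fin n)}
  {c : ℕ → Fin n} {e : ℕ → Fin I.edges.length}

theorem lt_of_adj (h : IsExtreme I L a) (hr : IsRoute I G c e) {u v : Fin n} (huv : G.Adj u v) :
    L true u < L true v ∧ L false v < L false u := by
  obtain ⟨k, hk⟩ := List.mem_iff_get.1 ((hr.mem_edges _ _).2 huv)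
  have h1 := (h.lowest true).lt k
  have h2 := (h.lowest false).lt k
  simp only [Input.tail, Input.head, cond_true, cond_false, hk] at h1 h2
  exact ⟨h1, h2⟩

/-- If the marks do not alternate, the tour splits into two paths, the vertices of which are
placed at their lowest and at their highest levels, respectively. -/
theorem isLayout (h : IsExtreme I L a) (hr : IsRoute I G c e) {j₁ j₂ : ℕ} (h12 : j₁ < j₂)
    (h2 : j₂ < j₁ + n) (m2 : Mark L a true (c j₂)) (m3 : Mark L a false (c (j₁ + n)))
    (n2 : ∀ k, j₁ ≤ k → k < j₂ → ¬ Mark L a true (c k))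
    (n3 : ∀ k, j₂ ≤ k → k < j₁ + n → ¬ Mark L a false (c k)) {x y : Fin n → ℤ}
    (hx : ∀ i < n, x (c (j₂ + i)) = if j₂ + i < j₁ + n then -(i : ℤ) else i)
    (hy : ∀ i < n, y (c (j₂ + i)) =
      if j₂ + i < j₁ + n then L true (c (j₂ + i)) else -L false (c (j₂ + i))) :
    IsLayout G (fun i => c (j₂ + i)) (j₁ + n - j₂) x y (L true (a true)) (-L false (a false)) := by
  have hn := hr.tour.three_le
  have eK : j₂ + (j₁ + n - j₂) = j₁ + n := by omega
  have yl : ∀ k, j₂ ≤ k → k < j₁ + n → y (c k) = L true (c k) := fun k hk hk' => by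
    have := hy (k - j₂) (by omega)
    rwa [Nat.add_sub_cancel' hk, if_pos hk'] at this
  have yr : ∀ k, j₁ + n ≤ k → k < j₂ + n → y (c k) = -L false (c k) := fun k hk hk' => by
    have := hy (k - j₂) (by omega)
    rwa [Nat.add_sub_cancel' (by omega), if_neg (by omega)] at this
  refine ⟨hr.tour.shift j₂, by omega, by omega, fun i hi => ?_, fun i hi hi' => ?_,
    fun u v huv => ?_, fun i hi => ?_, fun i hi hi' => ?_, ?_, ?_, ?_, ?_⟩
  · rw [hx i (by omega), if_pos (by omega)]
  · rw [hx i (by omega), if_neg (by omega)]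
  · obtain ⟨l1, l2⟩ := h.lt_of_adj hr huv
    have b := h.add_le true v
    simp only [Bool.not_true] at b
    obtain ⟨k, hk, hk', hc⟩ := hr.tour.exists_step huv j₂
    have wrap : k + 1 = j₂ + n → c (k + 1) = c j₂ := fun h => by rw [h, hr.tour.add_period]
    have y0 : y (c j₂) = L true (c j₂) := yl j₂ le_rfl h2
    rcases hc with ⟨rfl, rfl⟩ | ⟨rfl, rfl⟩
    -- `c j₂` is a source and `c (j₁ + n)` is a sink, so both connecting edges lead from the left
    -- path to the right path. They rise because the lowest level of the tail is below that of the
    -- head, hence below the highest level of the head.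
    · have hne : k + 1 ≠ j₂ + n := fun h' => h.adj_of_mark_true hr m2 (wrap h' ▸ huv)
      rcases Nat.lt_or_ge k (j₁ + n) with hlt | hge
      · rw [yl k hk hlt]
        rcases Nat.lt_or_ge (k + 1) (j₁ + n) with hlt' | hge'
        · rwa [yl _ (by omega) hlt']
        · rw [yr _ hge' (by omega)]; omega
      · rw [yr k hge hk', yr _ (by omega) (by omega)]; omega
    · rcases Nat.lt_or_ge k (j₁ + n) with hlt | hge
      · have hne : k + 1 ≠ j₁ + n := fun h' => h.adj_of_mark_false hr m3 (h' ▸ huv)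
        rwa [yl k hk hlt, yl _ (by omega) (by omega)]
      · rw [yr k hge hk']
        by_cases h' : k + 1 = j₂ + n
        · rw [wrap h'] at l1 ⊢
          rw [y0]; omega
        · rw [yr _ (by omega) (by omega)]; omega
  · have := h.lt_of_not_mark (n3 (j₂ + i) (by omega) (by omega))
    rw [yl _ (by omega) (by omega)]
    simp only [Bool.not_false] at this
    omega
  -- The right path is the stretch from `j₁` to `j₂`, which has no bottom marks, one turn later.
  · have hper : c (j₂ + i) = c (j₂ + i - n) := by
      rw [← hr.tour.add_period (j₂ + i - n), Nat.sub_add_cancel (by omega)]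
    have := h.lt_of_not_mark (n2 (j₂ + i - n) (by omega) (by omega))
    rwa [yr _ (by omega) (by omega), hper]
  · exact (yl j₂ le_rfl h2).trans (h.eq_of_mark m2)
  · rw [eK, yr _ le_rfl (by omega), h.eq_of_mark m3]
  · have e1 : j₂ + (j₁ + n - j₂ - 1) + 1 = j₁ + n := by omega
    have := hr.tour.step (j₂ + (j₁ + n - j₂ - 1))
    rw [e1] at this
    simp only [eK]
    exact this.resolve_right (h.adj_of_mark_false hr m3)
  · have e1 : j₂ + (n - 1) + 1 = j₂ + n := by omega
    have := hr.tour.step (j₂ + (n - 1))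
    rw [e1, hr.tour.add_period] at this
    exact this.resolve_left (h.adj_of_mark_true hr m2)

end IsExtreme

/-! ### Correctness of the whole program -/

namespace RAM

open Program Term Test

attribute [local simp] Program.run Term.eval Test.Holds Term.cost Test.cost Program.bound
  tailTerm headTerm incr

variable {n : ℕ} {I : Input n} {G : Digraph (Fin n)} {ℓ : Fin n → Finset ℤ} {c : ℕ → Fin n}
  {e : ℕ → Fin I.edges.length}

/-- The output is as specified. -/
def Correct (I : Input n) (G : Digraph (Fin n)) (ℓ : Fin n → Finset ℤ) (o : List ℤ) : Prop :=
  ((¬ ∃ D : Drawing G, D.IsMultilevelPlanar ℓ) → o = [0]) ∧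
  ((∃ D : Drawing G, D.IsMultilevelPlanar ℓ) →
    ∃ (P : PolylineData n) (D : Drawing G),
      D.IsMultilevelPlanar ℓ ∧ P.Describes D ∧ o = 1 :: P.encode I.edges)

theorem runs_reject (h : ¬ ∃ D : Drawing G, D.IsMultilevelPlanar ℓ) {s : State}
    (hs : s.out = []) : Runs (output (const 0)) s 2 fun s' => Correct I G ℓ s'.out :=
  Runs.of_run rfl ⟨fun _ => by simp [hs], fun h' => absurd h' h⟩

theorem runs_draw (hr : IsRoute I G c e) (hI : I.Represents G ℓ) {L : Bool → Fin n → ℤ}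
    {a : Bool → Fin n} (h : IsExtreme I L a) {j₁ j₂ : ℕ} (h12 : j₁ < j₂) (h2 : j₂ < j₁ + n)
    (hj₁ : j₁ < 2 * n) (hj₂ : j₂ ≤ 2 * n)
    (m2 : Mark L a true (c j₂)) (m3 : Mark L a false (c (j₁ + n)))
    (n2 : ∀ k, j₁ ≤ k → k < j₂ → ¬ Mark L a true (c k))
    (n3 : ∀ k, j₂ ≤ k → k < j₁ + n → ¬ Mark L a false (c k)) {s : State}
    (hs : Leveled I G c e L s) (h24 : s.reg 24 = j₂) (h25 : s.reg 25 = (j₁ + n : ℕ))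
    (ho : s.out = []) :
    Runs draw s (500 * I.size) fun s' => Correct I G ℓ s'.out := by
  have hn := hr.tour.three_le
  have h1 : Runs (output (const 1)) s 2 fun s' => s'.out = [1] :=
    Runs.of_run rfl (by simp [ho])
  refine Runs.le (B := 2 + (100 * I.size + (100 * I.size + 200 * I.size)))
    (h1.seq fun s₁ hf₁ ho₁ => (runs_place (j₂ := j₂) (j₃ := j₁ + n) hr.tour
      (hs.frame hf₁ rfl rfl (by decide)) ((hf₁.reg 24 rfl).trans h24) ((hf₁.reg 25 rfl).trans h25)
      (by omega)).seq fun s₂ hf₂ hxy => ?_) (by have := I.size_eq; omega)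
  have hs₂ : Leveled I G c e L s₂ :=
    (hs.frame hf₁ rfl rfl (by decide)).frame hf₂ rfl rfl (by decide)
  have g24 : s₂.reg 24 = j₂ := (hf₂.reg 24 rfl).trans ((hf₁.reg 24 rfl).trans h24)
  have g25 : s₂.reg 25 = (j₁ + n : ℕ) := (hf₂.reg 25 rfl).trans ((hf₁.reg 25 rfl).trans h25)
  have hlay := h.isLayout hr h12 h2 m2 m3 n2 n3 (x := fun v => s₂.arr 8 v)
    (y := fun v => s₂.arr 9 v) (fun i hi => (hxy i hi).1) fun i hi => (hxy i hi).2
  obtain ⟨D, hD, hP⟩ := hlay.exists_drawing (ℓ := ℓ) fun v => by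
    obtain ⟨k, hk, hk', rfl⟩ := hr.tour.surj v j₂
    obtain ⟨i, rfl⟩ := Nat.exists_eq_add_of_le hk
    rw [← Input.mem_levels_true hI, (hxy i (by omega)).2]
    split_ifs
    · exact (h.lowest true).mem _
    · exact Input.neg_mem_levels ((h.lowest false).mem _)
  refine (runs_vertices hs₂.toReady (fun v => s₂.arr 8 v) (fun v => s₂.arr 9 v) (fun _ => rfl)
    fun _ => rfl).seq fun s₃ hf₃ ho₃ => (runs_edges (j₂ := j₂) (j₃ := j₁ + n)
      (hs₂.toPrepared.frame hf₃ rfl rfl rfl rfl rfl rfl)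
      (fun v => s₂.arr 8 v) (fun v => s₂.arr 9 v) (fun v => congrFun (hf₃.arr 8 rfl) _)
      (fun v => congrFun (hf₃.arr 9 rfl) _) ((hf₃.reg 24 rfl).trans g24)
      ((hf₃.reg 25 rfl).trans g25) h2 (by omega) (by omega) (by omega)).mono le_rfl
      fun s₄ hf₄ ho₄ => ?_
  refine ⟨fun hno => absurd ⟨D, hD⟩ hno, fun _ => ⟨_, D, hD, hP, ?_⟩⟩
  rw [ho₄, ho₃, hf₂.out rfl, ho₁, PolylineData.encode]
  simp only [layout, encodePoint_intCast]
  simp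

theorem runs_decideAndDraw (hr : IsRoute I G c e) (hI : I.Represents G ℓ) {L : Bool → Fin n → ℤ}
    (hL : ∀ σ, I.IsLowest σ (L σ)) {s : State} (hs : Leveled I G c e L s) (ho : s.out = []) :
    Runs decideAndDraw s (2100 * I.size) fun s' => Correct I G ℓ s'.out := by
  have hn := hr.tour.three_le
  refine Runs.le (B := 300 * I.size + (300 * I.size + (2 + (300 * I.size + (300 * I.size +
    (300 * I.size + (10 + 500 * I.size))))))) ?_ (by have := I.size_eq; omega)
  refine (runs_argmin hr.tour true hs).seq fun s₁ hf₁ ⟨p₁, hp₁, h20, le₁⟩ => ?_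
  have hs₁ := hs.frame hf₁ rfl rfl (by decide)
  refine (runs_argmin hr.tour false hs₁).seq fun s₂ hf₂ ⟨p₂, hp₂, h21, le₂⟩ => ?_
  have hs₂ := hs₁.frame hf₂ rfl rfl (by decide)
  set p : Bool → ℕ := fun σ => bif σ then p₁ else p₂ with hpdef
  have hb₂ : Based I G c e L p s₂ := ⟨hs₂, fun σ => by
    cases σ
    · exact h21
    · exact (hf₂.reg 20 rfl).trans h20⟩
  have hp : ∀ σ, p σ < n := by rintro (_ | _) <;> assumption
  have hE : IsExtreme I L fun σ => c (p σ) := ⟨hL, by rintro (_ | _) <;> assumption⟩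
  have h22 : Runs (assign 22 (reg 20)) s₂ 2 fun s' => s'.reg 22 = (p₁ : ℕ) :=
    Runs.of_run rfl (by simpa using (hf₂.reg 20 rfl).trans h20)
  refine h22.seq fun s₃ hf₃ h22 => ?_
  have hb₃ := hb₂.frame hf₃ (by decide) (by decide)
  obtain ⟨k₁, hk₁, hk₁', hck₁⟩ := hr.tour.surj (c (p false)) p₁
  refine (runs_search false 23 (by simp) hb₃ hp h22 ⟨k₁, hk₁, by omega, .inr hck₁⟩).seq
    fun s₄ hf₄ ⟨j₁, hj₁, r22, r23, m1, n1⟩ => ?_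
  have hb₄ := hb₃.frame hf₄ (by decide) (by decide)
  -- The chosen vertex of each side is itself marked and is met within one turn, which bounds the
  -- search.
  have hj₁' : j₁ < p₁ + n := by
    by_contra hlt
    exact n1 k₁ hk₁ (by omega) (.inr hck₁)
  have hcp : c (p₁ + n) = c (p true) := hr.tour.add_period p₁
  refine (runs_search true 24 (by simp) hb₄ hp r22 ⟨p₁ + n, by omega, by omega, .inr hcp⟩).seq
    fun s₅ hf₅ ⟨j₂, hj₂, r22, r24, m2, n2⟩ => ?_
  have hb₅ := hb₄.frame hf₅ (by decide) (by decide)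
  have hj₂' : j₂ ≤ p₁ + n := by
    by_contra hlt
    exact n2 (p₁ + n) (by omega) (by omega) (.inr hcp)
  have m1' : Mark L (fun σ => c (p σ)) false (c (j₁ + n)) := by rwa [hr.tour.add_period]
  have h12 : j₁ ≠ j₂ := by rintro rfl; exact hE.not_mark_both hr m2 m1
  have h12n : j₂ ≠ j₁ + n := by rintro rfl; exact hE.not_mark_both hr m2 m1'
  have hj₂n : j₂ < j₁ + n := by omega
  refine (runs_search false 25 (by simp) hb₅ hp r22 ⟨j₁ + n, by omega, by omega, m1'⟩).seq
    fun s₆ hf₆ ⟨j₃, hj₃, _, r25, m3, n3⟩ => ?_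
  have hb₆ := hb₅.frame hf₆ (by decide) (by decide)
  have hj₃' : j₃ ≤ j₁ + n := by
    by_contra hlt
    exact n3 (j₁ + n) (by omega) (by omega) m1'
  have r23' : s₆.reg 23 = j₁ := (hf₆.reg 23 rfl).trans ((hf₅.reg 23 rfl).trans r23)
  have r24' : s₆.reg 24 = j₂ := (hf₆.reg 24 rfl).trans r24
  have ho' : s₆.out = [] := by
    rw [hf₆.out rfl, hf₅.out rfl, hf₄.out rfl, hf₃.out rfl, hf₂.out rfl, hf₁.out rfl, ho]
  refine Runs.le (B := (le (add (reg 23) (reg 0)) (reg 25)).cost + 1 + 500 * I.size)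
    (Runs.ite (fun hb => ?_) fun hb => ?_) (by simp only [Test.cost, Term.cost]; omega)
  · have : j₁ + n ≤ j₃ := by
      simp only [Test.Holds, Term.eval, r23', r25, hb₆.vertices] at hb
      exact_mod_cast hb
    obtain rfl : j₃ = j₁ + n := by omega
    exact runs_draw hr hI hE (by omega) hj₂n (by omega) (by omega) m2 m3 n2 n3 hb₆.toLeveled
      r24' r25 ho'
  · have : j₃ < j₁ + n := by
      simp only [Test.Holds, Term.eval, r23', r25, hb₆.vertices] at hb
      omega
    refine (runs_reject ?_ ho').le (by have := I.size_eq; omega)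
    have h23 : j₂ ≠ j₃ := by rintro rfl; exact hE.not_mark_both hr m2 m3
    have h01 : p₁ ≠ j₁ := by
      rintro rfl; exact hE.not_mark_both hr (.inr rfl) m1
    -- Otherwise `j₃ - n` would be a top mark between `p₁` and `j₁`, and the first search would have
    -- found it. So the four marks alternate within one turn.
    have h3 : j₃ < p₁ + n := by
      by_contra hge
      refine n1 (j₃ - n) (by omega) (by omega) ?_
      rwa [← hr.tour.add_period, Nat.sub_add_cancel (by omega)]
    exact hE.not_drawable hr hI (p := p₁) (q := j₁) (r := j₂) (s := j₃) (by omega) (by omega)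
      (by omega) h3 (.inr rfl) m1 m2 m3

theorem not_drawable_of_not_isLeveling (hI : I.Represents G ℓ) {σ : Bool}
    (h : ∀ y, ¬ I.IsLeveling σ y) : ¬ ∃ D : Drawing G, D.IsMultilevelPlanar ℓ := by
  rintro ⟨D, hD⟩
  obtain ⟨y, hy, -⟩ := Input.exists_leveling hI hD
  cases σ
  · exact h _ hy.neg
  · exact h _ hy

theorem runs_levels (hr : IsRoute I G c e) (hI : I.Represents G ℓ) {s : State}
    (hs : Prepared I G c e s) (h9 : s.reg 9 = 0) (ho : s.out = []) :
    Runs levels s (5000 * I.size) fun s' => Correct I G ℓ s'.out := by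
  have hz := I.size_eq
  refine Runs.le (B := 1000 * I.size + (5 + (1000 * I.size + (5 + 2100 * I.size)))) ?_ (by omega)
  refine (runs_solve hr (σ := true) hs h9).seq fun s₁ hf₁ h₁ => ?_
  have hs₁ := hs.frame hf₁ rfl rfl rfl rfl rfl rfl
  have ho₁ : s₁.out = [] := (hf₁.out rfl).trans ho
  refine Runs.le (B := (eq (reg 9) (const 0)).cost + 1 + (1000 * I.size + (5 + 2100 * I.size)))
    (Runs.ite (fun hb => ?_) fun hb => ?_) (by simp only [Test.cost, Term.cost]; omega)
  · have h9₁ : s₁.reg 9 = 0 := by simpa using hb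
    have hL₁ := (h₁.resolve_right fun h => by omega).2
    refine (runs_solve hr (σ := false) hs₁ h9₁).seq fun s₂ hf₂ h₂ => ?_
    have hs₂ := hs₁.frame hf₂ rfl rfl rfl rfl rfl rfl
    have ho₂ : s₂.out = [] := (hf₂.out rfl).trans ho₁
    refine Runs.le (B := (eq (reg 9) (const 0)).cost + 1 + 2100 * I.size)
      (Runs.ite (fun hb => ?_) fun hb => ?_) (by simp only [Test.cost, Term.cost]; omega)
    · have h9₂ : s₂.reg 9 = 0 := by simpa using hb
      have hL₂ := (h₂.resolve_right fun h => by omega).2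
      refine runs_decideAndDraw hr hI (L := fun σ v => s₂.arr (lev σ) v) (fun σ => ?_)
        ⟨hs₂, fun _ _ => rfl⟩ ho₂
      cases σ
      · exact hL₂
      · rw [show s₂.arr (lev true) = s₁.arr (lev true) from hf₂.arr 6 rfl]; exact hL₁
    · have h9₂ : s₂.reg 9 ≠ 0 := by simpa using hb
      exact (runs_reject (not_drawable_of_not_isLeveling hI
        (h₂.resolve_left fun h => h9₂ h.1).2) ho₂).le (by omega)
  · have h9₁ : s₁.reg 9 ≠ 0 := by simpa using hb
    exact (runs_reject (not_drawable_of_not_isLeveling hI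
      (h₁.resolve_left fun h => h9₁ h.1).2) ho₁).le (by omega)

/-- If every tail of an edge is the head of an edge, there is no drawing. -/
theorem not_drawable_of_no_source (hG : IsOrientedCycle G) (hI : I.Represents G ℓ)
    (h : ∀ k, ∃ j, (I.edges.get j).2 = (I.edges.get k).1) :
    ¬ ∃ D : Drawing G, D.IsMultilevelPlanar ℓ := by
  rintro ⟨D, hD⟩
  obtain ⟨y, hy, -⟩ := Input.exists_leveling hI hD
  obtain ⟨u, v, huv⟩ := hG.exists_adj
  obtain ⟨k₀, -⟩ := List.mem_iff_get.1 ((hI.mem_edges _ _).2 huv)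
  have : Nonempty (Fin I.edges.length) := ⟨k₀⟩
  -- Take an edge whose tail is lowest. An edge that ends at this tail has an even lower tail.
  obtain ⟨k, hk⟩ := Finite.exists_min fun k => y (I.tail true k)
  obtain ⟨j, hj⟩ := h k
  have h1 := hk j
  have h2 := hy.lt j
  simp only [Input.tail, Input.head, cond_true, hj] at h1 h2
  omega

theorem runs_mainProgram (hG : IsOrientedCycle G) (hI : I.Represents G ℓ) :
    Runs mainProgram (init I.encode) (6000 * I.size) fun s' => Correct I G ℓ s'.out := by
  have hz := I.size_eq
  refine Runs.le (B := 200 * I.size + (5 + (20 + (50 * (n + 1) + (500 * (n + 1) +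
    5000 * I.size))))) ?_ (by omega)
  refine (runs_prepare hG hI).seq fun s₁ hf₁ ⟨hs₁, hE, hsrc⟩ => ?_
  have ho₁ : s₁.out = [] := hf₁.out rfl
  refine Runs.le (B := (eq (reg 4) (const 0)).cost + 1 + (20 + (50 * (n + 1) + (500 * (n + 1) +
    5000 * I.size)))) (Runs.ite (fun hb => ?_) fun hb => ?_)
    (by simp only [Test.cost, Term.cost]; omega)
  · have h4 : s₁.reg 4 = 0 := by simpa using hb
    exact (runs_reject (not_drawable_of_no_source hG hI
      (hsrc.resolve_right fun h => by omega).2) ho₁).le (by omega)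
  · have h4 : s₁.reg 4 ≠ 0 := by simpa using hb
    obtain ⟨-, k, h3, hk⟩ := hsrc.resolve_left fun h => h4 h.1
    obtain ⟨c, e, hr, hc, he⟩ := hG.exists_route hI k fun u hu => by
      obtain ⟨j, hj⟩ := List.mem_iff_get.1 ((hI.mem_edges _ _).2 hu)
      exact hk j (by rw [hj])
    have ht := hs₁.tail k
    have hw : Runs walkInit s₁ 20 fun s' => s'.reg 8 = 2 + 2 * I.edges.length ∧
        s'.reg 5 = (c 0 : ℕ) ∧ s'.reg 6 = (e 0 : ℕ) := by
      refine (Runs.of_run rfl ?_).le (by decide)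
      rw [hc, he, ← ht]
      refine ⟨?_, ?_, ?_⟩
      · simp [walkInit, hs₁.edges]; ring
      · simp [walkInit, h3]
      · simp [walkInit, h3]
    refine hw.seq fun s₂ hf₂ ⟨h8, h5, h6⟩ => ?_
    have hs₂ := hs₁.frame hf₂ rfl rfl rfl
    refine (runs_offset hs₂ h8).seq fun s₃ hf₃ hoff => ?_
    have hs₃ := hs₂.frame hf₃ rfl rfl rfl
    refine (runs_walk hr hs₃ ?_ ((hf₃.reg 5 rfl).trans h5) ((hf₃.reg 6 rfl).trans h6) ?_).seq
      fun s₄ hf₄ ⟨htour, horder⟩ => ?_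
    · rw [hf₃.arr 1 rfl, hf₂.arr 1 rfl]; exact hE
    · rw [hf₃.reg 7 rfl, hf₂.reg 7 rfl, hf₁.reg 7 rfl]; rfl
    refine runs_levels hr hI ⟨hs₃.frame hf₄ rfl rfl rfl, ?_, htour, horder⟩ ?_ ?_
    · rw [hf₄.arr 3 rfl]; exact hoff
    · rw [hf₄.reg 9 rfl, hf₃.reg 9 rfl, hf₂.reg 9 rfl, hf₁.reg 9 rfl]; rfl
    · rw [hf₄.out rfl, hf₃.out rfl, hf₂.out rfl, ho₁]

end RAM
end MultilevelPlanarity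

theorem mainTheorem4 :
    ∃ (p : MultilevelPlanarity.RAM.Program) (C : ℕ),
      ∀ (n : ℕ) (G : Digraph (Fin n)) (ℓ : Fin n → Finset ℤ) (I : MultilevelPlanarity.Input n),
        MultilevelPlanarity.IsOrientedCycle G → I.Represents G ℓ →
          ∃ (t : ℕ) (o : List ℤ),
            MultilevelPlanarity.RAM.Computes p I.encode t o ∧ t ≤ C * I.size ∧
            ((¬ ∃ D : MultilevelPlanarity.Drawing G, D.IsMultilevelPlanar ℓ) → o = [0]) ∧
            ((∃ D : MultilevelPlanarity.Drawing G, D.IsMultilevelPlanar ℓ) →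
              ∃ (P : MultilevelPlanarity.PolylineData n) (D : MultilevelPlanarity.Drawing G),
                D.IsMultilevelPlanar ℓ ∧ P.Describes D ∧ o = 1 :: P.encode I.edges) := by
  refine ⟨MultilevelPlanarity.RAM.mainProgram, 6000, fun n G ℓ I hG hI => ?_⟩
  obtain ⟨t, s, h, ht, hs⟩ := MultilevelPlanarity.RAM.runs_mainProgram hG hI
  exact ⟨t, s.out, ⟨s, h, rfl⟩, ht, hs⟩
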